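/- Let $d\ge 1$ be an integer and $\varepsilon>0$. On the complex Hilbert space $L^2(\mathbb{R}^d)$ consider the harmonic oscillator $$\mathbf{h}:=c_d(-\Delta+|x|^2),\qquad c_d:=\frac{e^e}{d},$$ with its self-adjoint domain, so that $\mathbf{h}\ge e^e$. Its spectrum consists of eigenvalues and its eigenvectors span a dense subspace; functions of $\mathbf{h}$ are defined by the functional calculus. There is a constant $C>0$, depending only on $d$ and $\varepsilon$, such that the following holds. Let $V:\mathbb{R}^d\to\mathbb{R}$ be measurable with $V\ge 0$ almost everywhere, put $v:=V^{1/2}$, and assume that $v\in L^2(\mathbb{R}^d)$ lies in the domain of $(\ln\mathbf{h})^{1/2}(\ln\ln\mathbf{h})^{1/2+\varepsilon}$. Let $H:=(-\Delta)^{d/2}-V$ be the operator on $L^2(\mathbb{R}^d)$ associated with the quadratic form $\|(-\Delta)^{d/4}u\|_{L^2}^2-\|V^{1/2}u\|_{L^2}^2$ on $\{u\in H^{d/2}(\mathbb{R}^d) : V^{1/2}u\in L^2\}$, and let $N_{<0}(H)$ be the number of its negative eigenvalues, counted with multiplicity. Then $$N_{<0}\big((-\Delta)^{d/2}-V\big)-1\;\le\;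 C\,\big\|(\ln\mathbf{h})^{1/2}(\ln\ln\mathbf{h})^{1/2+\varepsilon}\,v\big\|_{L^2}^2 .$$ In particular $N_{<0}(H)$ is finite. -/

import Mathlib

open MeasureTheory FourierTransform Laplacian
open scoped SchwartzMap ENNReal ComplexConjugate

noncomputable section

namespace BoundStates

/-- The space `ℝ^d` with its Euclidean norm. -/
abbrev Space (d : ℕ) : Type := EuclideanSpace ℝ (Fin d)

/-- The complex Hilbert space `L²(ℝ^d)`. -/
abbrev L2 (d : ℕ) : Type := Lp ℂ 2 (volume : Measure (Space d))

/-! ### Eigenspaces and functions of a partially defined operator -/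

section Operators

variable {H : Type*} [NormedAddCommGroup H] [InnerProductSpace ℂ H]

/-- The eigenspace `{u ∈ D(A) | A u = lam u}` of a partially defined operator `A`. -/
def eigenspace (A : H →ₗ.[ℂ] H) (lam : ℝ) : Submodule ℂ H where
  carrier := {u | (u, (lam : ℂ) • u) ∈ A.graph}
  zero_mem' := by
    rw [Set.mem_ofPred_eq, smul_zero]
    exact A.graph.zero_mem
  add_mem' {u w} hu hw := by
    rw [Set.mem_ofPred_eq, smul_add]
    exact A.graph.add_mem hu hw
  smul_mem' c u hu := by
    rw [Set.mem_ofPred_eq, smul_comm]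
    exact A.graph.smul_mem c hu

/-- `N_{<0}(A)`: the number of negative eigenvalues of `A`, each one counted with its
multiplicity, the dimension of its eigenspace. -/
def numNegEigenvalues (A : H →ₗ.[ℂ] H) : ℝ≥0∞ :=
  ∑' lam : Set.Iio (0 : ℝ), ((Module.rank ℂ (eigenspace A lam)).toENat : ℝ≥0∞)

variable [CompleteSpace H]

/-- The orthogonal projection onto the eigenspace of `A` for `lam`. (The eigenspaces of a closed
operator are closed, so that the closure has no effect there.) -/
def eigenprojection (A : H →ₗ.[ℂ] H) (lam : ℝ) : H →L[ℂ] H :=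
  (eigenspace A lam).topologicalClosure.starProjection

/-- The operator `f(A) = ∑_lam f(lam) P_lam` of the functional calculus, for a self-adjoint
operator `A` whose eigenvectors span a dense subspace. Its domain is the set of those `u` for which
`∑_lam f(lam) P_lam u` converges; as the `P_lam` have mutually orthogonal ranges this
means `∑_lam |f(lam)|² ‖P_lam u‖² < ∞`. -/
def functionOf (A : H →ₗ.[ℂ] H) (f : ℝ → ℝ) : H →ₗ.[ℂ] H where
  domain :=
    { carrier := {u | Summable fun lam : ℝ => (f lam : ℂ) • eigenprojection A lam u}
      zero_mem' := by simp
      add_mem' := fun {u w} hu hw => by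
        have h := Summable.add hu hw
        simpa [smul_add] using h
      smul_mem' := fun c u hu => by
        have h := Summable.const_smul c hu
        simpa [smul_comm c] using h }
  toFun :=
    { toFun := fun u => ∑' lam : ℝ, (f lam : ℂ) • eigenprojection A lam (u : H)
      map_add' := fun u w => by
        rw [← Summable.tsum_add u.2 w.2]
        simp [smul_add]
      map_smul' := fun c u => by
        rw [RingHom.id_apply, ← Summable.tsum_const_smul c u.2]
        simp [smul_comm c] }

end Operators

/-! ### The harmonic oscillator -/

/-- The differential expression `c_d (-Δ + |x|²)`, `c_d = e^e / d`, on tempered distributions. -/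
def oscillatorExpr (d : ℕ) : 𝓢'(Space d, ℂ) →ₗ[ℂ] 𝓢'(Space d, ℂ) :=
  ((Real.exp (Real.exp 1) / d : ℝ) : ℂ) •
    (-(LineDeriv.laplacianCLM ℂ (Space d) 𝓢'(Space d, ℂ) :
        𝓢'(Space d, ℂ) →ₗ[ℂ] 𝓢'(Space d, ℂ)) +
      (TemperedDistribution.smulLeftCLM ℂ (fun x : Space d => ((‖x‖ ^ 2 : ℝ) : ℂ)) :
        𝓢'(Space d, ℂ) →ₗ[ℂ] 𝓢'(Space d, ℂ)))

/-- The graph of the harmonic oscillator: the pairs `(u, f)` in `L²` with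
`c_d (-Δ u + |x|² u) = f` in the sense of distributions. -/
def oscillatorGraph (d : ℕ) : Submodule ℂ (L2 d × L2 d) where
  carrier := {p | oscillatorExpr d (p.1 : 𝓢'(Space d, ℂ)) = (p.2 : 𝓢'(Space d, ℂ))}
  zero_mem' := by
    simp [← Lp.toTemperedDistributionCLM_apply]
  add_mem' {p q} hp hq := by
    simp only [Set.mem_ofPred_eq, ← Lp.toTemperedDistributionCLM_apply] at hp hq ⊢
    rw [Prod.fst_add, Prod.snd_add, map_add, map_add, map_add, hp, hq]
  smul_mem' c p hp := by
    simp only [Set.mem_ofPred_eq, ← Lp.toTemperedDistributionCLM_apply] at hp ⊢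
    rw [Prod.smul_fst, Prod.smul_snd, map_smul, map_smul, map_smul, hp]

/-- The harmonic oscillator `h = c_d (-Δ + |x|²)`, `c_d = e^e / d`, with its self-adjoint domain
`{u ∈ L² | -Δ u + |x|² u ∈ L²}`. -/
def oscillator (d : ℕ) : L2 d →ₗ.[ℂ] L2 d := (oscillatorGraph d).toLinearPMap

/-- The operator `oscillator d` does have the graph it is defined by. -/
theorem graph_oscillator (d : ℕ) : (oscillator d).graph = oscillatorGraph d := by
  refine Submodule.toLinearPMap_graph_eq _ fun p hp h0 => ?_
  have hp' : oscillatorExpr d (p.1 : 𝓢'(Space d, ℂ)) = (p.2 : 𝓢'(Space d, ℂ)) := hp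
  rw [h0, ← Lp.toTemperedDistributionCLM_apply, ← Lp.toTemperedDistributionCLM_apply, map_zero,
    map_zero] at hp'
  have h1 := Lp.ker_toTemperedDistributionCLM_eq_bot (E := Space d) (F := ℂ) (p := 2)
    (μ := volume)
  exact LinearMap.ker_eq_bot'.1 h1 p.2 hp'.symm

/-- The operator `(ln h)^{1/2} (ln ln h)^{1/2 + ε}`. -/
def logWeight (d : ℕ) (ε : ℝ) : L2 d →ₗ.[ℂ] L2 d :=
  functionOf (oscillator d) fun t =>
    Real.log t ^ (1 / 2 : ℝ) * Real.log (Real.log t) ^ (1 / 2 + ε)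

/-! ### The fractional Schrödinger operator -/

/-- The Fourier transform of `(-Δ)^{s/2} u`, that is `(2π|ξ|)^s û(ξ)` with the convention
`û(ξ) = ∫ exp(-2πi x·ξ) u(x) dx`. -/
def kineticRoot {d : ℕ} (s : ℝ) (u : L2 d) : Space d → ℂ :=
  fun ξ => (((2 * Real.pi * ‖ξ‖) ^ s : ℝ) : ℂ) * (𝓕 u : L2 d) ξ

/-- The function `V^{1/2} u`. -/
def potentialRoot {d : ℕ} (V : Space d → ℝ) (u : L2 d) : Space d → ℂ :=
  fun x => (√(V x) : ℂ) * u x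

theorem kineticRoot_add {d : ℕ} (s : ℝ) (u w : L2 d) :
    kineticRoot s (u + w) =ᵐ[volume] kineticRoot s u + kineticRoot s w := by
  have h : (𝓕 (u + w) : L2 d) = 𝓕 u + 𝓕 w := FourierAdd.fourier_add u w
  filter_upwards [Lp.coeFn_add (𝓕 u : L2 d) (𝓕 w)] with ξ hξ
  simp only [kineticRoot, h, Pi.add_apply] at hξ ⊢
  rw [hξ, mul_add]

theorem kineticRoot_smul {d : ℕ} (s : ℝ) (c : ℂ) (u : L2 d) :
    kineticRoot s (c • u) =ᵐ[volume] c • kineticRoot s u := by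
  have h : (𝓕 (c • u) : L2 d) = c • 𝓕 u := FourierSMul.fourier_smul c u
  filter_upwards [Lp.coeFn_smul c (𝓕 u : L2 d)] with ξ hξ
  simp [kineticRoot, h, hξ, mul_left_comm]

theorem potentialRoot_add {d : ℕ} (V : Space d → ℝ) (u w : L2 d) :
    potentialRoot V (u + w) =ᵐ[volume] potentialRoot V u + potentialRoot V w := by
  filter_upwards [Lp.coeFn_add u w] with x hx
  simp only [potentialRoot, Pi.add_apply] at hx ⊢
  rw [hx, mul_add]

theorem potentialRoot_smul {d : ℕ} (V : Space d → ℝ) (c : ℂ) (u : L2 d) :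
    potentialRoot V (c • u) =ᵐ[volume] c • potentialRoot V u := by
  filter_upwards [Lp.coeFn_smul c u] with x hx
  simp [potentialRoot, hx, mul_left_comm]

/-- The form domain `{u ∈ H^s | V^{1/2} u ∈ L²}` of `(-Δ)^s - V`, `V ≥ 0`. -/
def formDomain {d : ℕ} (s : ℝ) (V : Space d → ℝ) : Submodule ℂ (L2 d) where
  carrier := {u | MemLp (kineticRoot s u) 2 volume ∧ MemLp (potentialRoot V u) 2 volume}
  zero_mem' := by
    have h1 := kineticRoot_smul s 0 (0 : L2 d)
    have h2 := potentialRoot_smul V 0 (0 : L2 d)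
    rw [zero_smul, zero_smul] at h1 h2
    exact ⟨(memLp_congr_ae h1).2 MemLp.zero, (memLp_congr_ae h2).2 MemLp.zero⟩
  add_mem' {u w} hu hw :=
    ⟨(memLp_congr_ae (kineticRoot_add s u w)).2 (hu.1.add hw.1),
      (memLp_congr_ae (potentialRoot_add V u w)).2 (hu.2.add hw.2)⟩
  smul_mem' c u hu :=
    ⟨(memLp_congr_ae (kineticRoot_smul s c u)).2 (hu.1.const_smul c),
      (memLp_congr_ae (potentialRoot_smul V c u)).2 (hu.2.const_smul c)⟩

/-- The sesquilinear form `⟨(-Δ)^{s/2} w, (-Δ)^{s/2} u⟩ - ⟨V^{1/2} w, V^{1/2} u⟩` of `(-Δ)^s - V`,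
`V ≥ 0`, antilinear in `w`. -/
def schrodingerForm {d : ℕ} (s : ℝ) (V : Space d → ℝ) (w u : L2 d) : ℂ :=
  (∫ ξ, conj (kineticRoot s w ξ) * kineticRoot s u ξ) -
    ∫ x, conj (potentialRoot V w x) * potentialRoot V u x

theorem integrable_conj_mul {d : ℕ} {f g : Space d → ℂ} (hf : MemLp f 2 volume)
    (hg : MemLp g 2 volume) : Integrable (fun x => conj (f x) * g x) volume :=
  MemLp.integrable_mul (p := 2) (q := 2) hf.star hg

theorem schrodingerForm_add {d : ℕ} {s : ℝ} {V : Space d → ℝ} {w u u' : L2 d}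
    (hw : w ∈ formDomain s V) (hu : u ∈ formDomain s V) (hu' : u' ∈ formDomain s V) :
    schrodingerForm s V w (u + u') = schrodingerForm s V w u + schrodingerForm s V w u' := by
  have h1 : (∫ ξ, conj (kineticRoot s w ξ) * kineticRoot s (u + u') ξ) =
      (∫ ξ, conj (kineticRoot s w ξ) * kineticRoot s u ξ) +
        ∫ ξ, conj (kineticRoot s w ξ) * kineticRoot s u' ξ := by
    rw [← integral_add (integrable_conj_mul hw.1 hu.1) (integrable_conj_mul hw.1 hu'.1)]
    refine integral_congr_ae ?_
    filter_upwards [kineticRoot_add s u u'] with ξ hξ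
    simp [hξ, mul_add]
  have h2 : (∫ x, conj (potentialRoot V w x) * potentialRoot V (u + u') x) =
      (∫ x, conj (potentialRoot V w x) * potentialRoot V u x) +
        ∫ x, conj (potentialRoot V w x) * potentialRoot V u' x := by
    rw [← integral_add (integrable_conj_mul hw.2 hu.2) (integrable_conj_mul hw.2 hu'.2)]
    refine integral_congr_ae ?_
    filter_upwards [potentialRoot_add V u u'] with x hx
    simp [hx, mul_add]
  rw [schrodingerForm, h1, h2, schrodingerForm, schrodingerForm]
  ring

theorem schrodingerForm_smul {d : ℕ} (s : ℝ) (V : Space d → ℝ) (c : ℂ) (w u : L2 d) :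
    schrodingerForm s V w (c • u) = c * schrodingerForm s V w u := by
  have h1 : (∫ ξ, conj (kineticRoot s w ξ) * kineticRoot s (c • u) ξ) =
      c * ∫ ξ, conj (kineticRoot s w ξ) * kineticRoot s u ξ := by
    rw [← integral_const_mul]
    refine integral_congr_ae ?_
    filter_upwards [kineticRoot_smul s c u] with ξ hξ
    simp [hξ, mul_left_comm]
  have h2 : (∫ x, conj (potentialRoot V w x) * potentialRoot V (c • u) x) =
      c * ∫ x, conj (potentialRoot V w x) * potentialRoot V u x := by
    rw [← integral_const_mul]
    refine integral_congr_ae ?_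
    filter_upwards [potentialRoot_smul V c u] with x hx
    simp [hx, mul_left_comm]
  rw [schrodingerForm, h1, h2, schrodingerForm]
  ring

/-- The graph of the operator associated with the form: the pairs `(u, f)` with `u` in the form
domain and `q(w, u) = ⟨w, f⟩` for all `w` in the form domain. -/
def schrodingerGraph {d : ℕ} (s : ℝ) (V : Space d → ℝ) : Submodule ℂ (L2 d × L2 d) where
  carrier := {p | p.1 ∈ formDomain s V ∧
    ∀ w ∈ formDomain s V, schrodingerForm s V w p.1 = inner ℂ w p.2}
  zero_mem' := by
    refine ⟨(formDomain s V).zero_mem, fun w _ => ?_⟩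
    have h := schrodingerForm_smul s V 0 w 0
    simpa using h
  add_mem' {p q} hp hq := by
    refine ⟨(formDomain s V).add_mem hp.1 hq.1, fun w hw => ?_⟩
    simp [schrodingerForm_add hw hp.1 hq.1, hp.2 w hw, hq.2 w hw, inner_add_right]
  smul_mem' c p hp := by
    refine ⟨(formDomain s V).smul_mem c hp.1, fun w hw => ?_⟩
    simp [schrodingerForm_smul, hp.2 w hw, inner_smul_right]

/-- The fractional Schrödinger operator `H_s = (-Δ)^s - V` on `L²(ℝ^d)`, for `V ≥ 0`, as the
operator associated with its quadratic form. -/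
def schrodinger {d : ℕ} (s : ℝ) (V : Space d → ℝ) : L2 d →ₗ.[ℂ] L2 d :=
  (schrodingerGraph s V).toLinearPMap

theorem schwartz_mem_formDomain {d : ℕ} {s : ℝ} (hs : 0 ≤ s) {V : Space d → ℝ}
    (hV : MemLp (fun x => ((√(V x) : ℝ) : ℂ)) 2 volume) (φ : 𝓢(Space d, ℂ)) :
    (φ.toLp 2 : L2 d) ∈ formDomain s V := by
  constructor
  · let g : Space d → ℂ := fun ξ => (((1 + ‖ξ‖ ^ 2) ^ (s / 2) : ℝ) : ℂ)
    have hg : g.HasTemperateGrowth := by fun_prop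
    have hψ := (SchwartzMap.smulLeftCLM ℂ g (𝓕 φ)).memLp 2 (volume : Measure (Space d))
    have hF : ((𝓕 (φ.toLp 2 : L2 d) : L2 d) : Space d → ℂ) =ᵐ[volume] (𝓕 φ : 𝓢(Space d, ℂ)) := by
      rw [SchwartzMap.toLp_fourier_eq]
      exact SchwartzMap.coeFn_toLp _ _ _
    refine (hψ.const_mul (((2 * Real.pi) ^ s : ℝ) : ℂ)).mono ?_ ?_
    · refine AEStronglyMeasurable.mul ?_ (Lp.aestronglyMeasurable _)
      exact (by fun_prop : Measurable fun ξ : Space d =>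
        (((2 * Real.pi * ‖ξ‖) ^ s : ℝ) : ℂ)).aestronglyMeasurable
    · filter_upwards [hF] with ξ hξ
      have h1 : (0 : ℝ) ≤ (2 * Real.pi * ‖ξ‖) ^ s := by positivity
      have h2 : ‖ξ‖ ^ s ≤ (1 + ‖ξ‖ ^ 2) ^ (s / 2) := by
        have h3 : ‖ξ‖ ^ s = (‖ξ‖ ^ 2) ^ (s / 2) := by
          rw [← Real.rpow_natCast_mul (norm_nonneg ξ)]
          congr 1
          push_cast
          ring
        rw [h3]
        exact Real.rpow_le_rpow (by positivity) (by linarith) (by positivity)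
      have h4 : (2 * Real.pi * ‖ξ‖) ^ s ≤ (2 * Real.pi) ^ s * (1 + ‖ξ‖ ^ 2) ^ (s / 2) := by
        rw [Real.mul_rpow (by positivity) (norm_nonneg ξ)]
        gcongr
      simp only [kineticRoot, hξ, SchwartzMap.smulLeftCLM_apply_apply hg, g, norm_mul, smul_eq_mul,
        Complex.norm_real, Real.norm_eq_abs]
      rw [← mul_assoc, abs_of_nonneg h1, abs_of_nonneg (by positivity),
        abs_of_nonneg (by positivity)]
      gcongr
  · refine MemLp.ae_eq ?_ (hV.mul (r := 2) (φ.memLp_top (volume : Measure (Space d))))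
    filter_upwards [φ.coeFn_toLp 2 (volume : Measure (Space d))] with x hx
    simp [potentialRoot, hx, mul_comm]

/-- If `V^{1/2} ∈ L²` then the form domain is dense, so that the graph above is the graph of an
operator. -/
theorem graph_schrodinger {d : ℕ} {s : ℝ} (hs : 0 ≤ s) {V : Space d → ℝ}
    (hV : MemLp (fun x => ((√(V x) : ℝ) : ℂ)) 2 volume) :
    (schrodinger s V).graph = schrodingerGraph s V := by
  refine Submodule.toLinearPMap_graph_eq _ fun p hp h0 => ?_
  have hd : DenseRange (SchwartzMap.toLpCLM ℂ (E := Space d) ℂ 2 volume) :=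
    SchwartzMap.denseRange_toLpCLM ENNReal.ofNat_ne_top
  have hd' : Dense (formDomain s V : Set (L2 d)) := by
    refine hd.mono ?_
    rintro _ ⟨φ, rfl⟩
    exact schwartz_mem_formDomain hs hV φ
  refine hd'.eq_zero_of_inner_right ℂ fun w hw => ?_
  rw [← hp.2 w hw, h0]
  have h := schrodingerForm_smul s V 0 w 0
  simpa using h

end BoundStates

end

noncomputable section

namespace BoundStates

variable {d : ℕ}

/-! ### The Fourier transform on `L¹ ∩ L²` -/

/-! Take `N` orthonormal eigenvectors with negative eigenvalues. On their span the form is negative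
definite: with `K u = (2π|ξ|)^{d/2} û`, `P u = v u` and `v = V^{1/2}` one has `‖K u‖ ≤ ‖P u‖`, and
`P` is injective. Restricting to the kernel of the single functional `u ↦ ∫_{|ξ|<1} û` costs at most
one dimension, which is the `-1` of the theorem; it is needed because `|ξ|^{-d/2}` just fails to be
square integrable at the origin. In what remains, choose `u_i`, `i ≤ N'`, `N ≤ N' + 1`, with `g_i =
v u_i` orthonormal. Then the `a_i = K u_i` satisfy Bessel's inequality
(`exists_orthonormal_of_contraction`) and `û_i = (2π|ξ|)^{-d/2} a_i`.

Now `N' = ∑ ‖g_i‖² = ∑ ∫ conj(g_i) v u_i`. The right side is treated as linear in `v`, with `g_i`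
and `a_i` remembered only as Bessel families. The core is `exists_block_le`: if `B` is a combination
of Hermite functions of degree at most `n`, then `∑ |∫ conj(f_i) B u_i| ≤ C √N' √(1 + log(2n+d))
‖B‖`. Expand `v` in Hermite functions and group them into blocks `B_j` with `log h ≈ 2^j`. The cost
of a block is `2^{j/2} ‖B_j‖`, the weight `(ln h)^{1/2} (ln ln h)^{1/2+ε}` beats it by the square
summable factor `j^{-(1/2+ε)}`, and Cauchy–Schwarz in `j` gives `N' ≤ C √N' √M`, that is `N' ≤ C²
M`, where `M` is the squared norm on the right of the theorem (`exists_sum_partial_le`).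

For one block put `R = √(2n+d)`; the oscillator identity says that `B` lives essentially in `|x|,
|ξ| ≲ R`. Frequencies `|ξ| ≤ R` of `u_i` are handled pointwise: Bessel's inequality for `a_i` gives
`∑ |u_i(x)|² ≤ C (1 + log R + |x|²/R²)`, and `∫ |x|² |B|² ≤ R² ‖B‖²` (`exists_sum_low_le`).
Frequencies `|ξ| > R` are handled by a phase-space version of Cwikel's argument, using a Gaussian
short-time Fourier transform at length scale `1/R` (`exists_sum_high_le`): phase space is cut along
a level set comparing a local majorant of `B` with `(1+|p|²/R²)^{d/4}`. On one side Bessel's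
inequality is used at each point, on the other Plancherel for each `i`, and the level is chosen to
balance the two. -/

theorem integral_mul_fourier_eq {f g : Space d → ℂ} (hf : Integrable f) (hg : Integrable g) :
    ∫ ξ, 𝓕 g ξ * f ξ = ∫ x, g x * 𝓕 f x := by
  simpa using! VectorFourier.integral_fourierIntegral_smul_eq_flip (L := innerₗ (Space d))
    (μ := volume) (ν := volume) Real.continuous_fourierChar continuous_inner hg hf

theorem continuous_fourier {f : Space d → ℂ} (hf : Integrable f) : Continuous (𝓕 f) :=
  VectorFourier.fourierIntegral_continuous Real.continuous_fourierChar
    (by exact continuous_inner) hf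

/-- On `L¹ ∩ L²`, the `L²`-Fourier transform is given by the Fourier integral. -/
theorem fourier_toLp_ae_eq {f : Space d → ℂ} (h1 : Integrable f) (h2 : MemLp f 2 volume) :
    ((𝓕 (h2.toLp f) : L2 d) : Space d → ℂ) =ᵐ[volume] 𝓕 f := by
  refine ae_eq_of_integral_contDiff_smul_eq
    ((Lp.memLp _).locallyIntegrable (by norm_num)) (continuous_fourier h1).locallyIntegrable ?_
  intro g g_smooth g_cpt
  have hg₁ : HasCompactSupport (Complex.ofRealCLM ∘ g) := g_cpt.comp_left rfl
  have hg₂ : ContDiff ℝ (⊤ : ℕ∞) (Complex.ofRealCLM ∘ g) := by fun_prop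
  set φ : 𝓢(Space d, ℂ) := hg₁.toSchwartzMap hg₂ with hφ
  have hφ' : ∀ x, φ x = (g x : ℂ) := fun x => rfl
  have h3 := congrArg (fun T : 𝓢'(Space d, ℂ) => T φ)
    (Lp.fourier_toTemperedDistribution_eq (h2.toLp f))
  simp only [TemperedDistribution.fourier_apply, Lp.toTemperedDistribution_apply] at h3
  have h4 : ∫ x, (𝓕 φ) x • (h2.toLp f) x = ∫ x, (𝓕 φ) x * f x := by
    refine integral_congr_ae ?_
    filter_upwards [h2.coeFn_toLp] with x hx
    rw [hx, smul_eq_mul]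
  rw [h4, SchwartzMap.fourier_coe, integral_mul_fourier_eq h1 φ.integrable] at h3
  simpa [hφ'] using h3.symm

theorem fourierInv_eq_fourier_comp_neg' (f : Space d → ℂ) :
    𝓕⁻ f = fun x => 𝓕 f (-x) := by
  ext x
  rw [Real.fourierInv_eq_fourier_neg]

theorem enorm_sq_eq_lintegral (f : L2 d) : ‖f‖ₑ ^ 2 = ∫⁻ x, ‖f x‖ₑ ^ 2 := by
  rw [Lp.enorm_def, eLpNorm_eq_lintegral_rpow_enorm_toReal (by norm_num) (by norm_num)]
  simp only [ENNReal.toReal_ofNat, one_div, ENNReal.rpow_ofNat]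
  rw [← ENNReal.rpow_natCast, ← ENNReal.rpow_mul]
  simp

theorem lintegral_fourier_sq {f : Space d → ℂ} (h1 : Integrable f) (h2 : MemLp f 2 volume) :
    ∫⁻ ξ, ‖𝓕 f ξ‖ₑ ^ 2 = ∫⁻ x, ‖f x‖ₑ ^ 2 := by
  have hn : ‖(𝓕 (h2.toLp f) : L2 d)‖ₑ = ‖h2.toLp f‖ₑ := by
    rw [← ofReal_norm, ← ofReal_norm, Lp.norm_fourier_eq]
  calc ∫⁻ ξ, ‖𝓕 f ξ‖ₑ ^ 2 = ∫⁻ ξ, ‖(𝓕 (h2.toLp f) : L2 d) ξ‖ₑ ^ 2 := by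
        refine lintegral_congr_ae ?_
        filter_upwards [fourier_toLp_ae_eq h1 h2] with x hx
        rw [hx]
    _ = ∫⁻ x, ‖(h2.toLp f) x‖ₑ ^ 2 := by rw [← enorm_sq_eq_lintegral, hn, enorm_sq_eq_lintegral]
    _ = _ := by
        refine lintegral_congr_ae ?_
        filter_upwards [h2.coeFn_toLp] with x hx
        rw [hx]

theorem lintegral_fourierInv_sq {f : Space d → ℂ} (h1 : Integrable f) (h2 : MemLp f 2 volume) :
    ∫⁻ ξ, ‖𝓕⁻ f ξ‖ₑ ^ 2 = ∫⁻ x, ‖f x‖ₑ ^ 2 := by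
  rw [← lintegral_fourier_sq h1 h2, fourierInv_eq_fourier_comp_neg']
  exact lintegral_neg_eq_self (fun x => ‖𝓕 f x‖ₑ ^ 2)

theorem inner_eq_integral (f g : L2 d) : inner ℂ f g = ∫ x, conj (f x) * g x := by
  rw [L2.inner_def]
  simp [mul_comm]

theorem inner_toLp_eq_integral {f g : Space d → ℂ} (hf : MemLp f 2 volume)
    (hg : MemLp g 2 volume) : inner ℂ (hf.toLp f) (hg.toLp g) = ∫ x, conj (f x) * g x := by
  rw [inner_eq_integral]
  refine integral_congr_ae ?_
  filter_upwards [hf.coeFn_toLp, hg.coeFn_toLp] with x h1 h2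
  rw [h1, h2]

theorem integral_conj_fourier_mul {f g : Space d → ℂ} (hf1 : Integrable f)
    (hf2 : MemLp f 2 volume) (hg1 : Integrable g) (hg2 : MemLp g 2 volume) :
    ∫ ξ, conj (𝓕 f ξ) * 𝓕 g ξ = ∫ x, conj (f x) * g x := by
  rw [← inner_toLp_eq_integral hf2 hg2, ← Lp.inner_fourier_eq, inner_eq_integral]
  refine integral_congr_ae ?_
  filter_upwards [fourier_toLp_ae_eq hf1 hf2, fourier_toLp_ae_eq hg1 hg2] with x h1 h2
  rw [h1, h2]

theorem fourierInv_toLp_ae_eq {f : Space d → ℂ} (h1 : Integrable f) (h2 : MemLp f 2 volume) :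
    ((𝓕⁻ (h2.toLp f) : L2 d) : Space d → ℂ) =ᵐ[volume] 𝓕⁻ f := by
  refine ae_eq_of_integral_contDiff_smul_eq
    ((Lp.memLp _).locallyIntegrable (by norm_num)) ?_ ?_
  · rw [fourierInv_eq_fourier_comp_neg']
    exact ((continuous_fourier h1).comp continuous_neg).locallyIntegrable
  intro g g_smooth g_cpt
  have hg₁ : HasCompactSupport (Complex.ofRealCLM ∘ g) := g_cpt.comp_left rfl
  have hg₂ : ContDiff ℝ (⊤ : ℕ∞) (Complex.ofRealCLM ∘ g) := by fun_prop
  set φ : 𝓢(Space d, ℂ) := hg₁.toSchwartzMap hg₂ with hφ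
  have hφ' : ∀ x, φ x = (g x : ℂ) := fun x => rfl
  have h3 := congrArg (fun T : 𝓢'(Space d, ℂ) => T φ)
    (Lp.fourierInv_toTemperedDistribution_eq (h2.toLp f))
  simp only [TemperedDistribution.fourierInv_apply, Lp.toTemperedDistribution_apply] at h3
  have h4 : ∫ x, (𝓕⁻ φ) x • (h2.toLp f) x = ∫ x, (𝓕⁻ φ) x * f x := by
    refine integral_congr_ae ?_
    filter_upwards [h2.coeFn_toLp] with x hx
    rw [hx, smul_eq_mul]
  have h5 : ∫ x, (𝓕⁻ φ) x * f x = ∫ x, φ x * 𝓕⁻ f x := by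
    rw [SchwartzMap.fourierInv_coe, fourierInv_eq_fourier_comp_neg',
      fourierInv_eq_fourier_comp_neg', ← integral_neg_eq_self]
    simp only [neg_neg]
    rw [integral_mul_fourier_eq (f := fun x => f (-x)) h1.comp_neg φ.integrable]
    refine integral_congr_ae (.of_forall fun x => ?_)
    simp only
    congr 1
    rw [← Real.fourierInv_eq_fourier_neg, Real.fourierInv_eq_fourier_comp_neg]
  rw [h4, h5] at h3
  simpa [hφ'] using h3.symm

/-! ### Radial integrals -/

theorem lintegral_fun_norm [NeZero d] {f : ℝ → ℝ≥0∞} (hf : Measurable f) :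
    ∫⁻ x : Space d, f ‖x‖ = (d * volume (Metric.ball (0 : Space d) 1)) *
      ∫⁻ y in Set.Ioi (0 : ℝ), ENNReal.ofReal (y ^ (d - 1)) * f y := by
  have hn : Nontrivial (Space d) := inferInstance
  calc ∫⁻ x : Space d, f ‖x‖
      = ∫⁻ x : ({(0)}ᶜ : Set (Space d)), f ‖x.1‖ ∂((volume : Measure (Space d)).comap (↑)) := by
        rw [lintegral_subtype_comap (measurableSet_singleton _).compl (fun x => f ‖x‖),
          MeasureTheory.restrict_compl_singleton]
    _ = ∫⁻ x, f x.2 ∂(volume : Measure (Space d)).toSphere.prod (.volumeIoiPow (d - 1)) := by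
        have h := (volume : Measure (Space d)).measurePreserving_homeomorphUnitSphereProd
        simp only [finrank_euclideanSpace, Fintype.card_fin] at h
        rw [← h.lintegral_comp (by fun_prop)]
        simp
    _ = (volume : Measure (Space d)).toSphere Set.univ *
          ∫⁻ x : Set.Ioi (0 : ℝ), f x ∂.volumeIoiPow (d - 1) := by
        rw [lintegral_prod _ (by fun_prop)]
        simp [mul_comm]
    _ = _ := by
        rw [Measure.toSphere_apply_univ]
        simp only [finrank_euclideanSpace, Fintype.card_fin]
        congr 1
        rw [Measure.volumeIoiPow, lintegral_withDensity_eq_lintegral_mul _ (by fun_prop)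
          (by fun_prop)]
        exact lintegral_subtype_comap measurableSet_Ioi
          (fun a => ENNReal.ofReal (a ^ (d - 1)) * f a)

/-- The area of the unit sphere. -/
def sphereArea (d : ℕ) : ℝ≥0∞ := d * volume (Metric.ball (0 : Space d) 1)

theorem sphereArea_ne_top : sphereArea d ≠ ⊤ :=
  ENNReal.mul_ne_top (by simp) measure_ball_lt_top.ne

theorem setLIntegral_ball_norm_rpow [NeZero d] {α : ℝ} (hα : 0 < d + α) {ρ : ℝ} (hρ : 0 ≤ ρ) :
    ∫⁻ x in Metric.ball (0 : Space d) ρ, ENNReal.ofReal (‖x‖ ^ α) =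
      sphereArea d * ENNReal.ofReal (ρ ^ (d + α) / (d + α)) := by
  have hd : 1 ≤ d := NeZero.one_le
  have h1 : ∫⁻ x in Metric.ball (0 : Space d) ρ, ENNReal.ofReal (‖x‖ ^ α) =
      ∫⁻ x : Space d, (Set.Iio ρ).indicator (fun y => ENNReal.ofReal (y ^ α)) ‖x‖ := by
    rw [← lintegral_indicator measurableSet_ball]
    refine lintegral_congr fun x => ?_
    simp [Set.indicator]
  rw [h1, lintegral_fun_norm (by measurability), sphereArea]
  congr 1
  have h2 : ∫⁻ y in Set.Ioi (0 : ℝ), ENNReal.ofReal (y ^ (d - 1)) *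
      (Set.Iio ρ).indicator (fun y => ENNReal.ofReal (y ^ α)) y =
      ∫⁻ y in Set.Ioo 0 ρ, ENNReal.ofReal (y ^ (d + α - 1)) := by
    rw [← lintegral_indicator measurableSet_Ioi, ← lintegral_indicator measurableSet_Ioo]
    refine lintegral_congr fun y => ?_
    by_cases hy : 0 < y <;> by_cases hy' : y < ρ <;> simp [Set.indicator, hy, hy']
    rw [← ENNReal.ofReal_mul (by positivity), ← Real.rpow_natCast, ← Real.rpow_add hy]
    push_cast [Nat.cast_sub hd]
    ring_nf
  rw [h2, ← ofReal_integral_eq_lintegral_ofReal, ← integral_Ioc_eq_integral_Ioo,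
    ← intervalIntegral.integral_of_le hρ, integral_rpow (by left; linarith)]
  · rw [sub_add_cancel, Real.zero_rpow hα.ne', sub_zero]
  · exact (intervalIntegral.intervalIntegrable_rpow' (by linarith)).1.mono_set
      (by exact Set.Ioo_subset_Ioc_self)
  · exact (ae_restrict_iff' measurableSet_Ioo).2 (.of_forall fun y hy => Real.rpow_nonneg hy.1.le _)

theorem setLIntegral_annulus [NeZero d] {r ρ : ℝ} (hr : 0 < r) (hρ : r ≤ ρ) :
    ∫⁻ x in {x : Space d | r ≤ ‖x‖ ∧ ‖x‖ ≤ ρ}, ENNReal.ofReal (‖x‖ ^ (-d : ℝ)) =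
      sphereArea d * ENNReal.ofReal (Real.log (ρ / r)) := by
  have hd : 1 ≤ d := NeZero.one_le
  have hm : MeasurableSet {x : Space d | r ≤ ‖x‖ ∧ ‖x‖ ≤ ρ} := by measurability
  have h1 : ∫⁻ x in {x : Space d | r ≤ ‖x‖ ∧ ‖x‖ ≤ ρ}, ENNReal.ofReal (‖x‖ ^ (-d : ℝ)) =
      ∫⁻ x : Space d, (Set.Icc r ρ).indicator (fun y => ENNReal.ofReal (y ^ (-d : ℝ))) ‖x‖ := by
    rw [← lintegral_indicator hm]
    refine lintegral_congr fun x => ?_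
    simp [Set.indicator]
  rw [h1, lintegral_fun_norm (by measurability), sphereArea]
  congr 1
  have h2 : ∫⁻ y in Set.Ioi (0 : ℝ), ENNReal.ofReal (y ^ (d - 1)) *
      (Set.Icc r ρ).indicator (fun y => ENNReal.ofReal (y ^ (-d : ℝ))) y =
      ∫⁻ y in Set.Icc r ρ, ENNReal.ofReal (1 / y) := by
    rw [← lintegral_indicator measurableSet_Ioi, ← lintegral_indicator measurableSet_Icc]
    refine lintegral_congr fun y => ?_
    by_cases hy : y ∈ Set.Icc r ρ
    · have hy0 : 0 < y := hr.trans_le hy.1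
      simp only [Set.indicator, Set.mem_Ioi, hy0, hy, if_true]
      rw [← ENNReal.ofReal_mul (by positivity), ← Real.rpow_natCast, ← Real.rpow_add hy0,
        one_div, ← Real.rpow_neg_one]
      push_cast [Nat.cast_sub hd]
      ring_nf
    · simp [Set.indicator_of_notMem hy]
  have hi : IntervalIntegrable (fun y : ℝ => 1 / y) volume r ρ := by
    refine intervalIntegral.intervalIntegrable_one_div (fun y hy => ?_) (by fun_prop)
    rw [Set.uIcc_of_le hρ] at hy
    exact (hr.trans_le hy.1).ne'
  rw [h2, ← ofReal_integral_eq_lintegral_ofReal, integral_Icc_eq_integral_Ioc,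
    ← intervalIntegral.integral_of_le hρ, integral_one_div_of_pos hr (hr.trans_le hρ)]
  · exact (integrableOn_Icc_iff_integrableOn_Ioc).2 hi.1
  · exact (ae_restrict_iff' measurableSet_Icc).2
      (.of_forall fun y hy => by have := hr.trans_le hy.1; simp only [Pi.zero_apply]; positivity)

/-! ### The Gaussian -/

/-- Since `1 + t - t² / 2 ≤ 2`, the exponential that dominates the power is absorbed by the
Gaussian. -/
theorem one_add_pow_mul_exp_le (m : ℕ) {t : ℝ} (ht : 0 ≤ t) :
    (1 + t) ^ m * Real.exp (-t ^ 2 / 2) ≤ m.factorial * Real.exp 2 := by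
  have h1 : (1 + t) ^ m ≤ m.factorial * Real.exp (1 + t) := by
    have h := Real.pow_div_factorial_le_exp (1 + t) (by linarith) m
    rwa [div_le_iff₀ (by positivity), mul_comm] at h
  calc (1 + t) ^ m * Real.exp (-t ^ 2 / 2)
      ≤ m.factorial * Real.exp (1 + t) * Real.exp (-t ^ 2 / 2) := by gcongr
    _ = m.factorial * Real.exp (1 + t + -t ^ 2 / 2) := by rw [mul_assoc, ← Real.exp_add]
    _ ≤ m.factorial * Real.exp 2 := by
        gcongr
        nlinarith [sq_nonneg (t - 1)]

theorem norm_iteratedFDeriv_exp (i : ℕ) (t : ℝ) : ‖iteratedFDeriv ℝ i Real.exp t‖ = Real.exp t := by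
  rw [norm_iteratedFDeriv_eq_norm_iteratedDeriv, iteratedDeriv_eq_iterate, Real.iter_deriv_exp,
    Real.norm_of_nonneg (Real.exp_pos t).le]

/-- The real Gaussian `exp (-|x|² / 2)` as a Schwartz function. -/
def realGaussian (d : ℕ) : 𝓢(Space d, ℝ) where
  toFun x := Real.exp (-‖x‖ ^ 2 / 2)
  smooth' := by
    have h : ContDiff ℝ (⊤ : ℕ∞) fun x : Space d => ‖x‖ ^ 2 := contDiff_norm_sq ℝ
    exact Real.contDiff_exp.comp (h.neg.div_const 2)
  decay' k n := by
    have hg : (fun x : Space d => -‖x‖ ^ 2 / 2).HasTemperateGrowth := by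
      have h : (fun x : Space d => (-1 / 2 : ℝ) * ‖x‖ ^ 2).HasTemperateGrowth := by fun_prop
      convert h using 2
      ring
    obtain ⟨l, C, hC, h⟩ := hg.norm_iteratedFDeriv_le_uniform n
    refine ⟨n.factorial * (max C 1) ^ n * ((k + l * n).factorial * Real.exp 2), fun x => ?_⟩
    have h1 := norm_iteratedFDeriv_comp_le (𝕜 := ℝ) (g := Real.exp) (N := (⊤ : ℕ∞))
      (f := fun x : Space d => -‖x‖ ^ 2 / 2) (n := n) Real.contDiff_exp hg.1
      (by exact_mod_cast le_top) x
      (C := Real.exp (-‖x‖ ^ 2 / 2)) (D := max C 1 * (1 + ‖x‖) ^ l)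
      (fun i _ => (norm_iteratedFDeriv_exp i _).le) (fun i hi hin => ?_)
    · have h2 : ‖x‖ ^ k ≤ (1 + ‖x‖) ^ k := by gcongr; linarith
      calc ‖x‖ ^ k * ‖iteratedFDeriv ℝ n (fun x : Space d => Real.exp (-‖x‖ ^ 2 / 2)) x‖
          ≤ (1 + ‖x‖) ^ k * (n.factorial * Real.exp (-‖x‖ ^ 2 / 2) *
              (max C 1 * (1 + ‖x‖) ^ l) ^ n) := by gcongr; exact h1
        _ = n.factorial * (max C 1) ^ n *
              ((1 + ‖x‖) ^ (k + l * n) * Real.exp (-‖x‖ ^ 2 / 2)) := by ring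
        _ ≤ _ :=
            mul_le_mul_of_nonneg_left (one_add_pow_mul_exp_le _ (norm_nonneg x)) (by positivity)
    -- The chain rule bound asks for `D ^ i` with `1 ≤ i`; the maximum with `1` makes `1 ≤ D`, so
    -- that a bound by `D` is enough.
    · have h3 : (1 : ℝ) ≤ max C 1 * (1 + ‖x‖) ^ l :=
        one_le_mul_of_one_le_of_one_le (le_max_right _ _)
          (one_le_pow₀ (by linarith [norm_nonneg x]))
      calc ‖iteratedFDeriv ℝ i (fun x : Space d => -‖x‖ ^ 2 / 2) x‖
          ≤ C * (1 + ‖x‖) ^ l := h i hin x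
        _ ≤ max C 1 * (1 + ‖x‖) ^ l := by gcongr; exact le_max_left _ _
        _ ≤ _ := le_self_pow₀ h3 (by omega)

/-- The Gaussian `exp (-|x|² / 2)`. -/
def gaussian (d : ℕ) : 𝓢(Space d, ℂ) :=
  SchwartzMap.postcompCLM Complex.ofRealCLM (realGaussian d)

theorem gaussian_apply (x : Space d) : gaussian d x = ((Real.exp (-‖x‖ ^ 2 / 2) : ℝ) : ℂ) := by
  rw [gaussian, SchwartzMap.postcompCLM_apply]
  rfl

/-! ### Position, differentiation and the Hermite spaces -/

/-- Multiplication by the `i`-th coordinate. -/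
def position (i : Fin d) : 𝓢(Space d, ℂ) →ₗ[ℂ] 𝓢(Space d, ℂ) :=
  (SchwartzMap.smulLeftCLM ℂ (fun x : Space d => ((x i : ℝ) : ℂ)) :
    𝓢(Space d, ℂ) →ₗ[ℂ] 𝓢(Space d, ℂ))

/-- The `i`-th partial derivative. -/
def partialDeriv (i : Fin d) : 𝓢(Space d, ℂ) →ₗ[ℂ] 𝓢(Space d, ℂ) :=
  (LineDeriv.lineDerivOpCLM ℂ 𝓢(Space d, ℂ) (EuclideanSpace.single i (1 : ℝ)) :
    𝓢(Space d, ℂ) →ₗ[ℂ] 𝓢(Space d, ℂ))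

theorem hasTemperateGrowth_coord (i : Fin d) :
    (fun x : Space d => ((x i : ℝ) : ℂ)).HasTemperateGrowth :=
  (Complex.ofRealCLM.comp (EuclideanSpace.proj i : Space d →L[ℝ] ℝ)).hasTemperateGrowth

theorem position_apply (i : Fin d) (φ : 𝓢(Space d, ℂ)) (x : Space d) :
    position i φ x = (x i : ℂ) * φ x := by
  rw [position, ContinuousLinearMap.coe_coe,
    SchwartzMap.smulLeftCLM_apply_apply (hasTemperateGrowth_coord i), smul_eq_mul]

theorem partialDeriv_apply (i : Fin d) (φ : 𝓢(Space d, ℂ)) (x : Space d) :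
    partialDeriv i φ x = fderiv ℝ φ x (EuclideanSpace.single i 1) := rfl

theorem partialDeriv_comm (i j : Fin d) (φ : 𝓢(Space d, ℂ)) :
    partialDeriv i (partialDeriv j φ) = partialDeriv j (partialDeriv i φ) := by
  ext x
  have h1 : ∀ v w : Space d, fderiv ℝ (fun y => fderiv ℝ φ y w) x v =
      fderiv ℝ (fderiv ℝ φ) x v w := fun v w => by
    have h : DifferentiableAt ℝ (fderiv ℝ φ) x :=
      ((φ.smooth ⊤).fderiv_right (m := 1) (by norm_cast)).differentiable (by norm_num) x
    rw [fderiv_clm_apply h (by fun_prop)]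
    simp
  have h2 : IsSymmSndFDerivAt ℝ φ x :=
    ((φ.smooth 2).contDiffAt).isSymmSndFDerivAt (by simp)
  calc partialDeriv i (partialDeriv j φ) x
      = fderiv ℝ (fderiv ℝ φ) x (EuclideanSpace.single i 1) (EuclideanSpace.single j 1) := h1 _ _
    _ = fderiv ℝ (fderiv ℝ φ) x (EuclideanSpace.single j 1) (EuclideanSpace.single i 1) :=
        h2.eq _ _
    _ = _ := (h1 _ _).symm

theorem position_comm (i j : Fin d) (φ : 𝓢(Space d, ℂ)) :
    position i (position j φ) = position j (position i φ) := by
  ext x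
  simp only [position_apply]
  ring

theorem partialDeriv_position (i j : Fin d) (φ : 𝓢(Space d, ℂ)) :
    partialDeriv i (position j φ) = position j (partialDeriv i φ) + if i = j then φ else 0 := by
  ext x
  have h1 : (position j φ : Space d → ℂ) = fun y => ((y j : ℝ) : ℂ) * φ y := by
    ext y; exact position_apply j φ y
  have h2 : HasFDerivAt (fun y : Space d => ((y j : ℝ) : ℂ))
      (Complex.ofRealCLM.comp (EuclideanSpace.proj j : Space d →L[ℝ] ℝ)) x :=
    (Complex.ofRealCLM.comp (EuclideanSpace.proj j : Space d →L[ℝ] ℝ)).hasFDerivAt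
  have h3 := h2.mul (φ.hasFDerivAt x)
  rw [partialDeriv_apply, h1]
  refine (congrArg (fun L : Space d →L[ℝ] ℂ => L (EuclideanSpace.single i 1)) h3.fderiv).trans ?_
  by_cases hij : i = j
  · subst hij
    simp [position_apply, partialDeriv_apply]
  · simp [position_apply, partialDeriv_apply, hij, Ne.symm hij]

theorem partialDeriv_gaussian (i : Fin d) :
    partialDeriv i (gaussian d) = -position i (gaussian d) := by
  ext x
  have h0 : (gaussian d : Space d → ℂ) = fun y => ((Real.exp (-‖y‖ ^ 2 / 2) : ℝ) : ℂ) := by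
    ext y; rw [gaussian_apply]
  have h1 : HasFDerivAt (fun y : Space d => Real.exp (-‖y‖ ^ 2 / 2))
      (Real.exp (-‖x‖ ^ 2 / 2) • ((-1 / 2 : ℝ) • (2 • innerSL ℝ x))) x := by
    have h2 := ((hasStrictFDerivAt_norm_sq x).hasFDerivAt.const_mul (-1 / 2 : ℝ)).exp
    have h5 : ∀ y : Space d, -‖y‖ ^ 2 / 2 = -1 / 2 * ‖y‖ ^ 2 := fun y => by ring
    simpa only [h5] using h2
  have h3 := (Complex.ofRealCLM.hasFDerivAt.comp x h1).fderiv
  have h4 : (Complex.ofRealCLM ∘ fun y : Space d => Real.exp (-‖y‖ ^ 2 / 2)) = gaussian d := by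
    rw [h0]; rfl
  rw [partialDeriv_apply, ← h4, h3, neg_apply, position_apply, gaussian_apply]
  simp [EuclideanSpace.inner_single_right]
  ring

/-- The creation operator `x_i - ∂_i`. -/
def creation (i : Fin d) : 𝓢(Space d, ℂ) →ₗ[ℂ] 𝓢(Space d, ℂ) := position i - partialDeriv i

/-- The annihilation operator `x_i + ∂_i`. -/
def annihilation (i : Fin d) : 𝓢(Space d, ℂ) →ₗ[ℂ] 𝓢(Space d, ℂ) := position i + partialDeriv i

/-- The canonical commutation relation. Together with the vanishing of the annihilation operators on
the Gaussian it yields the spectrum. -/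
theorem annihilation_creation (i j : Fin d) (φ : 𝓢(Space d, ℂ)) :
    annihilation i (creation j φ) =
      creation j (annihilation i φ) + (2 : ℂ) • if i = j then φ else 0 := by
  simp only [annihilation, creation, LinearMap.add_apply, LinearMap.sub_apply, map_add, map_sub,
    partialDeriv_position, position_comm i j, partialDeriv_comm i j]
  by_cases hij : i = j
  · subst hij; simp only [if_true]; module
  · simp only [hij, Ne.symm hij, if_false]; module

theorem annihilation_gaussian (i : Fin d) : annihilation i (gaussian d) = 0 := by
  simp [annihilation, partialDeriv_gaussian]

/-- The operator `-Δ + |x|²` on Schwartz functions. -/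
def oscillatorSchwartz (d : ℕ) : 𝓢(Space d, ℂ) →ₗ[ℂ] 𝓢(Space d, ℂ) :=
  ∑ i, (position i ∘ₗ position i - partialDeriv i ∘ₗ partialDeriv i)

theorem oscillatorSchwartz_apply (φ : 𝓢(Space d, ℂ)) : oscillatorSchwartz d φ =
    ∑ i, (position i (position i φ) - partialDeriv i (partialDeriv i φ)) := by
  simp [oscillatorSchwartz, LinearMap.sum_apply]

/-- In each coordinate `x² - ∂² = (x - ∂)(x + ∂) + 1`; the `d` units add up to the ground state
energy. -/
theorem oscillatorSchwartz_eq (φ : 𝓢(Space d, ℂ)) :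
    oscillatorSchwartz d φ = ∑ i, creation i (annihilation i φ) + (d : ℂ) • φ := by
  have h : ∀ i : Fin d, creation i (annihilation i φ) =
      (position i (position i φ) - partialDeriv i (partialDeriv i φ)) - φ := fun i => by
    simp only [annihilation, creation, LinearMap.add_apply, LinearMap.sub_apply, map_add,
      partialDeriv_position, if_true]
    module
  have h' : ∑ i : Fin d, φ = (d : ℂ) • φ := by
    rw [Finset.sum_const, Finset.card_univ, Fintype.card_fin, Nat.cast_smul_eq_nsmul]
  rw [oscillatorSchwartz_apply, Finset.sum_congr rfl fun i _ => h i,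
    Finset.sum_sub_distrib _ (fun _ => φ), h', sub_add_cancel]

/-- The span of the Hermite functions of degree `n`. -/
def hermiteSpace (d : ℕ) : ℕ → Submodule ℂ 𝓢(Space d, ℂ)
  | 0 => ℂ ∙ gaussian d
  | n + 1 => ⨆ i, (hermiteSpace d n).map (creation i)

instance finiteDimensional_hermiteSpace (n : ℕ) : FiniteDimensional ℂ (hermiteSpace d n) := by
  induction n with
  | zero => rw [hermiteSpace]; infer_instance
  | succ n ih => rw [hermiteSpace]; infer_instance

theorem creation_mem {n : ℕ} {φ : 𝓢(Space d, ℂ)} (hφ : φ ∈ hermiteSpace d n) (i : Fin d) :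
    creation i φ ∈ hermiteSpace d (n + 1) := by
  rw [hermiteSpace]
  exact Submodule.mem_iSup_of_mem i (Submodule.mem_map_of_mem hφ)

theorem hermiteSpace_induction {n : ℕ} {p : 𝓢(Space d, ℂ) → Prop}
    (h1 : ∀ i, ∀ φ ∈ hermiteSpace d n, p (creation i φ)) (h0 : p 0)
    (h2 : ∀ φ ψ, p φ → p ψ → p (φ + ψ)) {φ : 𝓢(Space d, ℂ)} (hφ : φ ∈ hermiteSpace d (n + 1)) :
    p φ := by
  rw [hermiteSpace] at hφ
  refine Submodule.iSup_induction _ (motive := p) hφ (fun i ψ hψ => ?_) h0 h2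
  obtain ⟨χ, hχ, rfl⟩ := hψ
  exact h1 i χ hχ

/-- Moving the annihilation operator past the outermost creation operator leaves a commutator of
degree `n` and a term to which the induction hypothesis applies. -/
theorem annihilation_mem {n : ℕ} {φ : 𝓢(Space d, ℂ)} (hφ : φ ∈ hermiteSpace d (n + 1))
    (i : Fin d) : annihilation i φ ∈ hermiteSpace d n := by
  induction n generalizing φ with
  | zero =>
    refine hermiteSpace_induction (p := fun φ => annihilation i φ ∈ hermiteSpace d _)
      (fun j ψ hψ => ?_) (by simp) (fun φ ψ h1 h2 => ?_) hφ
    · obtain ⟨c, rfl⟩ := Submodule.mem_span_singleton.1 hψ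
      rw [annihilation_creation, map_smul, annihilation_gaussian, smul_zero, map_zero, zero_add]
      refine Submodule.smul_mem _ _ ?_
      split_ifs
      · exact hψ
      · exact Submodule.zero_mem _
    · rw [map_add]; exact Submodule.add_mem _ h1 h2
  | succ n ih =>
    refine hermiteSpace_induction (p := fun φ => annihilation i φ ∈ hermiteSpace d _)
      (fun j ψ hψ => ?_) (by simp) (fun φ ψ h1 h2 => ?_) hφ
    · rw [annihilation_creation]
      refine Submodule.add_mem _ (creation_mem (ih hψ) j) (Submodule.smul_mem _ _ ?_)
      split_ifs
      · exact hψ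
      · exact Submodule.zero_mem _
    · rw [map_add]; exact Submodule.add_mem _ h1 h2

theorem annihilation_zero {φ : 𝓢(Space d, ℂ)} (hφ : φ ∈ hermiteSpace d 0) (i : Fin d) :
    annihilation i φ = 0 := by
  obtain ⟨c, rfl⟩ := Submodule.mem_span_singleton.1 hφ
  rw [map_smul, annihilation_gaussian, smul_zero]

/-- The number operator `∑ creation i ∘ annihilation i` grows by `2` with each creation operator,
because of the commutation relation. -/
theorem oscillatorSchwartz_eigen {n : ℕ} {φ : 𝓢(Space d, ℂ)} (hφ : φ ∈ hermiteSpace d n) :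
    oscillatorSchwartz d φ = (2 * n + d : ℂ) • φ := by
  suffices h : ∑ i, creation i (annihilation i φ) = (2 * n : ℂ) • φ by
    rw [oscillatorSchwartz_eq, h, add_smul]
  induction n generalizing φ with
  | zero => simp [annihilation_zero hφ]
  | succ n ih =>
    refine hermiteSpace_induction (p := fun φ => ∑ i, creation i (annihilation i φ) =
      (2 * (n + 1 : ℕ) : ℂ) • φ) (fun j ψ hψ => ?_) (by simp) (fun φ ψ h1 h2 => ?_) hφ
    · have h3 : ∀ i, creation i (creation j (annihilation i ψ)) =
          creation j (creation i (annihilation i ψ)) := fun i => by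
        simp only [creation, LinearMap.sub_apply, map_sub, partialDeriv_position,
          position_comm i j, partialDeriv_comm i j]
        by_cases hij : i = j
        · subst hij; rfl
        · simp only [hij, Ne.symm hij, if_false]; module
      simp only [annihilation_creation, map_add, h3, Finset.sum_add_distrib, ← map_sum, ih hψ]
      simp only [map_smul, apply_ite, map_zero, smul_zero, Finset.sum_ite_eq', Finset.mem_univ,
        if_true]
      push_cast
      module
    · simp only [map_add, Finset.sum_add_distrib, h1, h2, smul_add]

/-! ### The Hermite spaces in `L²` -/

/-- The inclusion of Schwartz functions in `L²`. -/
def toL2 (d : ℕ) : 𝓢(Space d, ℂ) →L[ℂ] L2 d := SchwartzMap.toLpCLM ℂ ℂ 2 volume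

theorem toL2_apply (φ : 𝓢(Space d, ℂ)) : toL2 d φ = φ.toLp 2 := rfl

theorem coeFn_toL2 (φ : 𝓢(Space d, ℂ)) : (toL2 d φ : Space d → ℂ) =ᵐ[volume] φ :=
  φ.coeFn_toLp 2 volume

theorem inner_toL2 (φ ψ : 𝓢(Space d, ℂ)) :
    inner ℂ (toL2 d φ) (toL2 d ψ) = ∫ x, conj (φ x) * ψ x :=
  inner_toLp_eq_integral (φ.memLp 2 volume) (ψ.memLp 2 volume)

theorem inner_position (i : Fin d) (φ ψ : 𝓢(Space d, ℂ)) :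
    inner ℂ (toL2 d (position i φ)) (toL2 d ψ) = inner ℂ (toL2 d φ) (toL2 d (position i ψ)) := by
  simp only [inner_toL2, position_apply, map_mul, Complex.conj_ofReal]
  congr 1
  ext x
  ring

theorem inner_partialDeriv (i : Fin d) (φ ψ : 𝓢(Space d, ℂ)) :
    inner ℂ (toL2 d (partialDeriv i φ)) (toL2 d ψ) =
      -inner ℂ (toL2 d φ) (toL2 d (partialDeriv i ψ)) := by
  have h := SchwartzMap.integral_bilinear_lineDerivOp_right_eq_neg_left (μ := volume) φ ψ
    ((ContinuousLinearMap.mul ℝ ℂ).comp (Complex.conjCLE : ℂ →L[ℝ] ℂ))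
    (EuclideanSpace.single i (1 : ℝ))
  rw [inner_toL2, inner_toL2]
  exact (neg_eq_iff_eq_neg.2 h).symm

theorem inner_oscillatorSchwartz (φ ψ : 𝓢(Space d, ℂ)) :
    inner ℂ (toL2 d φ) (toL2 d (oscillatorSchwartz d ψ)) =
      ∑ i, (inner ℂ (toL2 d (position i φ)) (toL2 d (position i ψ)) +
        inner ℂ (toL2 d (partialDeriv i φ)) (toL2 d (partialDeriv i ψ))) := by
  simp only [oscillatorSchwartz_apply, map_sum, inner_sum, inner_position, inner_partialDeriv]
  refine Finset.sum_congr rfl fun i _ => ?_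
  rw [map_sub, inner_sub_right, sub_eq_add_neg]

theorem oscillatorSchwartz_symm (φ ψ : 𝓢(Space d, ℂ)) :
    inner ℂ (toL2 d (oscillatorSchwartz d φ)) (toL2 d ψ) =
      inner ℂ (toL2 d φ) (toL2 d (oscillatorSchwartz d ψ)) := by
  rw [← inner_conj_symm, inner_oscillatorSchwartz, inner_oscillatorSchwartz]
  simp only [map_sum, map_add, inner_conj_symm]

theorem inner_hermiteSpace {m n : ℕ} (hmn : m ≠ n) {φ ψ : 𝓢(Space d, ℂ)}
    (hφ : φ ∈ hermiteSpace d m) (hψ : ψ ∈ hermiteSpace d n) :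
    inner ℂ (toL2 d φ) (toL2 d ψ) = 0 := by
  have h := oscillatorSchwartz_symm φ ψ
  rw [oscillatorSchwartz_eigen hφ, oscillatorSchwartz_eigen hψ, map_smul, map_smul,
    inner_smul_left, inner_smul_right] at h
  have h1 : (2 * (m : ℂ) - 2 * n) * inner ℂ (toL2 d φ) (toL2 d ψ) = 0 := by
    simp only [map_add, map_mul, Complex.conj_natCast, Complex.conj_ofNat] at h
    linear_combination h
  rcases mul_eq_zero.1 h1 with h2 | h2
  · exact absurd (by exact_mod_cast sub_eq_zero.1 h2) (by omega : 2 * m ≠ 2 * n)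
  · exact h2

/-- The span of the Hermite functions of degree at most `n`. -/
def polySpace (d n : ℕ) : Submodule ℂ 𝓢(Space d, ℂ) :=
  ⨆ k ∈ Finset.range (n + 1), hermiteSpace d k

theorem hermiteSpace_le_polySpace {k n : ℕ} (h : k ≤ n) : hermiteSpace d k ≤ polySpace d n :=
  le_biSup (hermiteSpace d) (Finset.mem_range.2 (Nat.lt_succ_of_le h))

theorem creation_mem_polySpace {n : ℕ} {φ : 𝓢(Space d, ℂ)} (hφ : φ ∈ polySpace d n) (i : Fin d) :
    creation i φ ∈ polySpace d (n + 1) := by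
  suffices h : polySpace d n ≤ (polySpace d (n + 1)).comap (creation i) from h hφ
  refine iSup₂_le fun k hk ψ hψ => ?_
  exact hermiteSpace_le_polySpace (by simp at hk; omega) (creation_mem hψ i)

theorem annihilation_mem_polySpace {n : ℕ} {φ : 𝓢(Space d, ℂ)} (hφ : φ ∈ polySpace d n)
    (i : Fin d) : annihilation i φ ∈ polySpace d (n + 1) := by
  suffices h : polySpace d n ≤ (polySpace d (n + 1)).comap (annihilation i) from h hφ
  refine iSup₂_le fun k hk ψ hψ => ?_
  rw [Submodule.mem_comap]
  cases k with
  | zero => rw [annihilation_zero hψ]; exact Submodule.zero_mem _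
  | succ k => exact hermiteSpace_le_polySpace (by simp at hk; omega) (annihilation_mem hψ i)

theorem position_mem_polySpace {n : ℕ} {φ : 𝓢(Space d, ℂ)} (hφ : φ ∈ polySpace d n) (i : Fin d) :
    position i φ ∈ polySpace d (n + 1) := by
  have h : position i φ = (1 / 2 : ℂ) • (creation i φ + annihilation i φ) := by
    simp only [creation, annihilation, LinearMap.add_apply, LinearMap.sub_apply]
    module
  rw [h]
  exact Submodule.smul_mem _ _ (Submodule.add_mem _ (creation_mem_polySpace hφ i)
    (annihilation_mem_polySpace hφ i))

theorem partialDeriv_mem_polySpace {n : ℕ} {φ : 𝓢(Space d, ℂ)} (hφ : φ ∈ polySpace d n)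
    (i : Fin d) : partialDeriv i φ ∈ polySpace d (n + 1) := by
  have h : partialDeriv i φ = (1 / 2 : ℂ) • (annihilation i φ - creation i φ) := by
    simp only [creation, annihilation, LinearMap.add_apply, LinearMap.sub_apply]
    module
  rw [h]
  exact Submodule.smul_mem _ _ (Submodule.sub_mem _ (annihilation_mem_polySpace hφ i)
    (creation_mem_polySpace hφ i))

/-- The left side is the quadratic form of the oscillator at `φ`, and `φ` is an orthogonal sum of
eigenvectors with eigenvalues at most `2n + d`. This is the localisation of a block to `|x|, |ξ| ≲
√(2n+d)`. -/
theorem sum_norm_position_sq_add_norm_partialDeriv_sq_le {n : ℕ} {φ : 𝓢(Space d, ℂ)}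
    (hφ : φ ∈ polySpace d n) :
    ∑ i, (‖toL2 d (position i φ)‖ ^ 2 + ‖toL2 d (partialDeriv i φ)‖ ^ 2) ≤
      (2 * n + d) * ‖toL2 d φ‖ ^ 2 := by
  obtain ⟨w, hw⟩ := (Submodule.mem_iSup_finset_iff_exists_sum _ _).1 hφ
  have h1 : ∀ k l : ℕ, k ≠ l → inner ℂ (toL2 d (w k : 𝓢(Space d, ℂ))) (toL2 d (w l)) = 0 :=
    fun k l hkl => inner_hermiteSpace hkl (w k).2 (w l).2
  have h0 : ∀ u : L2 d, inner ℂ u u = ((‖u‖ ^ 2 : ℝ) : ℂ) := fun u => by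
    rw [inner_self_eq_norm_sq_to_K]; push_cast; rfl
  have h2 : inner ℂ (toL2 d φ) (toL2 d φ) =
      ∑ k ∈ Finset.range (n + 1), ((‖toL2 d (w k : 𝓢(Space d, ℂ))‖ ^ 2 : ℝ) : ℂ) := by
    rw [← hw, map_sum, sum_inner]
    refine Finset.sum_congr rfl fun k hk => ?_
    rw [inner_sum, Finset.sum_eq_single_of_mem k hk fun l _ hl => h1 k l hl.symm, h0]
  have h3 : inner ℂ (toL2 d φ) (toL2 d (oscillatorSchwartz d φ)) = ∑ k ∈ Finset.range (n + 1),
      (((2 * k + d : ℝ) * ‖toL2 d (w k : 𝓢(Space d, ℂ))‖ ^ 2 : ℝ) : ℂ) := by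
    rw [← hw, map_sum, map_sum, map_sum, sum_inner]
    refine Finset.sum_congr rfl fun k hk => ?_
    rw [inner_sum, Finset.sum_eq_single_of_mem k hk fun l _ hl => ?_,
      oscillatorSchwartz_eigen (w k).2, map_smul, inner_smul_right, h0]
    · push_cast; rfl
    · rw [oscillatorSchwartz_eigen (w l).2, map_smul, inner_smul_right, h1 k l hl.symm, mul_zero]
  rw [h0, ← Complex.ofReal_sum] at h2
  simp only [inner_oscillatorSchwartz, h0, ← Complex.ofReal_add, ← Complex.ofReal_sum] at h3
  have h2' := Complex.ofReal_injective h2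
  have h3' := Complex.ofReal_injective h3
  rw [h2', h3', Finset.mul_sum]
  refine Finset.sum_le_sum fun k hk => ?_
  have : (k : ℝ) ≤ n := by exact_mod_cast Nat.lt_succ_iff.1 (Finset.mem_range.1 hk)
  gcongr

theorem enorm_toL2_sq (φ : 𝓢(Space d, ℂ)) : ‖toL2 d φ‖ₑ ^ 2 = ∫⁻ x, ‖φ x‖ₑ ^ 2 := by
  rw [enorm_sq_eq_lintegral]
  refine lintegral_congr_ae ?_
  filter_upwards [coeFn_toL2 φ] with x hx
  rw [hx]

theorem ofReal_norm_sq_eq_sum (x : Space d) :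
    ENNReal.ofReal (‖x‖ ^ 2) = ∑ i, ‖(x i : ℂ)‖ₑ ^ 2 := by
  rw [EuclideanSpace.norm_sq_eq, ENNReal.ofReal_sum_of_nonneg fun _ _ => by positivity]
  refine Finset.sum_congr rfl fun i _ => ?_
  rw [ENNReal.ofReal_pow (norm_nonneg _), ofReal_norm]
  simp [enorm]

theorem sum_enorm_sq_le {n : ℕ} {φ : 𝓢(Space d, ℂ)} (hφ : φ ∈ polySpace d n) :
    ∑ i, ‖toL2 d (position i φ)‖ₑ ^ 2 ≤ (2 * n + d : ℕ) * ‖toL2 d φ‖ₑ ^ 2 ∧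
    ∑ i, ‖toL2 d (partialDeriv i φ)‖ₑ ^ 2 ≤ (2 * n + d : ℕ) * ‖toL2 d φ‖ₑ ^ 2 := by
  have h := sum_norm_position_sq_add_norm_partialDeriv_sq_le hφ
  rw [Finset.sum_add_distrib] at h
  have h1 : ∀ u : L2 d, ‖u‖ₑ ^ 2 = ENNReal.ofReal (‖u‖ ^ 2) := fun u => by
    rw [ENNReal.ofReal_pow (norm_nonneg _), ofReal_norm]
  have h2 : ((2 * n + d : ℕ) : ℝ≥0∞) = ENNReal.ofReal (2 * n + d) := by
    rw [← ENNReal.ofReal_natCast]; push_cast; rfl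
  have h3 : 0 ≤ ∑ i, ‖toL2 d (position i φ)‖ ^ 2 := by positivity
  have h4 : 0 ≤ ∑ i, ‖toL2 d (partialDeriv i φ)‖ ^ 2 := by positivity
  simp only [h1, h2]
  rw [← ENNReal.ofReal_sum_of_nonneg fun _ _ => by positivity,
    ← ENNReal.ofReal_sum_of_nonneg fun _ _ => by positivity, ← ENNReal.ofReal_mul (by positivity)]
  exact ⟨ENNReal.ofReal_le_ofReal (by linarith), ENNReal.ofReal_le_ofReal (by linarith)⟩

theorem lintegral_norm_sq_mul_le {n : ℕ} {φ : 𝓢(Space d, ℂ)} (hφ : φ ∈ polySpace d n) :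
    ∫⁻ x, ENNReal.ofReal (‖x‖ ^ 2) * ‖φ x‖ₑ ^ 2 ≤ (2 * n + d : ℕ) * ‖toL2 d φ‖ₑ ^ 2 := by
  refine le_trans (le_of_eq ?_) (sum_enorm_sq_le hφ).1
  simp only [ofReal_norm_sq_eq_sum, enorm_toL2_sq, position_apply, Finset.sum_mul, enorm_mul,
    mul_pow]
  rw [lintegral_finsetSum _ fun i _ => by fun_prop]

theorem fourier_partialDeriv (i : Fin d) (φ : 𝓢(Space d, ℂ)) (ξ : Space d) :
    𝓕 (partialDeriv i φ) ξ = (2 * Real.pi * Complex.I) * ((ξ i : ℂ) * 𝓕 φ ξ) := by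
  have h := congrArg (fun ψ : 𝓢(Space d, ℂ) => ψ ξ)
    (SchwartzMap.fourier_lineDerivOp_eq φ (EuclideanSpace.single i (1 : ℝ)))
  refine h.trans ?_
  simp only [smul_apply]
  rw [SchwartzMap.smulLeftCLM_apply_apply (by fun_prop)]
  simp [EuclideanSpace.inner_single_right]

theorem enorm_toL2_fourier (φ : 𝓢(Space d, ℂ)) : ‖toL2 d (𝓕 φ)‖ₑ = ‖toL2 d φ‖ₑ := by
  rw [toL2_apply, toL2_apply, ← ofReal_norm, ← ofReal_norm, SchwartzMap.norm_fourier_toL2_eq]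

/-- Each factor `|ξ|²` is traded for a first derivative, which stays a finite Hermite sum but raises
the degree by one; hence `n + m` on the right. The factor `2π` from differentiation is at least `1`
and is dropped. -/
theorem lintegral_norm_pow_mul_fourier_le (m : ℕ) {n : ℕ} {φ : 𝓢(Space d, ℂ)}
    (hφ : φ ∈ polySpace d n) :
    ∫⁻ ξ, ENNReal.ofReal (‖ξ‖ ^ 2) ^ m * ‖𝓕 φ ξ‖ₑ ^ 2 ≤
      ((2 * (n + m) + d : ℕ) : ℝ≥0∞) ^ m * ‖toL2 d φ‖ₑ ^ 2 := by
  induction m generalizing n φ with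
  | zero => simp [← enorm_toL2_sq, enorm_toL2_fourier]
  | succ m ih =>
    calc ∫⁻ ξ, ENNReal.ofReal (‖ξ‖ ^ 2) ^ (m + 1) * ‖𝓕 φ ξ‖ₑ ^ 2
        ≤ ∫⁻ ξ, ∑ i, ENNReal.ofReal (‖ξ‖ ^ 2) ^ m * ‖𝓕 (partialDeriv i φ) ξ‖ₑ ^ 2 := by
          refine lintegral_mono fun ξ => ?_
          simp only
          rw [pow_succ, mul_assoc, ← Finset.mul_sum]
          nth_rewrite 2 [ofReal_norm_sq_eq_sum]
          rw [Finset.sum_mul]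
          refine mul_le_mul' le_rfl (Finset.sum_le_sum fun i _ => ?_)
          have h1 : (1 : ℝ≥0∞) ≤ ‖2 * (Real.pi : ℂ) * Complex.I‖ₑ := by
            rw [← ofReal_norm, ← ENNReal.ofReal_one]
            refine ENNReal.ofReal_le_ofReal ?_
            simp only [norm_mul, Complex.norm_I, Complex.norm_real, Real.norm_eq_abs,
              abs_of_pos Real.pi_pos, Complex.norm_ofNat]
            linarith [Real.pi_gt_three]
          rw [fourier_partialDeriv, enorm_mul (2 * (Real.pi : ℂ) * Complex.I) (_ * _), mul_pow,
            enorm_mul (ξ i : ℂ), mul_pow (‖(ξ i : ℂ)‖ₑ)]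
          exact le_mul_of_one_le_left' (one_le_pow_of_one_le' h1 2)
      _ = ∑ i, ∫⁻ ξ, ENNReal.ofReal (‖ξ‖ ^ 2) ^ m * ‖𝓕 (partialDeriv i φ) ξ‖ₑ ^ 2 := by
          rw [lintegral_finsetSum _ fun i _ => ?_]
          exact (by fun_prop : Measurable fun ξ : Space d =>
            ENNReal.ofReal (‖ξ‖ ^ 2) ^ m).mul ((𝓕 (partialDeriv i φ)).continuous.measurable.enorm.pow_const 2)
      _ ≤ ∑ i, ((2 * (n + 1 + m) + d : ℕ) : ℝ≥0∞) ^ m * ‖toL2 d (partialDeriv i φ)‖ₑ ^ 2 :=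
          Finset.sum_le_sum fun i _ => ih (partialDeriv_mem_polySpace hφ i)
      _ ≤ ((2 * (n + 1 + m) + d : ℕ) : ℝ≥0∞) ^ m * ((2 * n + d : ℕ) * ‖toL2 d φ‖ₑ ^ 2) := by
          rw [← Finset.mul_sum]
          gcongr
          exact (sum_enorm_sq_le hφ).2
      _ ≤ _ := by
          rw [pow_succ _ m, mul_assoc]
          have h1 : 2 * (n + 1 + m) + d = 2 * (n + (m + 1)) + d := by ring
          have h2 : 2 * n + d ≤ 2 * (n + (m + 1)) + d := by omega
          rw [h1]
          gcongr

/-! ### Completeness of the Hermite functions -/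

/-- Completing the square, `2c|x| ≤ 2c² + |x|²/2`. This function dominates the exponential series in
the completeness proof. -/
theorem memLp_exp_mul_gaussian (c : ℝ) :
    MemLp (fun x : Space d => Real.exp (c * ‖x‖) * Real.exp (-‖x‖ ^ 2 / 2)) 2 volume := by
  rw [memLp_two_iff_integrable_sq (by fun_prop)]
  refine (((realGaussian d).integrable (μ := volume)).const_mul (Real.exp (2 * c ^ 2))).mono'
    (by fun_prop) (.of_forall fun x => ?_)
  have h : realGaussian d x = Real.exp (-‖x‖ ^ 2 / 2) := rfl
  rw [h, Real.norm_of_nonneg (by positivity), ← Real.exp_add, ← Real.exp_add, ← Real.exp_nat_mul]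
  refine Real.exp_le_exp.2 ?_
  push_cast
  nlinarith [sq_nonneg (2 * c - ‖x‖)]

/-- Multiplication by the linear function `⟨x, ξ⟩`. -/
def linearMul (ξ : Space d) : 𝓢(Space d, ℂ) →ₗ[ℂ] 𝓢(Space d, ℂ) :=
  ∑ i, ((ξ i : ℝ) : ℂ) • position i

theorem linearMul_apply (ξ : Space d) (φ : 𝓢(Space d, ℂ)) (x : Space d) :
    linearMul ξ φ x = ((inner ℝ x ξ : ℝ) : ℂ) * φ x := by
  simp only [linearMul, LinearMap.sum_apply, LinearMap.smul_apply, sum_apply, smul_apply,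
    position_apply, PiLp.inner_apply, Complex.ofReal_sum, Finset.sum_mul, smul_eq_mul]
  refine Finset.sum_congr rfl fun i _ => ?_
  simp
  ring

theorem linearMul_pow_apply (ξ : Space d) (k : ℕ) (x : Space d) :
    ((linearMul ξ) ^ k) (gaussian d) x =
      ((inner ℝ x ξ : ℝ) : ℂ) ^ k * ((Real.exp (-‖x‖ ^ 2 / 2) : ℝ) : ℂ) := by
  induction k with
  | zero => simp [gaussian_apply]
  | succ k ih => rw [pow_succ', Module.End.mul_apply, linearMul_apply, ih]; ring

theorem linearMul_pow_mem (ξ : Space d) (k : ℕ) :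
    ((linearMul ξ) ^ k) (gaussian d) ∈ polySpace d k := by
  induction k with
  | zero => exact hermiteSpace_le_polySpace le_rfl (Submodule.mem_span_singleton_self _)
  | succ k ih =>
    rw [pow_succ', Module.End.mul_apply, linearMul, LinearMap.sum_apply]
    exact Submodule.sum_mem _ fun i _ => Submodule.smul_mem _ _ (position_mem_polySpace ih i)

theorem inner_toL2_left (φ : 𝓢(Space d, ℂ)) (u : L2 d) :
    inner ℂ (toL2 d φ) u = ∫ x, conj (φ x) * u x := by
  rw [inner_eq_integral]
  refine integral_congr_ae ?_
  filter_upwards [coeFn_toL2 φ] with x hx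
  rw [hx]

/-- Completeness through the Fourier transform of `exp(-|x|²/2) u`. Expanding the character in its
power series, the `k`-th term is a multiple of the inner product of `u` with `⟨x, ξ⟩^k
exp(-|x|²/2)`, which is a finite Hermite sum, so it vanishes. By Plancherel `exp(-|x|²/2) u = 0`,
and the Gaussian has no zeros. -/
theorem eq_zero_of_inner_hermiteSpace {u : L2 d}
    (h : ∀ n, ∀ φ ∈ hermiteSpace d n, inner ℂ (toL2 d φ) u = 0) : u = 0 := by
  have h1 : ∀ n, ∀ φ ∈ polySpace d n, inner ℂ (toL2 d φ) u = 0 := fun n φ hφ => by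
    have h2 : polySpace d n ≤ (LinearMap.ker (innerSL ℂ u : L2 d →ₗ[ℂ] ℂ)).comap
        (toL2 d : 𝓢(Space d, ℂ) →ₗ[ℂ] L2 d) := by
      refine iSup₂_le fun k _ ψ hψ => ?_
      simp only [Submodule.mem_comap, LinearMap.mem_ker, ContinuousLinearMap.coe_coe,
        innerSL_apply_apply]
      rw [← inner_conj_symm, h k ψ hψ, map_zero]
    have h3 := h2 hφ
    simp only [Submodule.mem_comap, LinearMap.mem_ker, ContinuousLinearMap.coe_coe,
      innerSL_apply_apply] at h3
    rw [← inner_conj_symm, h3, map_zero]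
  set f : Space d → ℂ := fun x => ((Real.exp (-‖x‖ ^ 2 / 2) : ℝ) : ℂ) * u x with hf
  have hG : (gaussian d : Space d → ℂ) = fun x => ((Real.exp (-‖x‖ ^ 2 / 2) : ℝ) : ℂ) := by
    ext x; exact gaussian_apply x
  have hf1 : Integrable f := by
    have h4 := (gaussian d).memLp 2 volume
    rw [hG] at h4
    exact h4.integrable_mul (p := 2) (q := 2) (Lp.memLp u)
  have hf2 : MemLp f 2 volume := by
    have h4 := (gaussian d).memLp_top volume
    rw [hG] at h4
    exact (Lp.memLp u).mul (r := 2) h4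
  have hF : ∀ ξ, 𝓕 f ξ = 0 := fun ξ => by
    have h5 : HasSum (fun k : ℕ => ∫ x, ((-2 * Real.pi * Complex.I) * (inner ℝ x ξ : ℝ)) ^ k /
        k.factorial * f x) (∫ x, Complex.exp ((-2 * Real.pi * Complex.I) * (inner ℝ x ξ : ℝ)) *
          f x) := by
      refine hasSum_integral_of_dominated_convergence
        (fun k x => (2 * Real.pi * ‖ξ‖ * ‖x‖) ^ k / k.factorial *
          (Real.exp (-‖x‖ ^ 2 / 2) * ‖u x‖)) (fun k => ?_) (fun k => .of_forall fun x => ?_)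
        (.of_forall fun x => ?_) ?_ (.of_forall fun x => ?_)
      · exact (by fun_prop : Continuous fun x : Space d =>
          ((-2 * Real.pi * Complex.I) * (inner ℝ x ξ : ℝ)) ^ k / k.factorial).aestronglyMeasurable.mul
            hf1.aestronglyMeasurable
      · have h6 : ‖f x‖ = Real.exp (-‖x‖ ^ 2 / 2) * ‖u x‖ := by
          rw [hf]; simp only [norm_mul, Complex.norm_real, Real.norm_eq_abs, Real.abs_exp]
        rw [norm_mul, h6, norm_div, norm_pow, norm_mul, Complex.norm_natCast]
        have h7 : ‖(-2 * Real.pi * Complex.I : ℂ)‖ = 2 * Real.pi := by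
          simp [abs_of_pos Real.pi_pos]
        rw [h7, Complex.norm_real]
        have h8 : ‖(inner ℝ x ξ : ℝ)‖ ≤ ‖x‖ * ‖ξ‖ := norm_inner_le_norm x ξ
        have h9 : 2 * Real.pi * ‖(inner ℝ x ξ : ℝ)‖ ≤ 2 * Real.pi * ‖ξ‖ * ‖x‖ := by
          rw [mul_assoc _ ‖ξ‖, mul_comm ‖ξ‖]
          gcongr
        gcongr
      · exact (Real.summable_pow_div_factorial _).mul_right _
      · have h6 : ∀ x : Space d, ∑' k : ℕ, (2 * Real.pi * ‖ξ‖ * ‖x‖) ^ k / k.factorial *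
            (Real.exp (-‖x‖ ^ 2 / 2) * ‖u x‖) = (Real.exp ((2 * Real.pi * ‖ξ‖) * ‖x‖) *
              Real.exp (-‖x‖ ^ 2 / 2)) * ‖u x‖ := fun x => by
          rw [tsum_mul_right, Real.exp_eq_exp_ℝ, NormedSpace.exp_eq_tsum_div]
          ring
        simp only [h6]
        exact (memLp_exp_mul_gaussian _).integrable_mul (p := 2) (q := 2) (Lp.memLp u).norm
      · refine HasSum.mul_right _ ?_
        rw [Complex.exp_eq_exp_ℂ]
        exact NormedSpace.expSeries_div_hasSum_exp _
    have h6 : ∀ k : ℕ, ∫ x, ((-2 * Real.pi * Complex.I) * (inner ℝ x ξ : ℝ)) ^ k /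
        k.factorial * f x = 0 := fun k => by
      have h7 := h1 k _ (linearMul_pow_mem ξ k)
      rw [inner_toL2_left] at h7
      simp only [linearMul_pow_apply, map_mul, map_pow, Complex.conj_ofReal] at h7
      rw [show (fun x => ((-2 * Real.pi * Complex.I) * (inner ℝ x ξ : ℝ)) ^ k /
        (k.factorial : ℂ) * f x) = fun x => ((-2 * Real.pi * Complex.I) ^ k / k.factorial) *
          (((inner ℝ x ξ : ℝ) : ℂ) ^ k * ((Real.exp (-‖x‖ ^ 2 / 2) : ℝ) : ℂ) * u x) by
            ext x; rw [hf]; simp only; ring, integral_const_mul, h7, mul_zero]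
    simp only [h6] at h5
    rw [Real.fourier_eq', ← h5.unique hasSum_zero]
    refine integral_congr_ae (.of_forall fun x => ?_)
    simp only [smul_eq_mul]
    congr 2
    push_cast
    ring
  have h9 := lintegral_fourier_sq hf1 hf2
  simp only [hF, enorm_zero, ne_eq, OfNat.ofNat_ne_zero, not_false_eq_true, zero_pow,
    lintegral_zero] at h9
  rw [eq_comm, lintegral_eq_zero_iff' (by fun_prop)] at h9
  rw [Lp.eq_zero_iff_ae_eq_zero]
  filter_upwards [h9] with x hx
  simp only [Pi.zero_apply, ne_eq, OfNat.ofNat_ne_zero, not_false_eq_true, pow_eq_zero_iff,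
    enorm_eq_zero, hf, mul_eq_zero, Complex.ofReal_eq_zero, Real.exp_ne_zero, false_or] at hx
  simpa using hx

/-! ### The eigenspaces of the harmonic oscillator -/

/-- The complex conjugate of a Schwartz function. -/
def conjSchwartz : 𝓢(Space d, ℂ) →L[ℝ] 𝓢(Space d, ℂ) :=
  SchwartzMap.postcompCLM (Complex.conjCLE : ℂ →L[ℝ] ℂ)

theorem conjSchwartz_apply (φ : 𝓢(Space d, ℂ)) (x : Space d) :
    conjSchwartz φ x = conj (φ x) := rfl

theorem conjSchwartz_conjSchwartz (φ : 𝓢(Space d, ℂ)) : conjSchwartz (conjSchwartz φ) = φ := by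
  ext x
  simp [conjSchwartz_apply]

theorem position_conjSchwartz (i : Fin d) (φ : 𝓢(Space d, ℂ)) :
    position i (conjSchwartz φ) = conjSchwartz (position i φ) := by
  ext x
  simp [conjSchwartz_apply, position_apply]

theorem partialDeriv_conjSchwartz (i : Fin d) (φ : 𝓢(Space d, ℂ)) :
    partialDeriv i (conjSchwartz φ) = conjSchwartz (partialDeriv i φ) := by
  ext x
  have h : HasFDerivAt (conjSchwartz φ : Space d → ℂ)
      ((Complex.conjCLE : ℂ →L[ℝ] ℂ).comp (fderiv ℝ φ x)) x :=
    (Complex.conjCLE : ℂ →L[ℝ] ℂ).hasFDerivAt.comp x (φ.hasFDerivAt x)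
  rw [partialDeriv_apply, h.fderiv, conjSchwartz_apply, partialDeriv_apply]
  rfl

theorem oscillatorSchwartz_conjSchwartz (φ : 𝓢(Space d, ℂ)) :
    oscillatorSchwartz d (conjSchwartz φ) = conjSchwartz (oscillatorSchwartz d φ) := by
  simp only [oscillatorSchwartz_apply, map_sum, map_sub, position_conjSchwartz,
    partialDeriv_conjSchwartz]

/-- Distributions pair bilinearly and the inner product is antilinear on the left, hence the
conjugate. -/
theorem toTemperedDistribution_eq_inner (u : L2 d) (φ : 𝓢(Space d, ℂ)) :
    (u : 𝓢'(Space d, ℂ)) φ = inner ℂ (toL2 d (conjSchwartz φ)) u := by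
  rw [Lp.toTemperedDistribution_apply, inner_toL2_left]
  simp [conjSchwartz_apply]

theorem oscillatorSchwartz_eq_laplacian (φ : 𝓢(Space d, ℂ)) : oscillatorSchwartz d φ =
    -Δ φ + SchwartzMap.smulLeftCLM ℂ (fun x : Space d => ((‖x‖ ^ 2 : ℝ) : ℂ)) φ := by
  rw [SchwartzMap.laplacian_eq_sum (EuclideanSpace.basisFun (Fin d) ℝ), oscillatorSchwartz_apply,
    Finset.sum_sub_distrib, sub_eq_neg_add]
  congr 1
  · simp only [EuclideanSpace.basisFun_apply]
    rfl
  · ext x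
    rw [SchwartzMap.smulLeftCLM_apply_apply (by fun_prop)]
    simp only [sum_apply, position_apply, EuclideanSpace.norm_sq_eq, Complex.ofReal_sum,
      smul_eq_mul, Finset.sum_mul]
    refine Finset.sum_congr rfl fun i _ => ?_
    rw [Real.norm_eq_abs, sq_abs]
    push_cast
    ring

theorem oscillatorExpr_apply (T : 𝓢'(Space d, ℂ)) (φ : 𝓢(Space d, ℂ)) :
    oscillatorExpr d T φ =
      ((Real.exp (Real.exp 1) / d : ℝ) : ℂ) * T (oscillatorSchwartz d φ) := by
  rw [oscillatorSchwartz_eq_laplacian, map_add, map_neg, ← TemperedDistribution.laplacian_apply_apply,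
    ← TemperedDistribution.smulLeftCLM_apply_apply, ← TemperedDistribution.laplacianCLM_apply]
  rfl

/-- The weak form of the eigenvalue equation: all derivatives fall on the test function, so no
regularity of `u` has to be established. -/
theorem mem_eigenspace_oscillator_iff {u : L2 d} {lam : ℝ} :
    u ∈ eigenspace (oscillator d) lam ↔ ∀ φ : 𝓢(Space d, ℂ),
      ((Real.exp (Real.exp 1) / d : ℝ) : ℂ) * inner ℂ (toL2 d (oscillatorSchwartz d φ)) u =
        lam * inner ℂ (toL2 d φ) u := by
  have h1 : u ∈ eigenspace (oscillator d) lam ↔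
      oscillatorExpr d (u : 𝓢'(Space d, ℂ)) = (((lam : ℂ) • u : L2 d) : 𝓢'(Space d, ℂ)) := by
    change (u, (lam : ℂ) • u) ∈ (oscillator d).graph ↔ _
    rw [graph_oscillator]
    rfl
  have h2 : ∀ φ : 𝓢(Space d, ℂ), oscillatorExpr d (u : 𝓢'(Space d, ℂ)) (conjSchwartz φ) =
      ((Real.exp (Real.exp 1) / d : ℝ) : ℂ) * inner ℂ (toL2 d (oscillatorSchwartz d φ)) u :=
    fun φ => by
      rw [oscillatorExpr_apply, oscillatorSchwartz_conjSchwartz, toTemperedDistribution_eq_inner,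
        conjSchwartz_conjSchwartz]
  have h3 : ∀ φ : 𝓢(Space d, ℂ), (((lam : ℂ) • u : L2 d) : 𝓢'(Space d, ℂ)) (conjSchwartz φ) =
      lam * inner ℂ (toL2 d φ) u := fun φ => by
    rw [toTemperedDistribution_eq_inner, conjSchwartz_conjSchwartz, inner_smul_right]
  rw [h1]
  constructor
  · intro h φ
    rw [← h2, ← h3, h]
  · intro h
    ext φ
    rw [← conjSchwartz_conjSchwartz φ, h2, h3, h]

/-- The eigenvalues of the harmonic oscillator. -/
def level (d n : ℕ) : ℝ := Real.exp (Real.exp 1) / d * (2 * n + d)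

theorem toL2_mem_eigenspace {n : ℕ} {φ : 𝓢(Space d, ℂ)} (hφ : φ ∈ hermiteSpace d n) :
    toL2 d φ ∈ eigenspace (oscillator d) (level d n) := by
  rw [mem_eigenspace_oscillator_iff]
  intro ψ
  rw [oscillatorSchwartz_symm, oscillatorSchwartz_eigen hφ, map_smul, inner_smul_right, level]
  push_cast
  ring

theorem inner_eq_zero_of_mem_eigenspace {n : ℕ} {lam : ℝ} (hl : lam ≠ level d n)
    {φ : 𝓢(Space d, ℂ)} (hφ : φ ∈ hermiteSpace d n) {u : L2 d}
    (hu : u ∈ eigenspace (oscillator d) lam) : inner ℂ (toL2 d φ) u = 0 := by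
  have h := mem_eigenspace_oscillator_iff.1 hu φ
  rw [oscillatorSchwartz_eigen hφ, map_smul, inner_smul_left] at h
  have h1 : ((level d n - lam : ℝ) : ℂ) * inner ℂ (toL2 d φ) u = 0 := by
    rw [level]
    simp only [map_add, map_mul, Complex.conj_natCast, Complex.conj_ofNat] at h
    push_cast at h ⊢
    linear_combination h
  rcases mul_eq_zero.1 h1 with h2 | h2
  · exact absurd (sub_eq_zero.1 (by exact_mod_cast h2)) hl.symm
  · exact h2

/-- The image of `hermiteSpace d n` in `L²`. -/
def hermiteL2 (d n : ℕ) : Submodule ℂ (L2 d) :=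
  (hermiteSpace d n).map (toL2 d : 𝓢(Space d, ℂ) →ₗ[ℂ] L2 d)

instance (n : ℕ) : FiniteDimensional ℂ (hermiteL2 d n) := by
  rw [hermiteL2]; infer_instance

theorem toL2_mem_hermiteL2 {n : ℕ} {φ : 𝓢(Space d, ℂ)} (hφ : φ ∈ hermiteSpace d n) :
    toL2 d φ ∈ hermiteL2 d n := ⟨φ, hφ, rfl⟩

/-- The distributional domain admits no further eigenvectors: what is left of one after projecting
to `hermiteL2 d n` is orthogonal to degree `n` by construction and to other degrees because the
eigenvalues differ, so completeness makes it zero. -/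
theorem eigenspace_level (hd : 1 ≤ d) (n : ℕ) :
    eigenspace (oscillator d) (level d n) = hermiteL2 d n := by
  have hle : hermiteL2 d n ≤ eigenspace (oscillator d) (level d n) := by
    rintro _ ⟨φ, hφ, rfl⟩
    exact toL2_mem_eigenspace hφ
  refine le_antisymm (fun u hu => ?_) hle
  have h1 : u - (hermiteL2 d n).starProjection u = 0 := by
    refine eq_zero_of_inner_hermiteSpace fun k φ hφ => ?_
    by_cases hk : k = n
    · subst hk
      rw [← inner_conj_symm, Submodule.starProjection_inner_eq_zero _ _
        (toL2_mem_hermiteL2 hφ), map_zero]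
    · refine inner_eq_zero_of_mem_eigenspace (lam := level d n) ?_ hφ
        (Submodule.sub_mem _ hu (hle (Submodule.starProjection_apply_mem _ u)))
      intro h
      have hd' : (0 : ℝ) < d := by exact_mod_cast hd
      have h3 : (2 * n + d : ℝ) = 2 * k + d := by
        have : Real.exp (Real.exp 1) / d ≠ 0 := by positivity
        exact mul_left_cancel₀ this h
      exact hk (by exact_mod_cast (by linarith : (k : ℝ) = n))
  rw [sub_eq_zero.1 h1]
  exact Submodule.starProjection_apply_mem _ u

theorem eigenspace_eq_bot {lam : ℝ} (hl : ∀ n, lam ≠ level d n) :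
    eigenspace (oscillator d) lam = ⊥ := by
  rw [Submodule.eq_bot_iff]
  exact fun u hu => eq_zero_of_inner_hermiteSpace fun n φ hφ =>
    inner_eq_zero_of_mem_eigenspace (hl n) hφ hu

theorem level_injective (hd : 1 ≤ d) : Function.Injective (level d) := fun m n h => by
  have hd' : (0 : ℝ) < d := by exact_mod_cast hd
  have h1 : Real.exp (Real.exp 1) / d ≠ 0 := by positivity
  have h2 : (2 * m + d : ℝ) = 2 * n + d := mul_left_cancel₀ h1 h
  exact_mod_cast (by linarith : (m : ℝ) = n)

theorem eigenprojection_level (hd : 1 ≤ d) (n : ℕ) :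
    eigenprojection (oscillator d) (level d n) = (hermiteL2 d n).starProjection := by
  ext1 v
  have h : (eigenspace (oscillator d) (level d n)).topologicalClosure = hermiteL2 d n := by
    rw [eigenspace_level hd]
    exact (hermiteL2 d n).closed_of_finiteDimensional.submodule_topologicalClosure_eq
  refine (Submodule.eq_starProjection_of_mem_of_inner_eq_zero ?_ fun w hw => ?_).symm
  · rw [← h]
    exact Submodule.starProjection_apply_mem _ v
  · rw [← h] at hw
    exact Submodule.starProjection_inner_eq_zero _ _ hw

theorem eigenprojection_eq_zero {lam : ℝ} (hl : ∀ n, lam ≠ level d n) :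
    eigenprojection (oscillator d) lam = 0 := by
  ext1 v
  refine (Submodule.eq_starProjection_of_mem_of_inner_eq_zero (Submodule.zero_mem _)
    fun w hw => ?_)
  have h : (eigenspace (oscillator d) lam).topologicalClosure = ⊥ := by
    rw [eigenspace_eq_bot hl]
    exact isClosed_singleton.submodule_topologicalClosure_eq
  rw [h, Submodule.mem_bot] at hw
  rw [hw, inner_zero_right]

/-! ### Expansion of `L²` functions in Hermite components -/

theorem hasSum_norm_sq_of_orthogonal {H : Type*} [NormedAddCommGroup H] [InnerProductSpace ℂ H]
    {a : ℕ → H} {s : H} (ha : HasSum a s) (ho : ∀ m n, m ≠ n → inner ℂ (a m) (a n) = 0) :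
    HasSum (fun n => ‖a n‖ ^ 2) (‖s‖ ^ 2) := by
  have h1 : ∀ n, inner ℂ (a n) s = ((‖a n‖ ^ 2 : ℝ) : ℂ) := fun n => by
    have h2 : HasSum (fun m => inner ℂ (a n) (a m)) (inner ℂ (a n) s) :=
      ha.mapL (innerSL ℂ (a n))
    have h3 := hasSum_single n (f := fun m => inner ℂ (a n) (a m)) fun m hm => ho n m hm.symm
    rw [h2.unique h3, inner_self_eq_norm_sq_to_K]
    push_cast; rfl
  have h4 : HasSum (fun n => inner ℂ s (a n)) (inner ℂ s s) := ha.mapL (innerSL ℂ s)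
  have h5 : ∀ n, inner ℂ s (a n) = ((‖a n‖ ^ 2 : ℝ) : ℂ) := fun n => by
    rw [← inner_conj_symm, h1, Complex.conj_ofReal]
  have h6 : inner ℂ s s = ((‖s‖ ^ 2 : ℝ) : ℂ) := by
    rw [inner_self_eq_norm_sq_to_K]; push_cast; rfl
  simp only [h5, h6] at h4
  exact Complex.hasSum_ofReal.1 h4

theorem inner_hermiteL2 {m n : ℕ} (hmn : m ≠ n) {u w : L2 d} (hu : u ∈ hermiteL2 d m)
    (hw : w ∈ hermiteL2 d n) : inner ℂ u w = 0 := by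
  obtain ⟨φ, hφ, rfl⟩ := hu
  obtain ⟨ψ, hψ, rfl⟩ := hw
  exact inner_hermiteSpace hmn hφ hψ

/-- The components are orthogonal and square summable by Bessel's inequality, so they have a sum;
its difference from `v` is orthogonal to all Hermite functions. -/
theorem hasSum_starProjection_hermiteL2 (v : L2 d) :
    HasSum (fun n => (hermiteL2 d n).starProjection v) v := by
  set a : ℕ → L2 d := fun n => (hermiteL2 d n).starProjection v with ha
  have hmem : ∀ n, a n ∈ hermiteL2 d n := fun n => Submodule.starProjection_apply_mem _ v
  have ho : ∀ m n, m ≠ n → inner ℂ (a m) (a n) = 0 := fun m n hmn =>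
    inner_hermiteL2 hmn (hmem m) (hmem n)
  have hself : ∀ u : L2 d, inner ℂ u u = ((‖u‖ ^ 2 : ℝ) : ℂ) := fun u => by
    rw [inner_self_eq_norm_sq_to_K]; push_cast; rfl
  have hv : ∀ n, inner ℂ (a n) v = ((‖a n‖ ^ 2 : ℝ) : ℂ) := fun n => by
    have h := Submodule.starProjection_inner_eq_zero (K := hermiteL2 d n) v (a n) (hmem n)
    rw [inner_sub_left, sub_eq_zero] at h
    rw [← hself, ← inner_conj_symm, h, inner_conj_symm]
  have hsum : Summable a := by
    have hF : OrthogonalFamily ℂ (fun n => hermiteL2 d n) fun n => (hermiteL2 d n).subtypeₗᵢ :=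
      OrthogonalFamily.of_pairwise fun m n hmn => by
        exact Submodule.isOrtho_iff_inner_eq.2 fun u hu w hw => inner_hermiteL2 hmn hu hw
    refine (hF.summable_iff_norm_sq_summable fun n => ⟨a n, hmem n⟩).2 ?_
    refine summable_of_sum_le (c := ‖v‖ ^ 2) (fun n => by positivity) fun s => ?_
    have h1 : inner ℂ (∑ n ∈ s, a n) v = ((∑ n ∈ s, ‖a n‖ ^ 2 : ℝ) : ℂ) := by
      rw [sum_inner, Complex.ofReal_sum]
      exact Finset.sum_congr rfl fun n _ => hv n
    have h2 : ‖∑ n ∈ s, a n‖ ^ 2 = ∑ n ∈ s, ‖a n‖ ^ 2 := by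
      have h3 : inner ℂ (∑ n ∈ s, a n) (∑ n ∈ s, a n) = ((∑ n ∈ s, ‖a n‖ ^ 2 : ℝ) : ℂ) := by
        rw [sum_inner, Complex.ofReal_sum]
        refine Finset.sum_congr rfl fun n hn => ?_
        rw [inner_sum, Finset.sum_eq_single_of_mem n hn fun m _ hm => ho n m hm.symm, hself]
      rw [hself] at h3
      exact Complex.ofReal_injective h3
    have h3 : ∑ n ∈ s, ‖a n‖ ^ 2 ≤ ‖∑ n ∈ s, a n‖ * ‖v‖ := by
      have h4 := norm_inner_le_norm (𝕜 := ℂ) (∑ n ∈ s, a n) v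
      rw [h1, Complex.norm_of_nonneg (Finset.sum_nonneg fun n _ => sq_nonneg ‖a n‖)] at h4
      exact h4
    change ∑ n ∈ s, ‖a n‖ ^ 2 ≤ ‖v‖ ^ 2
    rw [← h2] at h3 ⊢
    have key : ∀ p q : ℝ, p ^ 2 ≤ p * q → p ^ 2 ≤ q ^ 2 := fun p q h => by
      nlinarith [sq_nonneg (p - q)]
    exact key _ _ h3
  obtain ⟨t, ht⟩ := hsum
  have h0 : v - t = 0 := by
    refine eq_zero_of_inner_hermiteSpace fun n φ hφ => ?_
    have hφ' := toL2_mem_hermiteL2 hφ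
    have h1 : HasSum (fun m => inner ℂ (toL2 d φ) (a m)) (inner ℂ (toL2 d φ) t) :=
      ht.mapL (innerSL ℂ (toL2 d φ))
    have h2 := hasSum_single n (f := fun m => inner ℂ (toL2 d φ) (a m)) fun m hm =>
      inner_hermiteL2 hm.symm hφ' (hmem m)
    have h3 := Submodule.starProjection_inner_eq_zero (K := hermiteL2 d n) v _ hφ'
    rw [inner_sub_right, h1.unique h2, ← inner_sub_right, ← inner_conj_symm, h3, map_zero]
  rw [sub_eq_zero.1 h0]
  exact ht

/-- Translates the abstract functional calculus into Hermite components: the sum over all real `lam`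
lives on the levels, since every other eigenprojection vanishes, and its terms are orthogonal. -/
theorem exists_hermite_expansion (hd : 1 ≤ d) (f : ℝ → ℝ) (v : L2 d)
    (hv : v ∈ (functionOf (oscillator d) f).domain) :
    ∃ w : ℕ → 𝓢(Space d, ℂ), (∀ n, w n ∈ hermiteSpace d n) ∧
      HasSum (fun n => toL2 d (w n)) v ∧
      HasSum (fun n => f (level d n) ^ 2 * ‖toL2 d (w n)‖ ^ 2)
        (‖functionOf (oscillator d) f ⟨v, hv⟩‖ ^ 2) := by
  have hmem : ∀ n, (hermiteL2 d n).starProjection v ∈ hermiteL2 d n := fun n =>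
    Submodule.starProjection_apply_mem _ v
  choose w hw hw' using hmem
  refine ⟨w, hw, ?_, ?_⟩
  · simpa only [← hw'] using! hasSum_starProjection_hermiteL2 v
  · have h1 : HasSum (fun lam : ℝ => (f lam : ℂ) • eigenprojection (oscillator d) lam v)
        (functionOf (oscillator d) f ⟨v, hv⟩) := Summable.hasSum hv
    have h2 := (level_injective hd).hasSum_iff
      (f := fun lam : ℝ => (f lam : ℂ) • eigenprojection (oscillator d) lam v)
      (a := functionOf (oscillator d) f ⟨v, hv⟩) fun lam hlam => by
        rw [eigenprojection_eq_zero fun n h => hlam ⟨n, h.symm⟩]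
        simp
    have h3 := hasSum_norm_sq_of_orthogonal (h2.2 h1) fun m n hmn => by
      simp only [Function.comp_apply, eigenprojection_level hd]
      exact inner_hermiteL2 hmn
        (Submodule.smul_mem _ _ (Submodule.starProjection_apply_mem _ v))
        (Submodule.smul_mem _ _ (Submodule.starProjection_apply_mem _ v))
    convert h3 using 2 with n
    simp only [Function.comp_apply, eigenprojection_level hd, ← hw']
    rw [norm_smul, mul_pow, Complex.norm_real, Real.norm_eq_abs, sq_abs]
    rfl

/-! ### The short-time Fourier transform with a Gaussian window -/

/-- The Gaussian window. -/
def window (b : ℝ) (y : Space d) : ℝ := Real.exp (-b * ‖y‖ ^ 2)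

/-- The Fourier transform of the Gaussian window. -/
def windowHat (b : ℝ) (ξ : Space d) : ℝ :=
  (Real.pi / b) ^ (d / 2 : ℝ) * Real.exp (-Real.pi ^ 2 * ‖ξ‖ ^ 2 / b)

theorem window_pos (b : ℝ) (y : Space d) : 0 < window b y := Real.exp_pos _

theorem window_le_one {b : ℝ} (hb : 0 < b) (y : Space d) : window b y ≤ 1 := by
  rw [window, Real.exp_le_one_iff]
  nlinarith [sq_nonneg ‖y‖]

theorem windowHat_nonneg {b : ℝ} (hb : 0 < b) (ξ : Space d) : 0 ≤ windowHat b ξ := by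
  have := Real.pi_pos
  unfold windowHat
  positivity

@[fun_prop]
theorem continuous_window (b : ℝ) : Continuous (window b : Space d → ℝ) := by
  unfold window; fun_prop

@[fun_prop]
theorem continuous_windowHat (b : ℝ) : Continuous (windowHat b : Space d → ℝ) := by
  unfold windowHat; fun_prop

theorem integrable_exp_neg_mul_norm_sq {b : ℝ} (hb : 0 < b) :
    Integrable fun y : Space d => Real.exp (-b * ‖y‖ ^ 2) := by
  have h := (GaussianFourier.integrable_cexp_neg_mul_sq_norm_add (V := Space d) (b := (b : ℂ))
    (by simpa using hb) 0 0).norm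
  refine h.congr (.of_forall fun y => ?_)
  simp only [Complex.norm_exp]
  congr 1
  simp [← Complex.ofReal_pow]

theorem lintegral_exp_neg_mul_norm_sq {b : ℝ} (hb : 0 < b) :
    ∫⁻ y : Space d, ENNReal.ofReal (Real.exp (-b * ‖y‖ ^ 2)) =
      ENNReal.ofReal ((Real.pi / b) ^ (d / 2 : ℝ)) := by
  rw [← ofReal_integral_eq_lintegral_ofReal (integrable_exp_neg_mul_norm_sq hb)
    (.of_forall fun y => (Real.exp_pos _).le), GaussianFourier.integral_rexp_neg_mul_sq_norm hb]
  simp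

theorem window_sq (b : ℝ) (y : Space d) : window b y ^ 2 = window (2 * b) y := by
  rw [window, window, ← Real.exp_nat_mul]
  congr 1
  push_cast
  ring

theorem lintegral_window_sq {b : ℝ} (hb : 0 < b) :
    ∫⁻ y : Space d, ENNReal.ofReal (window b y ^ 2) =
      ENNReal.ofReal ((Real.pi / (2 * b)) ^ (d / 2 : ℝ)) := by
  simp only [window_sq]
  exact lintegral_exp_neg_mul_norm_sq (by positivity)

theorem fourier_window {b : ℝ} (hb : 0 < b) (ξ : Space d) :
    𝓕 (fun y : Space d => (window b y : ℂ)) ξ = windowHat b ξ := by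
  have h := fourier_gaussian_innerProductSpace (V := Space d) (b := (b : ℂ)) (by simpa using hb) ξ
  have h1 : (fun y : Space d => (window b y : ℂ)) =
      fun y : Space d => Complex.exp (-b * ‖y‖ ^ 2) := by
    ext y; simp [window]
  rw [h1, h, windowHat]
  have : 0 ≤ Real.pi / b := by have := Real.pi_pos; positivity
  push_cast [Complex.ofReal_cpow this]
  simp

/-- The window translated by `x` and modulated by `p`. -/
def coherent (b : ℝ) (x p y : Space d) : ℂ :=
  (window b (y - x) : ℂ) * Complex.exp ((2 * Real.pi * inner ℝ y p : ℝ) * Complex.I)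

theorem norm_coherent (b : ℝ) (x p y : Space d) : ‖coherent b x p y‖ = window b (y - x) := by
  rw [coherent, norm_mul, Complex.norm_exp_ofReal_mul_I, mul_one, Complex.norm_real,
    Real.norm_of_nonneg (window_pos _ _).le]

theorem continuous_coherent (b : ℝ) (x p : Space d) : Continuous (coherent b x p) := by
  unfold coherent; fun_prop

theorem integrable_coherent {b : ℝ} (hb : 0 < b) (x p : Space d) : Integrable (coherent b x p) := by
  refine ((integrable_exp_neg_mul_norm_sq hb).comp_sub_right x).mono'
    (continuous_coherent b x p).aestronglyMeasurable (.of_forall fun y => ?_)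
  rw [norm_coherent]; rfl

theorem memLp_coherent {b : ℝ} (hb : 0 < b) (x p : Space d) : MemLp (coherent b x p) 2 volume := by
  rw [memLp_two_iff_integrable_sq_norm (continuous_coherent b x p).aestronglyMeasurable]
  simp only [norm_coherent, window_sq]
  exact (integrable_exp_neg_mul_norm_sq (by positivity)).comp_sub_right x

theorem fourier_coherent {b : ℝ} (hb : 0 < b) (x p ξ : Space d) : 𝓕 (coherent b x p) ξ =
    Complex.exp (-(2 * Real.pi * inner ℝ x (ξ - p) : ℝ) * Complex.I) * windowHat b (ξ - p) := by
  rw [← fourier_window hb, Real.fourier_eq', Real.fourier_eq', ← integral_const_mul,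
    ← integral_add_right_eq_self _ x]
  refine integral_congr_ae (.of_forall fun y => ?_)
  simp only [coherent, add_sub_cancel_right, smul_eq_mul, inner_add_left, inner_sub_right]
  rw [mul_left_comm, ← Complex.exp_add, ← mul_assoc, ← Complex.exp_add, mul_comm]
  congr 2
  push_cast
  ring

/-- The short-time Fourier transform. -/
def stft (b : ℝ) (f : Space d → ℂ) (x p : Space d) : ℂ := ∫ y, conj (coherent b x p y) * f y

theorem measurable_stft (b : ℝ) {f : Space d → ℂ} (hf : StronglyMeasurable f) :
    Measurable (Function.uncurry (stft b f)) := by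
  have h1 : StronglyMeasurable fun z : (Space d × Space d) × Space d =>
      conj (coherent b z.1.1 z.1.2 z.2) * f z.2 := by
    refine StronglyMeasurable.mul ?_ (hf.comp_measurable measurable_snd)
    refine Continuous.stronglyMeasurable ?_
    unfold coherent
    fun_prop
  exact h1.integral_prod_right'.measurable

theorem stft_eq_fourier (b : ℝ) (f : Space d → ℂ) (x p : Space d) :
    stft b f x p = 𝓕 (fun y => (window b (y - x) : ℂ) * f y) p := by
  rw [stft, Real.fourier_eq']
  refine integral_congr_ae (.of_forall fun y => ?_)
  simp only [coherent, map_mul, Complex.conj_ofReal, ← Complex.exp_conj, Complex.conj_I, smul_eq_mul]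
  rw [mul_comm (window b (y - x) : ℂ), mul_assoc]
  congr 2
  push_cast
  ring

theorem integrable_window_mul {b : ℝ} (hb : 0 < b) {f : Space d → ℂ} (hf : MemLp f 2 volume)
    (x : Space d) : Integrable fun y => (window b (y - x) : ℂ) * f y := by
  refine MemLp.integrable_mul (p := 2) (q := 2) ?_ hf
  have h := memLp_coherent hb x (0 : Space d)
  have h1 : coherent b x (0 : Space d) = fun y => (window b (y - x) : ℂ) := by
    ext y; simp [coherent]
  rwa [h1] at h

theorem memLp_window_mul {b : ℝ} (hb : 0 < b) {f : Space d → ℂ} (hf : MemLp f 2 volume)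
    (x : Space d) : MemLp (fun y => (window b (y - x) : ℂ) * f y) 2 volume := by
  refine hf.mono ((by fun_prop : Continuous fun y : Space d =>
    (window b (y - x) : ℂ)).aestronglyMeasurable.mul hf.1) (.of_forall fun y => ?_)
  rw [norm_mul, Complex.norm_real, Real.norm_of_nonneg (window_pos _ _).le]
  exact mul_le_of_le_one_left (norm_nonneg _) (window_le_one hb _)

/-- Plancherel in `p` at fixed `x`, giving localisation in position. -/
theorem lintegral_stft_sq {b : ℝ} (hb : 0 < b) {f : Space d → ℂ} (hf : MemLp f 2 volume)
    (x : Space d) :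
    ∫⁻ p, ‖stft b f x p‖ₑ ^ 2 = ∫⁻ y, ENNReal.ofReal (window b (y - x) ^ 2) * ‖f y‖ₑ ^ 2 := by
  simp only [stft_eq_fourier]
  rw [lintegral_fourier_sq (integrable_window_mul hb hf x) (memLp_window_mul hb hf x)]
  refine lintegral_congr fun y => ?_
  rw [enorm_mul, mul_pow, ENNReal.ofReal_pow (window_pos _ _).le, ← ofReal_norm (window b _ : ℂ),
    Complex.norm_real, Real.norm_of_nonneg (window_pos _ _).le]

theorem inner_coherent {b : ℝ} (hb : 0 < b) (f : L2 d) (x p : Space d) :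
    stft b f x p = inner ℂ ((memLp_coherent hb x p).toLp _) f := by
  rw [inner_eq_integral, stft]
  refine integral_congr_ae ?_
  filter_upwards [(memLp_coherent hb x p).coeFn_toLp] with y hy
  rw [hy]

theorem stft_eq_integral_fourier {b : ℝ} (hb : 0 < b) (f : L2 d) (x p : Space d) :
    stft b f x p = ∫ ξ, Complex.exp ((2 * Real.pi * inner ℝ x (ξ - p) : ℝ) * Complex.I) *
      ((windowHat b (ξ - p) : ℂ) * (𝓕 f : L2 d) ξ) := by
  rw [inner_coherent hb, ← Lp.inner_fourier_eq, inner_eq_integral]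
  refine integral_congr_ae ?_
  filter_upwards [fourier_toLp_ae_eq (integrable_coherent hb x p) (memLp_coherent hb x p)]
    with ξ hξ
  rw [hξ, fourier_coherent hb, map_mul, Complex.conj_ofReal, ← Complex.exp_conj, mul_assoc]
  simp only [map_mul, Complex.conj_I, ← Complex.ofReal_neg, Complex.conj_ofReal]
  congr 2
  push_cast
  ring

theorem windowHat_eq (b : ℝ) (ξ : Space d) :
    windowHat b ξ = (Real.pi / b) ^ (d / 2 : ℝ) * window (Real.pi ^ 2 / b) ξ := by
  rw [windowHat, window]
  congr 2
  ring

/-- Plancherel in `x` at fixed `p`: up to a factor of modulus one the transform is the inverse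
Fourier transform of `windowHat b (· - p)` times `𝓕 f`. This gives localisation in momentum. -/
theorem lintegral_stft_sq' {b : ℝ} (hb : 0 < b) (f : L2 d) (p : Space d) :
    ∫⁻ x, ‖stft b f x p‖ₑ ^ 2 =
      ∫⁻ ξ, ENNReal.ofReal (windowHat b (ξ - p) ^ 2) * ‖(𝓕 f : L2 d) ξ‖ₑ ^ 2 := by
  have hb' : 0 < Real.pi ^ 2 / b := by have := Real.pi_pos; positivity
  set F : Space d → ℂ := fun ξ => (windowHat b (ξ - p) : ℂ) * (𝓕 f : L2 d) ξ with hF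
  have hF' : F = fun ξ => (((Real.pi / b) ^ (d / 2 : ℝ) : ℝ) : ℂ) *
      ((window (Real.pi ^ 2 / b) (ξ - p) : ℂ) * (𝓕 f : L2 d) ξ) := by
    ext ξ
    simp only [hF, windowHat_eq]
    push_cast
    ring
  have h1 : Integrable F := by
    rw [hF']; exact (integrable_window_mul hb' (Lp.memLp _) p).const_mul _
  have h2 : MemLp F 2 volume := by
    rw [hF']; exact (memLp_window_mul hb' (Lp.memLp _) p).const_mul _
  calc ∫⁻ x, ‖stft b f x p‖ₑ ^ 2 = ∫⁻ x, ‖𝓕⁻ F x‖ₑ ^ 2 := by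
        refine lintegral_congr fun x => ?_
        have h3 : stft b f x p =
            Complex.exp ((-(2 * Real.pi * inner ℝ x p) : ℝ) * Complex.I) * 𝓕⁻ F x := by
          rw [stft_eq_integral_fourier hb, Real.fourierInv_eq', ← integral_const_mul]
          refine integral_congr_ae (.of_forall fun ξ => ?_)
          have h4 : Complex.exp ((2 * Real.pi * inner ℝ x (ξ - p) : ℝ) * Complex.I) =
              Complex.exp ((-(2 * Real.pi * inner ℝ x p) : ℝ) * Complex.I) *
                Complex.exp ((2 * Real.pi * inner ℝ ξ x : ℝ) * Complex.I) := by
            rw [← Complex.exp_add, inner_sub_right, real_inner_comm ξ x]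
            congr 1
            push_cast
            ring
          simp only [smul_eq_mul, hF]
          rw [h4, mul_assoc]
        rw [h3, enorm_mul, ← ofReal_norm (Complex.exp _), Complex.norm_exp_ofReal_mul_I]
        simp
    _ = ∫⁻ ξ, ‖F ξ‖ₑ ^ 2 := lintegral_fourierInv_sq h1 h2
    _ = _ := by
        refine lintegral_congr fun ξ => ?_
        rw [hF, enorm_mul, mul_pow, ENNReal.ofReal_pow (windowHat_nonneg hb _),
          ← ofReal_norm (windowHat b _ : ℂ), Complex.norm_real,
          Real.norm_of_nonneg (windowHat_nonneg hb _)]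

/-- Moyal's identity, with `‖window b‖²` as the constant. Absolute values are taken inside the
integral so that phase space can then be cut into regions. -/
theorem enorm_inner_le_lintegral_stft {b : ℝ} (hb : 0 < b) (h f : L2 d) :
    ENNReal.ofReal ((Real.pi / (2 * b)) ^ (d / 2 : ℝ)) * ‖inner ℂ h f‖ₑ ≤
      ∫⁻ x, ∫⁻ p, ‖stft b h x p‖ₑ * ‖stft b f x p‖ₑ := by
  have hpi := Real.pi_pos
  have hi : Integrable fun y => conj (h y) * f y :=
    integrable_conj_mul (Lp.memLp h) (Lp.memLp f)
  have h1 : ∀ x, ∫ p, conj (stft b h x p) * stft b f x p =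
      ∫ y, ((window b (y - x) ^ 2 : ℝ) : ℂ) * (conj (h y) * f y) := fun x => by
    simp only [stft_eq_fourier]
    rw [integral_conj_fourier_mul (integrable_window_mul hb (Lp.memLp h) x)
      (memLp_window_mul hb (Lp.memLp h) x) (integrable_window_mul hb (Lp.memLp f) x)
      (memLp_window_mul hb (Lp.memLp f) x)]
    refine integral_congr_ae (.of_forall fun y => ?_)
    simp only [map_mul, Complex.conj_ofReal]
    push_cast
    ring
  have hw : Integrable fun x : Space d => ((window b x ^ 2 : ℝ) : ℂ) := by
    simp only [window_sq]
    exact (integrable_exp_neg_mul_norm_sq (by positivity : 0 < 2 * b)).ofReal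
  have hw' : ∫ x : Space d, ((window b x ^ 2 : ℝ) : ℂ) =
      (((Real.pi / (2 * b)) ^ (d / 2 : ℝ) : ℝ) : ℂ) := by
    rw [integral_complex_ofReal]
    congr 1
    simp only [window_sq]
    simp only [window]
    rw [GaussianFourier.integral_rexp_neg_mul_sq_norm (by positivity)]
    simp
  have h2 : ∫ x, ∫ y, ((window b (y - x) ^ 2 : ℝ) : ℂ) * (conj (h y) * f y) =
      (((Real.pi / (2 * b)) ^ (d / 2 : ℝ) : ℝ) : ℂ) * inner ℂ h f := by
    rw [integral_integral_swap]
    · simp only [integral_mul_const]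
      rw [inner_eq_integral, ← integral_const_mul]
      refine integral_congr_ae (.of_forall fun y => ?_)
      simp only
      rw [← hw', integral_sub_left_eq_self (fun x : Space d => ((window b x ^ 2 : ℝ) : ℂ))]
    · have h3 := (hw.comp_neg.mul_prod hi)
      have h4 : MeasurePreserving (fun z : Space d × Space d => (z.1 - z.2, z.2))
          (volume.prod volume) (volume.prod volume) :=
        measurePreserving_sub_prod volume volume
      refine (h4.integrable_comp_of_integrable h3).congr (.of_forall fun z => ?_)
      simp
      rfl
  calc ENNReal.ofReal ((Real.pi / (2 * b)) ^ (d / 2 : ℝ)) * ‖inner ℂ h f‖ₑ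
      = ‖(((Real.pi / (2 * b)) ^ (d / 2 : ℝ) : ℝ) : ℂ) * inner ℂ h f‖ₑ := by
        rw [enorm_mul, ← ofReal_norm ((_ : ℝ) : ℂ), Complex.norm_real,
          Real.norm_of_nonneg (by positivity)]
    _ = ‖∫ x, ∫ p, conj (stft b h x p) * stft b f x p‖ₑ := by simp only [h1, h2]
    _ ≤ ∫⁻ x, ‖∫ p, conj (stft b h x p) * stft b f x p‖ₑ := enorm_integral_le_lintegral_enorm _
    _ ≤ ∫⁻ x, ∫⁻ p, ‖stft b h x p‖ₑ * ‖stft b f x p‖ₑ := by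
        refine lintegral_mono fun x => (enorm_integral_le_lintegral_enorm _).trans ?_
        refine lintegral_mono fun p => ?_
        simp only [enorm_mul, RCLike.enorm_conj, le_refl]

/-! ### Weights in momentum space -/

/-- The squared Japanese bracket at the scale `R`. -/
def bracket (R : ℝ) (p : Space d) : ℝ := 1 + ‖p‖ ^ 2 / R ^ 2

theorem one_le_bracket (R : ℝ) (p : Space d) : 1 ≤ bracket R p := by
  unfold bracket
  have : 0 ≤ ‖p‖ ^ 2 / R ^ 2 := by positivity
  linarith

theorem bracket_pos (R : ℝ) (p : Space d) : 0 < bracket R p :=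
  one_pos.trans_le (one_le_bracket R p)

@[fun_prop]
theorem continuous_bracket (R : ℝ) : Continuous (bracket R : Space d → ℝ) := by
  unfold bracket; fun_prop

/-- Peetre's inequality at scale `R`. It lets weights move between `p` and `ξ` at the price of a
weight in `ξ - p`, which the Gaussian `windowHat` absorbs. -/
theorem bracket_le_two_mul (R : ℝ) (p ξ : Space d) :
    bracket R p ≤ 2 * (bracket R ξ * bracket R (ξ - p)) := by
  have h0 : ∀ s t r : ℝ, 0 ≤ r → 0 ≤ s → 0 ≤ t → r ≤ s + t →
      1 + (r / R) ^ 2 ≤ 2 * ((1 + (s / R) ^ 2) * (1 + (t / R) ^ 2)) := by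
    intro s t r hr hs ht h
    have h1 : (r / R) ^ 2 ≤ (s / R + t / R) ^ 2 := by
      rw [← add_div, div_pow, div_pow]
      gcongr
    nlinarith [sq_nonneg (s / R - t / R), sq_nonneg (s / R * (t / R))]
  have h1 := h0 ‖ξ‖ ‖ξ - p‖ ‖p‖ (norm_nonneg _) (norm_nonneg _) (norm_nonneg _)
    (by simpa [norm_sub_rev] using norm_sub_le ξ (ξ - p))
  simpa only [bracket, div_pow] using h1

/-- The power `bracket R p ^ s` as a weight. -/
def weight (R s : ℝ) (p : Space d) : ℝ≥0∞ := ENNReal.ofReal (bracket R p ^ s)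

@[fun_prop]
theorem measurable_weight (R s : ℝ) : Measurable (weight R s : Space d → ℝ≥0∞) := by
  unfold weight; fun_prop

theorem weight_ne_top (R s : ℝ) (p : Space d) : weight R s p ≠ ⊤ := ENNReal.ofReal_ne_top

theorem weight_mul (R s t : ℝ) (p : Space d) : weight R s p * weight R t p = weight R (s + t) p := by
  have := bracket_pos R p
  rw [weight, weight, weight, ← ENNReal.ofReal_mul (by positivity), Real.rpow_add this]

theorem weight_zero (R : ℝ) (p : Space d) : weight R 0 p = 1 := by simp [weight]

theorem weight_neg_mul (R s : ℝ) (p : Space d) : weight R (-s) p * weight R s p = 1 := by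
  rw [weight_mul, neg_add_cancel, weight_zero]

theorem weight_sq (R s : ℝ) (p : Space d) : weight R s p ^ 2 = weight R (2 * s) p := by
  rw [sq, weight_mul, two_mul]

theorem weight_mono (R : ℝ) {s t : ℝ} (h : s ≤ t) (p : Space d) : weight R s p ≤ weight R t p :=
  ENNReal.ofReal_le_ofReal (Real.rpow_le_rpow_of_exponent_le (one_le_bracket R p) h)

theorem weight_le (R : ℝ) {s : ℝ} (hs : 0 ≤ s) (p ξ : Space d) :
    weight R s p ≤ ENNReal.ofReal (2 ^ s) * (weight R s ξ * weight R s (ξ - p)) := by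
  have h1 := bracket_pos R ξ
  have h2 := bracket_pos R (ξ - p)
  rw [weight, weight, weight, ← ENNReal.ofReal_mul (by positivity),
    ← ENNReal.ofReal_mul (by positivity), ← Real.mul_rpow h1.le h2.le,
    ← Real.mul_rpow (by positivity) (by positivity)]
  exact ENNReal.ofReal_le_ofReal (Real.rpow_le_rpow (bracket_pos _ _).le
    (bracket_le_two_mul R p ξ) hs)

theorem weight_neg_le (R : ℝ) {s : ℝ} (hs : 0 ≤ s) (p ξ : Space d) :
    weight R (-s) ξ ≤ ENNReal.ofReal (2 ^ s) * (weight R (-s) p * weight R s (ξ - p)) := by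
  have h := weight_le R hs p ξ
  calc weight R (-s) ξ = weight R (-s) ξ * (weight R (-s) p * weight R s p) := by
        rw [weight_neg_mul, mul_one]
    _ ≤ weight R (-s) ξ * (weight R (-s) p *
          (ENNReal.ofReal (2 ^ s) * (weight R s ξ * weight R s (ξ - p)))) := by gcongr
    _ = (weight R (-s) ξ * weight R s ξ) *
          (ENNReal.ofReal (2 ^ s) * (weight R (-s) p * weight R s (ξ - p))) := by ring
    _ = _ := by rw [weight_neg_mul, one_mul]

theorem lintegral_comp_inv_smul {R : ℝ} (hR : 0 < R) {g : Space d → ℝ≥0∞} (hg : Measurable g) :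
    ∫⁻ p, g (R⁻¹ • p) = ENNReal.ofReal (R ^ d) * ∫⁻ p, g p := by
  have h1 : Measurable fun p : Space d => R⁻¹ • p := measurable_const_smul _
  rw [← lintegral_map hg h1, Measure.map_addHaar_smul _ (inv_ne_zero hR.ne')]
  rw [lintegral_smul_measure]
  simp [abs_of_pos hR]

theorem exists_lintegral_weight_neg [NeZero d] :
    ∃ C : ℝ, 0 < C ∧ ∀ R : ℝ, 0 < R →
      ∫⁻ p : Space d, weight R (-d) p ≤ ENNReal.ofReal (C * R ^ d) := by
  have hd : (0 : ℝ) < d := by exact_mod_cast Nat.pos_of_ne_zero (NeZero.ne d)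
  have h1 := integrable_rpow_neg_one_add_norm_sq (E := Space d) (μ := volume) (r := 2 * d)
    (by simp; linarith)
  have h2 : ∫⁻ p : Space d, weight 1 (-d) p =
      ENNReal.ofReal (∫ p : Space d, (1 + ‖p‖ ^ 2) ^ (-(2 * d : ℝ) / 2)) := by
    rw [ofReal_integral_eq_lintegral_ofReal h1 (.of_forall fun p => by positivity)]
    refine lintegral_congr fun p => ?_
    rw [weight, bracket]
    congr 2 <;> ring
  set I := ∫ p : Space d, (1 + ‖p‖ ^ 2) ^ (-(2 * d : ℝ) / 2)
  refine ⟨|I| + 1, by positivity, fun R hR => ?_⟩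
  calc ∫⁻ p : Space d, weight R (-d) p = ∫⁻ p : Space d, weight 1 (-d) (R⁻¹ • p) := by
        refine lintegral_congr fun p => ?_
        rw [weight, weight, bracket, bracket, norm_smul]
        congr 3
        rw [norm_inv, Real.norm_of_nonneg hR.le]
        field_simp
    _ = ENNReal.ofReal (R ^ d) * ENNReal.ofReal I := by
        rw [lintegral_comp_inv_smul hR (measurable_weight _ _), h2]
    _ ≤ _ := by
        rw [← ENNReal.ofReal_mul (by positivity), mul_comm]
        refine ENNReal.ofReal_le_ofReal ?_
        gcongr
        linarith [le_abs_self I]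

/-- The power of the bracket is at most `d! exp(bracket)`, which uses up only half of a Gaussian
bound `exp(-2|p|²/R²)` for `windowHat²`. The range of `c` covers the two windows in use, `R²` for
the majorant and `2R²` for the pairing. -/
theorem exists_lintegral_weight_mul_windowHat_sq (d : ℕ) :
    ∃ C : ℝ, 0 < C ∧ ∀ R c : ℝ, 0 < R → 1 ≤ c → c ≤ 2 →
      ∫⁻ p : Space d, weight R d p * ENNReal.ofReal (windowHat (c * R ^ 2) p ^ 2) ≤
        ENNReal.ofReal (C / R ^ d) := by
  have hpi := Real.pi_pos
  refine ⟨d.factorial * Real.exp 1 * Real.pi ^ d * Real.pi ^ (d / 2 : ℝ), by positivity,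
    fun R c hR hc1 hc2 => ?_⟩
  have hR2 : 0 < R⁻¹ ^ 2 := by positivity
  have key : ∀ p : Space d, bracket R p ^ (d : ℝ) * windowHat (c * R ^ 2) p ^ 2 ≤
      (d.factorial * Real.exp 1 * (Real.pi / R ^ 2) ^ d) * Real.exp (-(R⁻¹ ^ 2) * ‖p‖ ^ 2) := by
    intro p
    have h1 : bracket R p ^ (d : ℝ) ≤ d.factorial * Real.exp (bracket R p) := by
      rw [Real.rpow_natCast]
      have := Real.pow_div_factorial_le_exp _ (bracket_pos R p).le d
      rwa [div_le_iff₀' (by positivity)] at this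
    have h2 : windowHat (c * R ^ 2) p ^ 2 ≤ (Real.pi / R ^ 2) ^ d *
        Real.exp (-2 * (R⁻¹ ^ 2 * ‖p‖ ^ 2)) := by
      rw [windowHat, mul_pow, ← Real.rpow_mul_natCast (by positivity), ← Real.exp_nat_mul]
      have e1 : (d / 2 : ℝ) * (2 : ℕ) = (d : ℕ) := by push_cast; ring
      rw [e1, Real.rpow_natCast]
      have e2 : ((2 : ℕ) : ℝ) * (-Real.pi ^ 2 * ‖p‖ ^ 2 / (c * R ^ 2)) =
          -((2 / c) * Real.pi ^ 2 * (R⁻¹ ^ 2 * ‖p‖ ^ 2)) := by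
        push_cast
        field_simp
      have e3 : 2 ≤ 2 / c * Real.pi ^ 2 := by
        have : 1 ≤ 2 / c := by rw [le_div_iff₀ (by linarith)]; linarith
        nlinarith [Real.pi_gt_three]
      have e4 : 0 ≤ R⁻¹ ^ 2 * ‖p‖ ^ 2 := by positivity
      refine mul_le_mul ?_ (Real.exp_le_exp.2 (by rw [e2]; nlinarith)) (Real.exp_pos _).le
        (by positivity)
      gcongr
      exact le_mul_of_one_le_left (by positivity) hc1
    calc _ ≤ (d.factorial * Real.exp (bracket R p)) * ((Real.pi / R ^ 2) ^ d *
        Real.exp (-2 * (R⁻¹ ^ 2 * ‖p‖ ^ 2))) := by gcongr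
      _ = (d.factorial * (Real.pi / R ^ 2) ^ d) *
          (Real.exp (bracket R p) * Real.exp (-2 * (R⁻¹ ^ 2 * ‖p‖ ^ 2))) := by ring
      _ = (d.factorial * (Real.pi / R ^ 2) ^ d) *
          (Real.exp 1 * Real.exp (-(R⁻¹ ^ 2) * ‖p‖ ^ 2)) := by
          rw [← Real.exp_add, ← Real.exp_add, bracket]
          congr 2
          field_simp
          ring
      _ = _ := by ring
  calc _ ≤ ∫⁻ p : Space d, ENNReal.ofReal (d.factorial * Real.exp 1 * (Real.pi / R ^ 2) ^ d) *
        ENNReal.ofReal (Real.exp (-(R⁻¹ ^ 2) * ‖p‖ ^ 2)) := by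
        refine lintegral_mono fun p => ?_
        rw [weight, ← ENNReal.ofReal_mul (by have := bracket_pos R p; positivity),
          ← ENNReal.ofReal_mul (by positivity)]
        exact ENNReal.ofReal_le_ofReal (key p)
    _ = _ := by
        rw [lintegral_const_mul' _ _ ENNReal.ofReal_ne_top, lintegral_exp_neg_mul_norm_sq hR2,
          ← ENNReal.ofReal_mul (by positivity)]
        congr 1
        rw [inv_pow, div_inv_eq_mul, Real.mul_rpow hpi.le (by positivity), div_pow]
        have : (R ^ 2) ^ (d / 2 : ℝ) = R ^ d := by
          rw [← Real.rpow_natCast_mul hR.le]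
          push_cast
          rw [mul_div_cancel₀ _ two_ne_zero, Real.rpow_natCast]
        rw [this]
        field_simp
        ring

/-! ### Bessel families -/

/-- Families that satisfy Bessel's inequality. -/
def IsBessel {ι : Type*} [Fintype ι] (a : ι → L2 d) : Prop :=
  ∀ g : L2 d, ∑ i, ‖inner ℂ (a i) g‖ₑ ^ 2 ≤ ‖g‖ₑ ^ 2

theorem IsBessel.enorm_le_one {ι : Type*} [Fintype ι] {a : ι → L2 d} (ha : IsBessel a) (i : ι) :
    ‖a i‖ₑ ≤ 1 := by
  have h1 : ‖inner ℂ (a i) (a i)‖ₑ ^ 2 ≤ ‖a i‖ₑ ^ 2 :=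
    (Finset.single_le_sum (f := fun j => ‖inner ℂ (a j) (a i)‖ₑ ^ 2) (fun _ _ => zero_le)
      (Finset.mem_univ i)).trans (ha (a i))
  have h2 := (ENNReal.pow_le_pow_left_iff two_ne_zero).1 h1
  rw [← ofReal_norm, ← ofReal_norm, inner_self_eq_norm_sq_to_K, norm_pow,
    ENNReal.ofReal_le_ofReal_iff (norm_nonneg _)] at h2
  simp only [RCLike.norm_ofReal, abs_norm] at h2
  rw [← ofReal_norm, ENNReal.ofReal_le_one]
  nlinarith [norm_nonneg (a i)]

/-- Bessel's inequality for `star G`. It will be applied at a fixed point `x` or `(x, p)`, where it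
bounds the sum over the family independently of its size. -/
theorem IsBessel.sum_enorm_integral_sq_le {ι : Type*} [Fintype ι] {a : ι → L2 d}
    (ha : IsBessel a) {G : Space d → ℂ} (hG : MemLp G 2 volume) :
    ∑ i, ‖∫ y, G y * a i y‖ₑ ^ 2 ≤ ∫⁻ y, ‖G y‖ₑ ^ 2 := by
  have h1 : ∀ i, ‖∫ y, G y * a i y‖ₑ = ‖inner ℂ (a i) (hG.star.toLp _)‖ₑ := fun i => by
    rw [inner_eq_integral, ← RCLike.enorm_conj, ← integral_conj]
    congr 1
    refine integral_congr_ae ?_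
    filter_upwards [hG.star.coeFn_toLp] with y hy
    rw [hy]
    simp [mul_comm]
  simp only [h1]
  refine (ha _).trans ?_
  rw [enorm_sq_eq_lintegral]
  refine (lintegral_congr_ae ?_).le
  filter_upwards [hG.star.coeFn_toLp] with y hy
  rw [hy]
  simp

/-! ### Cauchy–Schwarz inequalities for lower integrals -/

theorem le_mul_of_rpow_half_le {a b A B : ℝ≥0∞} {c : ℝ≥0∞}
    (h : c ≤ a ^ (1 / 2 : ℝ) * b ^ (1 / 2 : ℝ)) (ha : a ≤ A ^ 2) (hb : b ≤ B ^ 2) : c ≤ A * B := by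
  have h1 : ∀ z : ℝ≥0∞, (z ^ 2) ^ (1 / 2 : ℝ) = z := fun z => by
    rw [← ENNReal.rpow_natCast, ← ENNReal.rpow_mul]
    norm_num
  refine h.trans (mul_le_mul' ?_ ?_)
  · exact (ENNReal.rpow_le_rpow ha (by norm_num)).trans (h1 A).le
  · exact (ENNReal.rpow_le_rpow hb (by norm_num)).trans (h1 B).le

theorem lintegral_mul_le_of_sq_le {α : Type*} [MeasurableSpace α] {μ : Measure α}
    {f g : α → ℝ≥0∞} (hf : AEMeasurable f μ) (hg : AEMeasurable g μ) {A B : ℝ≥0∞}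
    (h1 : ∫⁻ x, f x ^ 2 ∂μ ≤ A ^ 2) (h2 : ∫⁻ x, g x ^ 2 ∂μ ≤ B ^ 2) :
    ∫⁻ x, f x * g x ∂μ ≤ A * B := by
  have h := ENNReal.lintegral_mul_le_Lp_mul_Lq μ Real.HolderConjugate.two_two hf hg
  simp only [ENNReal.rpow_two] at h
  exact le_mul_of_rpow_half_le h h1 h2

theorem lintegral_lintegral_mul_le_of_sq_le {f g : Space d → Space d → ℝ≥0∞}
    (hf : Measurable (Function.uncurry f)) (hg : Measurable (Function.uncurry g)) {A B : ℝ≥0∞}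
    (h1 : ∫⁻ x, ∫⁻ p, f x p ^ 2 ≤ A ^ 2) (h2 : ∫⁻ x, ∫⁻ p, g x p ^ 2 ≤ B ^ 2) :
    ∫⁻ x, ∫⁻ p, f x p * g x p ≤ A * B := by
  have h := lintegral_mul_le_of_sq_le (μ := (volume : Measure (Space d × Space d)))
    hf.aemeasurable hg.aemeasurable (A := A) (B := B)
  simp only [Measure.volume_eq_prod] at h
  rw [lintegral_prod _ (by fun_prop), lintegral_prod _ (by fun_prop),
    lintegral_prod _ (by fun_prop)] at h
  exact h h1 h2

theorem sum_mul_le_of_sq_le {ι : Type*} [Fintype ι] {f g : ι → ℝ≥0∞} {A B : ℝ≥0∞}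
    (h1 : ∑ i, f i ^ 2 ≤ A ^ 2) (h2 : ∑ i, g i ^ 2 ≤ B ^ 2) : ∑ i, f i * g i ≤ A * B := by
  have h := ENNReal.inner_le_Lp_mul_Lq Finset.univ f g Real.HolderConjugate.two_two
  simp only [ENNReal.rpow_two] at h
  exact le_mul_of_rpow_half_le h h1 h2

/-! ### A local majorant -/

/-- Fourier inversion for the windowed function; when its transform is not integrable the right side
is infinite. -/
theorem enorm_window_mul_le {b : ℝ} (hb : 0 < b) (B : 𝓢(Space d, ℂ)) (x y : Space d) :
    ‖(window b (y - x) : ℂ) * B y‖ₑ ≤ ∫⁻ p, ‖stft b B x p‖ₑ := by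
  have hB : MemLp B 2 (volume : Measure (Space d)) := B.memLp 2 _
  set F : Space d → ℂ := fun y => (window b (y - x) : ℂ) * B y with hF
  have hFc : Continuous F := by
    have := B.continuous
    fun_prop
  have hFi : Integrable F := integrable_window_mul hb hB x
  have h1 : ∀ p, stft b B x p = 𝓕 F p := fun p => stft_eq_fourier b B x p
  simp only [h1]
  by_cases htop : ∫⁻ p, ‖𝓕 F p‖ₑ = ⊤
  · rw [htop]; exact le_top
  have hG : Integrable (𝓕 F) := ⟨(continuous_fourier hFi).aestronglyMeasurable, lt_top_iff_ne_top.2 htop⟩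
  have h2 : F y = 𝓕⁻ (𝓕 F) y := by rw [hFc.fourierInv_fourier_eq hFi hG]
  change ‖F y‖ₑ ≤ _
  rw [h2, Real.fourierInv_eq']
  refine (enorm_integral_le_lintegral_enorm _).trans (lintegral_mono fun p => ?_)
  rw [enorm_smul, ← ofReal_norm (Complex.exp _), Complex.norm_exp_ofReal_mul_I]
  simp

/-- The square of a local majorant of `B` at the scale `R⁻¹`. -/
def majorantSq (R : ℝ) (B : Space d → ℂ) (x : Space d) : ℝ≥0∞ :=
  (∫⁻ p : Space d, weight R (-d) p) * ∫⁻ p, weight R d p * ‖stft (R ^ 2) B x p‖ₑ ^ 2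

theorem measurable_majorantSq (R : ℝ) {B : Space d → ℂ} (hB : StronglyMeasurable B) :
    Measurable (majorantSq R B) := by
  have h := measurable_stft (R ^ 2) hB
  have h1 : Measurable fun z : Space d × Space d =>
      weight R d z.2 * ‖Function.uncurry (stft (R ^ 2) B) z‖ₑ ^ 2 := by fun_prop
  have h2 : Measurable fun x => ∫⁻ p, weight R d p * ‖stft (R ^ 2) B x p‖ₑ ^ 2 :=
    h1.lintegral_prod_right' (ν := volume)
  exact measurable_const.mul h2

theorem rpow_half_sq (z : ℝ≥0∞) : (z ^ (1 / 2 : ℝ)) ^ 2 = z := by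
  rw [← ENNReal.rpow_mul_natCast]
  norm_num

/-- Cauchy–Schwarz against the integrable weight `bracket^{-d}` in the inversion bound. The majorant
is independent of `y`, so it controls `B` uniformly near `x` at length scale `1/R`. -/
theorem enorm_window_mul_sq_le {R : ℝ} (hR : 0 < R) (B : 𝓢(Space d, ℂ)) (x y : Space d) :
    ‖(window (R ^ 2) (y - x) : ℂ) * B y‖ₑ ^ 2 ≤ majorantSq R B x := by
  have hm : Measurable (stft (R ^ 2) B x) :=
    (measurable_stft (R ^ 2) B.continuous.stronglyMeasurable).of_uncurry_left
  have h2 : ∀ p : Space d, weight R (-d / 2) p ^ 2 = weight R (-d) p := fun p => by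
    rw [weight_sq]; congr 1; ring
  have h3 : ∀ p : Space d, weight R (d / 2) p ^ 2 = weight R d p := fun p => by
    rw [weight_sq]; congr 1; ring
  calc ‖(window (R ^ 2) (y - x) : ℂ) * B y‖ₑ ^ 2
      ≤ (∫⁻ p, weight R (-d / 2) p * (weight R (d / 2) p * ‖stft (R ^ 2) B x p‖ₑ)) ^ 2 := by
        gcongr
        refine (enorm_window_mul_le (by positivity) B x y).trans_eq ?_
        refine lintegral_congr fun p => ?_
        rw [← mul_assoc, neg_div, weight_neg_mul, one_mul]
    _ ≤ ((∫⁻ p : Space d, weight R (-d) p) ^ (1 / 2 : ℝ) *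
          (∫⁻ p, weight R d p * ‖stft (R ^ 2) B x p‖ₑ ^ 2) ^ (1 / 2 : ℝ)) ^ 2 := by
        gcongr
        refine lintegral_mul_le_of_sq_le (by fun_prop) (by fun_prop) ?_ ?_
        · rw [rpow_half_sq]
          simp only [h2, le_refl]
        · rw [rpow_half_sq]
          simp only [mul_pow, h3, le_refl]
    _ = _ := by
        rw [mul_pow, rpow_half_sq, rpow_half_sq, majorantSq]

theorem stft_congr_ae (b : ℝ) {f g : Space d → ℂ} (h : f =ᵐ[volume] g) : stft b f = stft b g := by
  ext x p
  refine integral_congr_ae ?_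
  filter_upwards [h] with y hy
  rw [hy]

/-- Plancherel in `x`, then Peetre's inequality splits the weight into one on `ξ` and one on `ξ -
p`, and the `p` integral factors out by translation. -/
theorem lintegral_lintegral_stft_sq_le {R b s : ℝ} (hb : 0 < b) (hs : 0 ≤ s) (f : L2 d) :
    ∫⁻ x, ∫⁻ p, weight R s p * ‖stft b f x p‖ₑ ^ 2 ≤
      ENNReal.ofReal (2 ^ s) * (∫⁻ p : Space d, weight R s p * ENNReal.ofReal (windowHat b p ^ 2)) *
        ∫⁻ ξ, weight R s ξ * ‖(𝓕 f : L2 d) ξ‖ₑ ^ 2 := by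
  have hm := measurable_stft b (Lp.stronglyMeasurable f)
  have hF : Measurable ((𝓕 f : L2 d) : Space d → ℂ) := (Lp.stronglyMeasurable _).measurable
  rw [lintegral_lintegral_swap]
  swap
  · exact (((measurable_weight R s).comp measurable_snd).mul (hm.enorm.pow_const 2)).aemeasurable
  calc ∫⁻ p, ∫⁻ x, weight R s p * ‖stft b f x p‖ₑ ^ 2
      = ∫⁻ p, ∫⁻ ξ, weight R s p *
          (ENNReal.ofReal (windowHat b (ξ - p) ^ 2) * ‖(𝓕 f : L2 d) ξ‖ₑ ^ 2) := by
        refine lintegral_congr fun p => ?_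
        rw [lintegral_const_mul' _ _ (weight_ne_top _ _ _), lintegral_stft_sq' hb,
          lintegral_const_mul' _ _ (weight_ne_top _ _ _)]
    _ ≤ ∫⁻ p, ∫⁻ ξ, ENNReal.ofReal (2 ^ s) * ((weight R s ξ * ‖(𝓕 f : L2 d) ξ‖ₑ ^ 2) *
          (weight R s (ξ - p) * ENNReal.ofReal (windowHat b (ξ - p) ^ 2))) := by
        refine lintegral_mono fun p => lintegral_mono fun ξ => ?_
        refine (mul_le_mul' (weight_le R hs p ξ) le_rfl).trans_eq ?_
        ring
    _ = ∫⁻ ξ, ∫⁻ p, ENNReal.ofReal (2 ^ s) * ((weight R s ξ * ‖(𝓕 f : L2 d) ξ‖ₑ ^ 2) *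
          (weight R s (ξ - p) * ENNReal.ofReal (windowHat b (ξ - p) ^ 2))) := by
        rw [lintegral_lintegral_swap]
        fun_prop
    _ = _ := by
        have h1 : ∀ ξ : Space d, ∫⁻ p, weight R s (ξ - p) * ENNReal.ofReal (windowHat b (ξ - p) ^ 2) =
            ∫⁻ p : Space d, weight R s p * ENNReal.ofReal (windowHat b p ^ 2) := fun ξ =>
          lintegral_sub_left_eq_self
            (fun p : Space d => weight R s p * ENNReal.ofReal (windowHat b p ^ 2)) ξ
        have h2 : ∀ ξ : Space d, ∫⁻ p, ENNReal.ofReal (2 ^ s) *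
            ((weight R s ξ * ‖(𝓕 f : L2 d) ξ‖ₑ ^ 2) *
              (weight R s (ξ - p) * ENNReal.ofReal (windowHat b (ξ - p) ^ 2))) =
            ENNReal.ofReal (2 ^ s) * (∫⁻ p : Space d, weight R s p *
              ENNReal.ofReal (windowHat b p ^ 2)) * (weight R s ξ * ‖(𝓕 f : L2 d) ξ‖ₑ ^ 2) :=
          fun ξ => by
            rw [lintegral_const_mul _ (by fun_prop), lintegral_const_mul _ (by fun_prop), h1]
            ring
        simp only [h2]
        rw [lintegral_const_mul _ (by fun_prop)]

/-- The factor `R^d` from the integrable weight cancels `R^{-d}` from the Gaussian, so the constant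
does not see the scale. -/
theorem exists_lintegral_majorantSq_le [NeZero d] :
    ∃ C : ℝ, 0 < C ∧ ∀ R : ℝ, 0 < R → ∀ B : 𝓢(Space d, ℂ),
      ∫⁻ x, majorantSq R B x ≤ ENNReal.ofReal C * ∫⁻ ξ, weight R d ξ * ‖𝓕 B ξ‖ₑ ^ 2 := by
  obtain ⟨C₁, hC₁, h1⟩ := exists_lintegral_weight_neg (d := d)
  obtain ⟨C₂, hC₂, h2⟩ := exists_lintegral_weight_mul_windowHat_sq d
  refine ⟨C₁ * 2 ^ (d : ℝ) * C₂, by positivity, fun R hR B => ?_⟩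
  have h3 : stft (R ^ 2) B = stft (R ^ 2) (toL2 d B) := stft_congr_ae _ (coeFn_toL2 B).symm
  have h4 : ∫⁻ ξ, weight R d ξ * ‖(𝓕 (toL2 d B) : L2 d) ξ‖ₑ ^ 2 =
      ∫⁻ ξ, weight R d ξ * ‖𝓕 B ξ‖ₑ ^ 2 := by
    refine lintegral_congr_ae ?_
    have h5 : (𝓕 (toL2 d B) : L2 d) = toL2 d (𝓕 B) := SchwartzMap.toLp_fourier_eq B
    rw [h5]
    filter_upwards [coeFn_toL2 (𝓕 B)] with ξ hξ
    rw [hξ]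
  have h6 := lintegral_lintegral_stft_sq_le (R := R) (b := R ^ 2) (s := d) (by positivity)
    (by positivity) (toL2 d B)
  have h7 := h2 R 1 hR le_rfl (by norm_num)
  rw [one_mul] at h7
  unfold majorantSq
  rw [h3, lintegral_const_mul _ ?_]
  swap
  · refine Measurable.lintegral_prod_right' (f := fun z : Space d × Space d =>
      weight R d z.2 * ‖stft (R ^ 2) (toL2 d B) z.1 z.2‖ₑ ^ 2) ?_
    exact ((measurable_weight R d).comp measurable_snd).mul
      ((measurable_stft (R ^ 2) (Lp.stronglyMeasurable _)).enorm.pow_const 2)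
  calc _ ≤ ENNReal.ofReal (C₁ * R ^ d) * (ENNReal.ofReal (2 ^ (d : ℝ)) *
        ENNReal.ofReal (C₂ / R ^ d) * ∫⁻ ξ, weight R d ξ * ‖𝓕 B ξ‖ₑ ^ 2) := by
        rw [← h4]
        exact mul_le_mul' (h1 R hR) (h6.trans (by gcongr))
    _ = _ := by
        rw [← mul_assoc, ← mul_assoc, ← ENNReal.ofReal_mul (by positivity),
          ← ENNReal.ofReal_mul (by positivity)]
        congr 2
        field_simp

/-! ### The high-frequency multiplier -/

/-- The multiplier `(2π|ξ|)^{-d/2}`, cut off to `|ξ| > R`. -/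
def highMultiplier (R : ℝ) (ξ : Space d) : ℝ :=
  if R < ‖ξ‖ then (2 * Real.pi * ‖ξ‖) ^ (-(d / 2) : ℝ) else 0

theorem measurable_highMultiplier (R : ℝ) : Measurable (highMultiplier R : Space d → ℝ) := by
  unfold highMultiplier
  refine Measurable.ite (measurableSet_lt measurable_const measurable_norm) ?_ measurable_const
  fun_prop

/-- For `|ξ| > R` the bracket is comparable with `(|ξ|/R)²`, so the cut-off multiplier is at most a
constant times `R^{-d/2} bracket^{-d/4}`, a bound without singularity. -/
theorem highMultiplier_sq_mul_le {R : ℝ} (hR : 0 < R) (ξ : Space d) :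
    ENNReal.ofReal (highMultiplier R ξ ^ 2) * weight R (d / 2) ξ ≤
      ENNReal.ofReal (2 ^ (d / 2 : ℝ) / R ^ d) := by
  have hpi := Real.pi_gt_three
  have hb := bracket_pos R ξ
  rw [weight, ← ENNReal.ofReal_mul (by positivity)]
  refine ENNReal.ofReal_le_ofReal ?_
  unfold highMultiplier
  split_ifs with h
  · have hξ : 0 < ‖ξ‖ := hR.trans h
    have h1 : bracket R ξ ≤ 2 * (‖ξ‖ / R) ^ 2 := by
      rw [bracket, ← div_pow]
      have : 1 ≤ ‖ξ‖ / R := by rw [le_div_iff₀ hR]; linarith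
      nlinarith
    have h2 : bracket R ξ ^ (d / 2 : ℝ) ≤ 2 ^ (d / 2 : ℝ) * (‖ξ‖ / R) ^ d := by
      refine (Real.rpow_le_rpow hb.le h1 (by positivity)).trans_eq ?_
      rw [Real.mul_rpow (by norm_num) (by positivity), ← Real.rpow_natCast_mul (by positivity)]
      congr 1
      push_cast
      rw [mul_div_cancel₀ _ two_ne_zero, Real.rpow_natCast]
    have h3 : ((2 * Real.pi * ‖ξ‖) ^ (-(d / 2) : ℝ)) ^ 2 ≤ (‖ξ‖ ^ d)⁻¹ := by
      rw [← Real.rpow_mul_natCast (by positivity)]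
      have : (-(d / 2) : ℝ) * (2 : ℕ) = -(d : ℕ) := by push_cast; ring
      rw [this, Real.rpow_neg (by positivity), Real.rpow_natCast]
      gcongr
      nlinarith
    calc _ ≤ (‖ξ‖ ^ d)⁻¹ * (2 ^ (d / 2 : ℝ) * (‖ξ‖ / R) ^ d) := by gcongr
      _ = _ := by
        rw [div_pow]
        field_simp
  · simp only [ne_eq, OfNat.ofNat_ne_zero, not_false_eq_true, zero_pow, zero_mul]
    positivity

/-! ### The high-frequency part -/

theorem memLp_two_of_lintegral_ne_top {f : Space d → ℂ} (hf : AEStronglyMeasurable f volume)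
    (h : ∫⁻ x, ‖f x‖ₑ ^ 2 ≠ ⊤) : MemLp f 2 volume := by
  refine ⟨hf, ?_⟩
  rw [eLpNorm_lt_top_iff_lintegral_rpow_enorm_lt_top (by norm_num) (by norm_num)]
  simpa using lt_top_iff_ne_top.2 h

theorem highMultiplier_sq_le {R : ℝ} (hR : 0 < R) (ξ : Space d) :
    ENNReal.ofReal (highMultiplier R ξ ^ 2) ≤
      ENNReal.ofReal (2 ^ (d / 2 : ℝ) / R ^ d) * weight R (-(d / 2)) ξ := by
  calc ENNReal.ofReal (highMultiplier R ξ ^ 2)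
      = ENNReal.ofReal (highMultiplier R ξ ^ 2) * weight R (d / 2) ξ * weight R (-(d / 2)) ξ := by
        rw [mul_assoc, mul_comm (weight R _ ξ), weight_neg_mul, mul_one]
    _ ≤ _ := mul_le_mul' (highMultiplier_sq_mul_le hR ξ) le_rfl

theorem enorm_ofReal_sq (r : ℝ) : ‖(r : ℂ)‖ₑ ^ 2 = ENNReal.ofReal (r ^ 2) := by
  rw [← ofReal_norm, Complex.norm_real, ← ENNReal.ofReal_pow (norm_nonneg _), Real.norm_eq_abs,
    sq_abs]

theorem lintegral_windowHat_mul_highMultiplier_sq_le {C R : ℝ} (hR : 0 < R)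
    (hC : ∫⁻ p : Space d, weight R d p * ENNReal.ofReal (windowHat (2 * R ^ 2) p ^ 2) ≤
        ENNReal.ofReal (C / R ^ d)) (p : Space d) :
    ∫⁻ ξ, ENNReal.ofReal (windowHat (2 * R ^ 2) (ξ - p) ^ 2) *
      ENNReal.ofReal (highMultiplier R ξ ^ 2) ≤
        ENNReal.ofReal (2 ^ d * C / (R ^ d) ^ 2) * weight R (-(d / 2)) p := by
  have hd : (0 : ℝ) ≤ d / 2 := by positivity
  have hc : (0 : ℝ) ≤ 2 ^ (d / 2 : ℝ) / R ^ d := by positivity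
  have h2 : (2 : ℝ) ^ (d / 2 : ℝ) * 2 ^ (d / 2 : ℝ) = 2 ^ d := by
    rw [← Real.rpow_add (by norm_num), add_halves, Real.rpow_natCast]
  calc _ ≤ ∫⁻ ξ, ENNReal.ofReal (2 ^ (d / 2 : ℝ) / R ^ d) * ENNReal.ofReal (2 ^ (d / 2 : ℝ)) *
        weight R (-(d / 2)) p *
          (weight R d (ξ - p) * ENNReal.ofReal (windowHat (2 * R ^ 2) (ξ - p) ^ 2)) := by
        refine lintegral_mono fun ξ => ?_
        calc _ ≤ ENNReal.ofReal (windowHat (2 * R ^ 2) (ξ - p) ^ 2) *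
              (ENNReal.ofReal (2 ^ (d / 2 : ℝ) / R ^ d) * (ENNReal.ofReal (2 ^ (d / 2 : ℝ)) *
                (weight R (-(d / 2)) p * weight R d (ξ - p)))) := by
              refine mul_le_mul' le_rfl ((highMultiplier_sq_le hR ξ).trans ?_)
              refine mul_le_mul' le_rfl ((weight_neg_le R hd p ξ).trans ?_)
              exact mul_le_mul' le_rfl (mul_le_mul' le_rfl (weight_mono R (by linarith) _))
          _ = _ := by ring
    _ = ENNReal.ofReal (2 ^ (d / 2 : ℝ) / R ^ d) * ENNReal.ofReal (2 ^ (d / 2 : ℝ)) *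
        weight R (-(d / 2)) p *
          ∫⁻ ξ : Space d, weight R d ξ * ENNReal.ofReal (windowHat (2 * R ^ 2) ξ ^ 2) := by
        rw [lintegral_const_mul _ (by fun_prop), lintegral_sub_right_eq_self
          (fun ξ : Space d => weight R d ξ * ENNReal.ofReal (windowHat (2 * R ^ 2) ξ ^ 2)) p]
    _ ≤ ENNReal.ofReal (2 ^ (d / 2 : ℝ) / R ^ d) * ENNReal.ofReal (2 ^ (d / 2 : ℝ)) *
        weight R (-(d / 2)) p * ENNReal.ofReal (C / R ^ d) := by gcongr
    _ = _ := by
        rw [mul_right_comm, ← ENNReal.ofReal_mul hc, ← ENNReal.ofReal_mul (by positivity), ← h2]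
        congr 2
        field_simp

/-- The families `u` with `û = 1_{|ξ|>R} (2π|ξ|)^{-d/2} a`. -/
def IsHighPart (R : ℝ) (a u : L2 d) : Prop :=
  ((𝓕 u : L2 d) : Space d → ℂ) =ᵐ[volume] fun ξ => (highMultiplier R ξ : ℂ) * a ξ

/-- At a fixed point of phase space the transform of each `u i` is the integral of `a i` against one
function `G` common to all `i`, so Bessel's inequality bounds the whole sum. -/
theorem sum_enorm_stft_high_sq_le {C R : ℝ} (hR : 0 < R)
    (hC : ∫⁻ p : Space d, weight R d p * ENNReal.ofReal (windowHat (2 * R ^ 2) p ^ 2) ≤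
        ENNReal.ofReal (C / R ^ d)) {N : ℕ} {a u : Fin N → L2 d} (ha : IsBessel a)
    (hu : ∀ i, IsHighPart R (a i) (u i)) (x p : Space d) :
    ∑ i, ‖stft (2 * R ^ 2) (u i) x p‖ₑ ^ 2 ≤
      ENNReal.ofReal (2 ^ d * C / (R ^ d) ^ 2) * weight R (-(d / 2)) p := by
  set G : Space d → ℂ := fun ξ => Complex.exp ((2 * Real.pi * inner ℝ x (ξ - p) : ℝ) * Complex.I) *
    ((windowHat (2 * R ^ 2) (ξ - p) : ℂ) * (highMultiplier R ξ : ℂ)) with hG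
  have h1 : ∀ i, stft (2 * R ^ 2) (u i) x p = ∫ ξ, G ξ * a i ξ := fun i => by
    rw [stft_eq_integral_fourier (by positivity)]
    refine integral_congr_ae ?_
    filter_upwards [hu i] with ξ hξ
    rw [hξ, hG]
    ring
  have h2 : ∫⁻ ξ, ‖G ξ‖ₑ ^ 2 ≤
      ENNReal.ofReal (2 ^ d * C / (R ^ d) ^ 2) * weight R (-(d / 2)) p := by
    refine le_trans (le_of_eq (lintegral_congr fun ξ => ?_))
      (lintegral_windowHat_mul_highMultiplier_sq_le hR hC p)
    rw [hG, enorm_mul, enorm_mul, mul_pow, mul_pow, enorm_ofReal_sq, enorm_ofReal_sq,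
      ← ofReal_norm (Complex.exp _), Complex.norm_exp_ofReal_mul_I]
    simp
  have hGm : Measurable G := by
    have := measurable_highMultiplier (d := d) R
    rw [hG]
    fun_prop
  simp only [h1]
  refine (ha.sum_enorm_integral_sq_le (memLp_two_of_lintegral_ne_top hGm.aestronglyMeasurable
    (ne_top_of_le_ne_top ?_ h2))).trans h2
  exact ENNReal.mul_ne_top ENNReal.ofReal_ne_top (weight_ne_top _ _ _)

/-- The counterpart for a single function: instead of summing over the family at a point, one
integrates over all of phase space, with the weight that the multiplier gains. -/
theorem lintegral_stft_high_sq_le {C R : ℝ} (hR : 0 < R)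
    (hC : ∫⁻ p : Space d, weight R d p * ENNReal.ofReal (windowHat (2 * R ^ 2) p ^ 2) ≤
        ENNReal.ofReal (C / R ^ d)) {a u : L2 d} (hu : IsHighPart R a u) (ha : ‖a‖ₑ ≤ 1) :
    ∫⁻ x, ∫⁻ p, weight R (d / 2) p * ‖stft (2 * R ^ 2) u x p‖ₑ ^ 2 ≤
      ENNReal.ofReal (2 ^ d * C / (R ^ d) ^ 2) := by
  have hd : (0 : ℝ) ≤ d / 2 := by positivity
  have hc : (0 : ℝ) ≤ 2 ^ (d / 2 : ℝ) / R ^ d := by positivity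
  have h2 : (2 : ℝ) ^ (d / 2 : ℝ) * 2 ^ (d / 2 : ℝ) = 2 ^ d := by
    rw [← Real.rpow_add (by norm_num), add_halves, Real.rpow_natCast]
  have h3 : ∫⁻ ξ, weight R (d / 2) ξ * ‖(𝓕 u : L2 d) ξ‖ₑ ^ 2 ≤
      ENNReal.ofReal (2 ^ (d / 2 : ℝ) / R ^ d) := by
    calc _ = ∫⁻ ξ, ENNReal.ofReal (highMultiplier R ξ ^ 2) * weight R (d / 2) ξ * ‖a ξ‖ₑ ^ 2 := by
          refine lintegral_congr_ae ?_
          filter_upwards [hu] with ξ hξ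
          rw [hξ, enorm_mul, mul_pow, enorm_ofReal_sq]
          ring
      _ ≤ ∫⁻ ξ, ENNReal.ofReal (2 ^ (d / 2 : ℝ) / R ^ d) * ‖a ξ‖ₑ ^ 2 :=
          lintegral_mono fun ξ => mul_le_mul' (highMultiplier_sq_mul_le hR ξ) le_rfl
      _ = ENNReal.ofReal (2 ^ (d / 2 : ℝ) / R ^ d) * ‖a‖ₑ ^ 2 := by
          rw [lintegral_const_mul' _ _ ENNReal.ofReal_ne_top, enorm_sq_eq_lintegral]
      _ ≤ _ := mul_le_of_le_one_right' (pow_le_one' ha 2)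
  have h4 : ∫⁻ p : Space d, weight R (d / 2) p * ENNReal.ofReal (windowHat (2 * R ^ 2) p ^ 2) ≤
      ENNReal.ofReal (C / R ^ d) :=
    (lintegral_mono fun p => mul_le_mul' (weight_mono R (by linarith) p) le_rfl).trans hC
  refine (lintegral_lintegral_stft_sq_le (R := R) (b := 2 * R ^ 2) (by positivity) hd u).trans ?_
  calc _ ≤ ENNReal.ofReal (2 ^ (d / 2 : ℝ)) * ENNReal.ofReal (C / R ^ d) *
        ENNReal.ofReal (2 ^ (d / 2 : ℝ) / R ^ d) := by gcongr
    _ = _ := by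
        rw [mul_right_comm, ← ENNReal.ofReal_mul (by positivity), ← ENNReal.ofReal_mul (by positivity),
          ← h2]
        congr 1
        field_simp

/-! ### The products `conj B · f i` in phase space, and the Cwikel splitting -/

theorem lintegral_window_sq_sub {R : ℝ} (hR : 0 < R) (x : Space d) :
    ∫⁻ y, ENNReal.ofReal (window (R ^ 2) (y - x) ^ 2) =
      ENNReal.ofReal ((Real.pi / 2) ^ (d / 2 : ℝ) / R ^ d) := by
  have hpi := Real.pi_pos
  rw [lintegral_sub_right_eq_self (fun y : Space d => ENNReal.ofReal (window (R ^ 2) y ^ 2)) x,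
    lintegral_window_sq (by positivity)]
  congr 1
  rw [← div_div, Real.div_rpow (by positivity) (by positivity), ← Real.rpow_natCast_mul hR.le]
  congr 1
  push_cast
  rw [mul_div_cancel₀ _ two_ne_zero, Real.rpow_natCast]

/-- The window at `2R²` is the square of the window at `R²`: one factor is spent on `B`, which
becomes the majorant, and the other remains to be integrated. The sum over `i` is Bessel's
inequality for `f`. -/
theorem sum_enorm_stft_mul_sq_le {R : ℝ} (hR : 0 < R) (B : 𝓢(Space d, ℂ)) {N : ℕ}
    {f h : Fin N → L2 d} (hf : IsBessel f)
    (hh : ∀ i, h i =ᵐ[volume] fun y => conj (B y) * f i y) (x p : Space d) :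
    ∑ i, ‖stft (2 * R ^ 2) (h i) x p‖ₑ ^ 2 ≤
      ENNReal.ofReal ((Real.pi / 2) ^ (d / 2 : ℝ) / R ^ d) * majorantSq R B x := by
  set G : Space d → ℂ := fun y => B y * coherent (2 * R ^ 2) x p y with hG
  have hGm : MemLp G 2 volume :=
    (memLp_coherent (by positivity : 0 < 2 * R ^ 2) x p).mul (B.memLp_top volume)
  have h1 : ∀ i, stft (2 * R ^ 2) (h i) x p = ∫ y, star G y * f i y := fun i => by
    refine integral_congr_ae ?_
    filter_upwards [hh i] with y hy
    rw [hy]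
    simp only [hG, Pi.star_apply, RCLike.star_def, map_mul]
    ring
  simp only [h1]
  refine (hf.sum_enorm_integral_sq_le hGm.star).trans ?_
  calc ∫⁻ y, ‖star G y‖ₑ ^ 2 = ∫⁻ y, ENNReal.ofReal (window (R ^ 2) (y - x) ^ 2) *
        ‖(window (R ^ 2) (y - x) : ℂ) * B y‖ₑ ^ 2 := by
        refine lintegral_congr fun y => ?_
        have h2 : ‖coherent (2 * R ^ 2) x p y‖ₑ = ENNReal.ofReal (window (R ^ 2) (y - x) ^ 2) := by
          rw [← ofReal_norm, norm_coherent, window_sq]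
        rw [Pi.star_apply, RCLike.star_def, RCLike.enorm_conj, hG, enorm_mul, mul_pow, h2, enorm_mul,
          mul_pow, enorm_ofReal_sq]
        ring
    _ ≤ ∫⁻ y, ENNReal.ofReal (window (R ^ 2) (y - x) ^ 2) * majorantSq R B x :=
        lintegral_mono fun y => mul_le_mul' le_rfl (enorm_window_mul_sq_le hR B x y)
    _ = _ := by
        rw [lintegral_mul_const _ (by fun_prop), lintegral_window_sq_sub hR]

/-- Plancherel in `p` and the same splitting of the window, but the second factor now localises the
single function `f`; its mass is recovered on integrating over `x`. -/
theorem lintegral_stft_mul_sq_le {R : ℝ} (hR : 0 < R) (B : 𝓢(Space d, ℂ)) {f h : L2 d}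
    (hh : h =ᵐ[volume] fun y => conj (B y) * f y) (x : Space d) :
    ∫⁻ p, ‖stft (2 * R ^ 2) h x p‖ₑ ^ 2 ≤
      majorantSq R B x * ∫⁻ y, ENNReal.ofReal (window (R ^ 2) (y - x) ^ 2) * ‖f y‖ₑ ^ 2 := by
  have hF : Measurable (f : Space d → ℂ) := (Lp.stronglyMeasurable f).measurable
  rw [lintegral_stft_sq (by positivity) (Lp.memLp h), ← lintegral_const_mul _ (by fun_prop)]
  refine lintegral_mono_ae ?_
  filter_upwards [hh] with y hy
  rw [hy, ← window_sq, enorm_mul, RCLike.enorm_conj]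
  refine le_trans (le_of_eq ?_) (mul_le_mul' (enorm_window_mul_sq_le hR B x y) le_rfl)
  rw [enorm_mul, mul_pow, mul_pow, enorm_ofReal_sq, sq (window _ _ ^ 2),
    ENNReal.ofReal_mul (sq_nonneg _)]
  ring

theorem lintegral_lintegral_window_sq_mul {R : ℝ} (hR : 0 < R) (f : L2 d) :
    ∫⁻ x, ∫⁻ y, ENNReal.ofReal (window (R ^ 2) (y - x) ^ 2) * ‖f y‖ₑ ^ 2 =
      ENNReal.ofReal ((Real.pi / 2) ^ (d / 2 : ℝ) / R ^ d) * ‖f‖ₑ ^ 2 := by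
  have hF : Measurable (f : Space d → ℂ) := (Lp.stronglyMeasurable f).measurable
  rw [lintegral_lintegral_swap (by fun_prop), enorm_sq_eq_lintegral,
    ← lintegral_const_mul _ (by fun_prop)]
  refine lintegral_congr fun y => ?_
  rw [lintegral_mul_const _ (by fun_prop), ← lintegral_window_sq_sub hR (0 : Space d)]
  congr 1
  rw [lintegral_sub_left_eq_self (fun x : Space d => ENNReal.ofReal (window (R ^ 2) x ^ 2)) y]
  simp

/-- The region lies in the ball `|p| < R (v/s)^{2/d}`, on which `(|p|/R)^{-d/2}` has integral
proportional to `R^d v/s`. What matters is linearity in `v`: multiplied by one more factor `v x` it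
yields the integrable `v x ^ 2`. -/
theorem exists_lintegral_weight_sublevel_le [NeZero d] : ∃ C : ℝ, 0 < C ∧ ∀ R s : ℝ, 0 < R → 0 < s →
    ∀ v : ℝ≥0∞, ∫⁻ p : Space d, (if ENNReal.ofReal s * weight R (d / 4) p < v then
      weight R (-(d / 4)) p else 0) ≤ ENNReal.ofReal (C * R ^ d / s) * v := by
  have hd : (0 : ℝ) < d := by exact_mod_cast Nat.pos_of_ne_zero (NeZero.ne d)
  set A := (sphereArea d).toReal with hA
  have hA0 : 0 ≤ A := ENNReal.toReal_nonneg
  have hA' : sphereArea d = ENNReal.ofReal A := (ENNReal.ofReal_toReal sphereArea_ne_top).symm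
  refine ⟨A * (2 / d) + 1, by positivity, fun R s hR hs v => ?_⟩
  have hpos : 0 < (A * (2 / d) + 1) * R ^ d / s := by positivity
  rcases eq_or_ne v ⊤ with rfl | hv
  · rw [ENNReal.mul_top (by simpa using hpos)]
    exact le_top
  obtain ⟨t, ht, rfl⟩ : ∃ t : ℝ, 0 ≤ t ∧ v = ENNReal.ofReal t :=
    ⟨v.toReal, ENNReal.toReal_nonneg, (ENNReal.ofReal_toReal hv).symm⟩
  set ρ : ℝ := R * (t / s) ^ (2 / d : ℝ) with hρ
  have hρ0 : 0 ≤ ρ := by positivity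
  have key : ∀ p : Space d, p ≠ 0 → (if ENNReal.ofReal s * weight R (d / 4) p < ENNReal.ofReal t then
      weight R (-(d / 4)) p else 0) ≤ (Metric.ball (0 : Space d) ρ).indicator
        (fun p => ENNReal.ofReal (R ^ (d / 2 : ℝ)) * ENNReal.ofReal (‖p‖ ^ (-(d / 2) : ℝ))) p := by
    intro p hp
    have hp' : 0 < ‖p‖ := norm_pos_iff.2 hp
    have hb := bracket_pos R p
    have h1 : (‖p‖ / R) ^ (d / 2 : ℝ) ≤ bracket R p ^ (d / 4 : ℝ) := by
      have : (‖p‖ / R) ^ (d / 2 : ℝ) = ((‖p‖ / R) ^ 2) ^ (d / 4 : ℝ) := by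
        rw [← Real.rpow_natCast_mul (by positivity)]
        congr 1
        push_cast
        ring
      rw [this]
      refine Real.rpow_le_rpow (by positivity) ?_ (by positivity)
      rw [bracket, div_pow]
      linarith
    have h0 : 0 < (‖p‖ / R) ^ (d / 2 : ℝ) := by positivity
    split_ifs with h
    · rw [weight, ← ENNReal.ofReal_mul hs.le, ENNReal.ofReal_lt_ofReal_iff_of_nonneg
        (by positivity)] at h
      have h2 : (‖p‖ / R) ^ (d / 2 : ℝ) < t / s := by
        rw [lt_div_iff₀' hs]
        exact (mul_le_mul_of_nonneg_left h1 hs.le).trans_lt h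
      have h3 : ‖p‖ / R < (t / s) ^ (2 / d : ℝ) := by
        have h4 := Real.rpow_lt_rpow h0.le h2 (by positivity : 0 < (2 / d : ℝ))
        rw [← Real.rpow_mul (by positivity)] at h4
        have h5 : (d / 2 : ℝ) * (2 / d) = 1 := by field_simp
        rwa [h5, Real.rpow_one] at h4
      have h6 : p ∈ Metric.ball (0 : Space d) ρ := by
        rw [mem_ball_zero_iff, hρ, mul_comm]
        rwa [div_lt_iff₀ hR] at h3
      rw [Set.indicator_of_mem h6, weight, ← ENNReal.ofReal_mul (by positivity)]
      refine ENNReal.ofReal_le_ofReal ?_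
      rw [Real.rpow_neg hb.le, Real.rpow_neg hp'.le]
      calc (bracket R p ^ (d / 4 : ℝ))⁻¹ ≤ ((‖p‖ / R) ^ (d / 2 : ℝ))⁻¹ := by gcongr
        _ = _ := by
          rw [Real.div_rpow hp'.le hR.le]
          field_simp
    · exact zero_le
  have hae : ∀ᵐ p : Space d, p ≠ 0 := by
    have : Nontrivial (Space d) := by
      have := Fin.pos_iff_nonempty.1 (Nat.pos_of_ne_zero (NeZero.ne d))
      infer_instance
    exact Measure.ae_ne volume 0
  calc _ ≤ ∫⁻ p : Space d, (Metric.ball (0 : Space d) ρ).indicator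
        (fun p => ENNReal.ofReal (R ^ (d / 2 : ℝ)) * ENNReal.ofReal (‖p‖ ^ (-(d / 2) : ℝ))) p := by
        refine lintegral_mono_ae ?_
        filter_upwards [hae] with p hp using key p hp
    _ = ENNReal.ofReal (R ^ (d / 2 : ℝ)) *
        (sphereArea d * ENNReal.ofReal (ρ ^ (d + -(d / 2) : ℝ) / (d + -(d / 2)))) := by
        rw [lintegral_indicator measurableSet_ball, lintegral_const_mul' _ _ ENNReal.ofReal_ne_top,
          setLIntegral_ball_norm_rpow (by linarith) hρ0]
    _ ≤ _ := by
        rw [hA', ← ENNReal.ofReal_mul hA0, ← ENNReal.ofReal_mul (by positivity),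
          ← ENNReal.ofReal_mul hpos.le]
        refine ENNReal.ofReal_le_ofReal ?_
        have e1 : (d + -(d / 2) : ℝ) = d / 2 := by ring
        have e2 : ρ ^ (d / 2 : ℝ) = R ^ (d / 2 : ℝ) * (t / s) := by
          rw [hρ, Real.mul_rpow hR.le (by positivity), ← Real.rpow_mul (by positivity)]
          have h5 : (2 / d : ℝ) * (d / 2) = 1 := by field_simp
          rw [h5, Real.rpow_one]
        have e3 : R ^ (d / 2 : ℝ) * R ^ (d / 2 : ℝ) = R ^ d := by
          rw [← Real.rpow_add hR, add_halves, Real.rpow_natCast]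
        rw [e1, e2]
        calc _ = A * (2 / d) * (R ^ (d / 2 : ℝ) * R ^ (d / 2 : ℝ)) / s * t := by field_simp
          _ ≤ _ := by
            rw [e3]
            gcongr
            linarith

/-- The part of `G` over the set where `s * weight R (d / 4) p < v x`. -/
def superlevelPart (R s : ℝ) (v : Space d → ℝ≥0∞) (G : Space d → Space d → ℝ≥0∞) (x p : Space d) :
    ℝ≥0∞ :=
  if ENNReal.ofReal s * weight R (d / 4) p < v x then G x p else 0

theorem measurable_superlevelPart (R s : ℝ) {v : Space d → ℝ≥0∞} (hv : Measurable v)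
    {G : Space d → Space d → ℝ≥0∞} (hG : Measurable (Function.uncurry G)) :
    Measurable (Function.uncurry (superlevelPart R s v G)) := by
  have hE : MeasurableSet {z : Space d × Space d |
      ENNReal.ofReal s * weight R (d / 4) z.2 < v z.1} :=
    measurableSet_lt (by fun_prop) (by fun_prop)
  exact Measurable.ite hE hG measurable_const

/-- Where the majorant is large, the sum over `i` is taken first, by Cauchy–Schwarz at each point of
phase space, so the bound does not depend on `N`. -/
theorem sum_lintegral_superlevel_le {N : ℕ} {H U : Fin N → Space d → Space d → ℝ≥0∞}
    (hH : ∀ i, Measurable (Function.uncurry (H i))) (hU : ∀ i, Measurable (Function.uncurry (U i)))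
    {v : Space d → ℝ≥0∞} (hv : Measurable v) {R s : ℝ} {α β γ : ℝ≥0∞}
    (h1 : ∀ x p, ∑ i, H i x p ^ 2 ≤ (α * v x) ^ 2)
    (h2 : ∀ x p, ∑ i, U i x p ^ 2 ≤ (β * weight R (-(d / 4)) p) ^ 2)
    (h3 : ∀ v : ℝ≥0∞, ∫⁻ p : Space d, (if ENNReal.ofReal s * weight R (d / 4) p < v then
      weight R (-(d / 4)) p else 0) ≤ γ * v) :
    ∑ i, ∫⁻ x, ∫⁻ p, superlevelPart R s v (fun x p => H i x p * U i x p) x p ≤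
      α * β * γ * ∫⁻ x, v x ^ 2 := by
  have hm : ∀ i, Measurable (Function.uncurry
      (superlevelPart R s v (fun x p => H i x p * U i x p))) := fun i =>
    measurable_superlevelPart R s hv ((hH i).mul (hU i))
  have hm' : ∀ i, Measurable fun x => ∫⁻ p, superlevelPart R s v (fun x p => H i x p * U i x p) x p :=
    fun i => (hm i).lintegral_prod_right'
  rw [← lintegral_finsetSum _ fun i _ => hm' i]
  calc _ ≤ ∫⁻ x, α * β * γ * v x ^ 2 := by
        refine lintegral_mono fun x => ?_
        simp only
        rw [← lintegral_finsetSum _ fun i _ => (hm i).of_uncurry_left]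
        calc _ ≤ ∫⁻ p, α * β * v x * (if ENNReal.ofReal s * weight R (d / 4) p < v x then
              weight R (-(d / 4)) p else 0) := by
              refine lintegral_mono fun p => ?_
              simp only [superlevelPart]
              split_ifs with h
              · refine (sum_mul_le_of_sq_le (h1 x p) (h2 x p)).trans_eq ?_
                ring
              · simp
          _ = α * β * v x * ∫⁻ p, (if ENNReal.ofReal s * weight R (d / 4) p < v x then
              weight R (-(d / 4)) p else 0) := by
              refine lintegral_const_mul _ (Measurable.ite ?_ (by fun_prop) measurable_const)
              exact measurableSet_lt (by fun_prop) measurable_const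
          _ ≤ α * β * v x * (γ * v x) := mul_le_mul' le_rfl (h3 _)
          _ = _ := by ring
    _ = _ := lintegral_const_mul _ (hv.pow_const 2)

/-- Where the majorant is small, `bracket^{-d/4} ≤ s / v x`. Writing `H U` as `(H bracket^{-d/4})
(bracket^{d/4} U)`, this factor cancels the `v x ^ 2` in the Plancherel bound for `H`. The estimate
is for one pair and will cost a factor `N`. -/
theorem lintegral_sublevel_le {H U : Space d → Space d → ℝ≥0∞}
    (hH : Measurable (Function.uncurry H)) (hU : Measurable (Function.uncurry U))
    {v F : Space d → ℝ≥0∞} (hv : Measurable v) {R s : ℝ} {α β : ℝ≥0∞}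
    (h1 : ∀ x, ∫⁻ p, H x p ^ 2 ≤ v x ^ 2 * F x) (h2 : ∫⁻ x, F x ≤ α ^ 2)
    (h3 : ∫⁻ x, ∫⁻ p, weight R (d / 2) p * U x p ^ 2 ≤ β ^ 2) :
    ∫⁻ x, ∫⁻ p, (if ENNReal.ofReal s * weight R (d / 4) p < v x then 0 else H x p * U x p) ≤
      ENNReal.ofReal s * α * β := by
  have hE : MeasurableSet {z : Space d × Space d |
      ENNReal.ofReal s * weight R (d / 4) z.2 < v z.1} :=
    measurableSet_lt (by fun_prop) (by fun_prop)
  set f : Space d → Space d → ℝ≥0∞ := fun x p =>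
    if ENNReal.ofReal s * weight R (d / 4) p < v x then 0 else H x p * weight R (-(d / 4)) p with hf
  set g : Space d → Space d → ℝ≥0∞ := fun x p => weight R (d / 4) p * U x p with hg
  have hfm : Measurable (Function.uncurry f) := by
    refine Measurable.ite hE measurable_const ?_
    exact hH.mul ((measurable_weight _ _).comp measurable_snd)
  have hgm : Measurable (Function.uncurry g) :=
    ((measurable_weight _ _).comp measurable_snd).mul hU
  have e1 : ∀ x p, (if ENNReal.ofReal s * weight R (d / 4) p < v x then 0 else H x p * U x p) =
      f x p * g x p := fun x p => by
    simp only [hf, hg]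
    split_ifs
    · simp
    · rw [mul_assoc, ← mul_assoc (weight _ _ _), weight_neg_mul, one_mul]
  simp only [e1]
  refine lintegral_lintegral_mul_le_of_sq_le hfm hgm ?_ ?_
  · calc _ ≤ ∫⁻ x, ENNReal.ofReal s ^ 2 * F x := by
          refine lintegral_mono fun x => ?_
          simp only
          -- The quotient `s / v x` needs `v x` positive and finite. If `v x = 0` then `∫ H x p ^ 2
          -- = 0`; if `v x = ⊤` then `x` has no points in the region.
          rcases eq_or_ne (v x) 0 with h0 | h0
          · have h4 := h1 x
            rw [h0] at h4
            simp only [ne_eq, OfNat.ofNat_ne_zero, not_false_eq_true, zero_pow, zero_mul] at h4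
            refine le_trans (lintegral_mono fun p => ?_) (h4.trans zero_le)
            simp only [hf]
            split_ifs
            · simp
            · gcongr
              refine mul_le_of_le_one_right' ?_
              rw [← weight_zero R p]
              exact weight_mono R (by simp; positivity) p
          rcases eq_or_ne (v x) ⊤ with htop | htop
          · refine le_trans (le_of_eq ?_) zero_le
            rw [lintegral_eq_zero_of_ae_eq_zero]
            refine .of_forall fun p => ?_
            simp only [hf, htop, Pi.zero_apply]
            rw [if_pos (lt_top_iff_ne_top.2 (ENNReal.mul_ne_top ENNReal.ofReal_ne_top
              (weight_ne_top _ _ _)))]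
            simp
          have hp : ∀ p, f x p ^ 2 ≤ (ENNReal.ofReal s / v x) ^ 2 * H x p ^ 2 := fun p => by
            simp only [hf]
            split_ifs with h
            · simp
            · rw [← mul_pow, mul_comm (H x p)]
              gcongr
              rw [ENNReal.le_div_iff_mul_le (.inl h0) (.inl htop)]
              calc _ ≤ weight R (-(d / 4)) p * (ENNReal.ofReal s * weight R (d / 4) p) :=
                    mul_le_mul' le_rfl (not_lt.1 h)
                _ = (weight R (-(d / 4)) p * weight R (d / 4) p) * ENNReal.ofReal s := by ring
                _ = _ := by rw [weight_neg_mul, one_mul]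
          calc _ ≤ ∫⁻ p, (ENNReal.ofReal s / v x) ^ 2 * H x p ^ 2 := lintegral_mono hp
            _ = (ENNReal.ofReal s / v x) ^ 2 * ∫⁻ p, H x p ^ 2 := by
                refine lintegral_const_mul' _ _ (ENNReal.pow_ne_top ?_)
                exact ENNReal.div_ne_top ENNReal.ofReal_ne_top h0
            _ ≤ (ENNReal.ofReal s / v x) ^ 2 * (v x ^ 2 * F x) := mul_le_mul' le_rfl (h1 x)
            _ = _ := by rw [← mul_assoc, ← mul_pow, ENNReal.div_mul_cancel h0 htop]
      _ = ENNReal.ofReal s ^ 2 * ∫⁻ x, F x :=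
          lintegral_const_mul' _ _ (ENNReal.pow_ne_top ENNReal.ofReal_ne_top)
      _ ≤ _ := by
          rw [mul_pow]
          gcongr
  · refine le_trans (le_of_eq ?_) h3
    refine lintegral_congr fun x => lintegral_congr fun p => ?_
    simp only [hg]
    rw [mul_pow, weight_sq]
    congr 2
    ring

/-- Cwikel's argument: Moyal's identity reduces the sum to phase-space integrals, which are split
according to whether `s * weight R (d / 4) p < v x`. -/
theorem exists_sum_high_le [NeZero d] : ∃ C : ℝ, 0 < C ∧ ∀ (R : ℝ), 0 < R → ∀ (N : ℕ)
    (f a u : Fin N → L2 d), IsBessel f → IsBessel a → (∀ i, IsHighPart R (a i) (u i)) →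
    ∀ (B : 𝓢(Space d, ℂ)) (β : ℝ), 0 < β →
      ∫⁻ ξ, weight R d ξ * ‖𝓕 B ξ‖ₑ ^ 2 ≤ ENNReal.ofReal (β ^ 2) →
      ∑ i, ‖∫ y, conj (f i y) * (B y * u i y)‖ₑ ≤ ENNReal.ofReal (C * √N * β) := by
  obtain ⟨C₁, hC₁, h1⟩ := exists_lintegral_majorantSq_le (d := d)
  obtain ⟨C₂, hC₂, h2⟩ := exists_lintegral_weight_mul_windowHat_sq d
  obtain ⟨C₃, hC₃, h3⟩ := exists_lintegral_weight_sublevel_le (d := d)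
  have hpi := Real.pi_pos
  set c₂ : ℝ := √(2 ^ d * C₂) with hc₂
  set c₄ : ℝ := √((Real.pi / 2) ^ (d / 2 : ℝ)) with hc₄
  set c₅ : ℝ := (Real.pi / 4) ^ (d / 2 : ℝ) with hc₅
  have hc₂0 : 0 < c₂ := by positivity
  have hc₄0 : 0 < c₄ := by positivity
  have hc₅0 : 0 < c₅ := by positivity
  have hc₂s : c₂ ^ 2 = 2 ^ d * C₂ := Real.sq_sqrt (by positivity)
  have hc₄s : c₄ ^ 2 = (Real.pi / 2) ^ (d / 2 : ℝ) := Real.sq_sqrt (by positivity)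
  refine ⟨(c₄ * c₂ * C₃ * C₁ + c₄ * c₂) / c₅, by positivity, ?_⟩
  intro R hR N f a u hf ha hu B β hβ hB
  rcases Nat.eq_zero_or_pos N with rfl | hN
  · simp
  have hN' : (0 : ℝ) < N := by exact_mod_cast hN
  set n : ℝ := √N with hn
  have hn0 : 0 < n := by positivity
  have hns : (N : ℝ) = n ^ 2 := (Real.sq_sqrt hN'.le).symm
  set ρ : ℝ := √(R ^ d) with hρ
  have hρ0 : 0 < ρ := by positivity
  have hρs : R ^ d = ρ ^ 2 := (Real.sq_sqrt (by positivity)).symm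
  -- The two regions contribute multiples of `β² / (ρ s)` and `N s / ρ³`; this `s` makes both of
  -- them multiples of `√N β / ρ²`.
  set s : ℝ := ρ * β / n with hs
  have hs0 : 0 < s := by positivity
  have hC2 := h2 R 2 hR (by norm_num) le_rfl
  have hhm : ∀ i, MemLp (fun y => conj (B y) * f i y) 2 volume := fun i =>
    (Lp.memLp (f i)).mul (B.memLp_top volume).star
  set h : Fin N → L2 d := fun i => (hhm i).toLp _ with hh
  have hhae : ∀ i, h i =ᵐ[volume] fun y => conj (B y) * f i y := fun i => (hhm i).coeFn_toLp
  set H : Fin N → Space d → Space d → ℝ≥0∞ := fun i x p => ‖stft (2 * R ^ 2) (h i) x p‖ₑ with hHdef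
  set U : Fin N → Space d → Space d → ℝ≥0∞ := fun i x p => ‖stft (2 * R ^ 2) (u i) x p‖ₑ with hUdef
  have hHm : ∀ i, Measurable (Function.uncurry (H i)) := fun i =>
    (measurable_stft (2 * R ^ 2) (Lp.stronglyMeasurable (h i))).enorm
  have hUm : ∀ i, Measurable (Function.uncurry (U i)) := fun i =>
    (measurable_stft (2 * R ^ 2) (Lp.stronglyMeasurable (u i))).enorm
  set v : Space d → ℝ≥0∞ := fun x => majorantSq R B x ^ (1 / 2 : ℝ) with hv
  have hvm : Measurable v := (measurable_majorantSq R B.continuous.stronglyMeasurable).pow_const _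
  have hvs : ∀ x, v x ^ 2 = majorantSq R B x := fun x => rpow_half_sq _
  have hconst : ENNReal.ofReal ((Real.pi / 2) ^ (d / 2 : ℝ) / R ^ d) =
      ENNReal.ofReal (c₄ / ρ) ^ 2 := by
    rw [← ENNReal.ofReal_pow (by positivity), div_pow, hc₄s, hρs]
  have hconst' : ENNReal.ofReal (2 ^ d * C₂ / (R ^ d) ^ 2) = ENNReal.ofReal (c₂ / ρ ^ 2) ^ 2 := by
    rw [← ENNReal.ofReal_pow (by positivity), div_pow, hc₂s, hρs]
  have hH1 : ∀ x p, ∑ i, H i x p ^ 2 ≤ (ENNReal.ofReal (c₄ / ρ) * v x) ^ 2 := fun x p => by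
    rw [mul_pow, ← hconst, hvs]
    exact sum_enorm_stft_mul_sq_le hR B hf hhae x p
  have hU1 : ∀ x p, ∑ i, U i x p ^ 2 ≤
      (ENNReal.ofReal (c₂ / ρ ^ 2) * weight R (-(d / 4)) p) ^ 2 := fun x p => by
    have e : (2 * -(d / 4) : ℝ) = -(d / 2) := by ring
    rw [mul_pow, ← hconst', weight_sq, e]
    exact sum_enorm_stft_high_sq_le hR hC2 ha hu x p
  have hE := sum_lintegral_superlevel_le hHm hUm hvm hH1 hU1 (h3 R s hR hs0)
  have hEc : ∀ i, ∫⁻ x, ∫⁻ p,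
      (if ENNReal.ofReal s * weight R (d / 4) p < v x then 0 else H i x p * U i x p) ≤
        ENNReal.ofReal s * ENNReal.ofReal (c₄ / ρ) * ENNReal.ofReal (c₂ / ρ ^ 2) := fun i => by
    refine lintegral_sublevel_le (hHm i) (hUm i) hvm
      (F := fun x => ∫⁻ y, ENNReal.ofReal (window (R ^ 2) (y - x) ^ 2) * ‖f i y‖ₑ ^ 2)
      (fun x => ?_) ?_ ?_
    · rw [hvs]
      exact lintegral_stft_mul_sq_le hR B (hhae i) x
    · rw [lintegral_lintegral_window_sq_mul hR, hconst]
      exact mul_le_of_le_one_right' (pow_le_one' (hf.enorm_le_one i) 2)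
    · rw [← hconst']
      exact lintegral_stft_high_sq_le hR hC2 (hu i) (ha.enorm_le_one i)
  have hinner : ∀ i, ∫ y, conj (f i y) * (B y * u i y) = inner ℂ (h i) (u i) := fun i => by
    rw [inner_eq_integral]
    refine integral_congr_ae ?_
    filter_upwards [hhae i] with y hy
    rw [hy, map_mul, Complex.conj_conj]
    ring
  have hsplit : ∀ i, ENNReal.ofReal (c₅ / ρ ^ 2) * ‖∫ y, conj (f i y) * (B y * u i y)‖ₑ ≤
      (∫⁻ x, ∫⁻ p, superlevelPart R s v (fun x p => H i x p * U i x p) x p) +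
        ENNReal.ofReal s * ENNReal.ofReal (c₄ / ρ) * ENNReal.ofReal (c₂ / ρ ^ 2) := fun i => by
    -- The Moyal constant of the window at `2R²`; its `R^{-d} = ρ^{-2}` cancels the remaining power
    -- of the scale.
    have e : c₅ / ρ ^ 2 = (Real.pi / (2 * (2 * R ^ 2))) ^ (d / 2 : ℝ) := by
      have : Real.pi / (2 * (2 * R ^ 2)) = Real.pi / 4 / R ^ 2 := by field_simp; norm_num
      rw [this, Real.div_rpow (by positivity) (by positivity), ← Real.rpow_natCast_mul hR.le, ← hρs]
      congr 1
      push_cast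
      rw [mul_div_cancel₀ _ two_ne_zero, Real.rpow_natCast]
    have hm : Measurable (Function.uncurry
        (superlevelPart R s v (fun x p => H i x p * U i x p))) :=
      measurable_superlevelPart R s hvm ((hHm i).mul (hUm i))
    have hm' : Measurable fun x => ∫⁻ p, superlevelPart R s v (fun x p => H i x p * U i x p) x p :=
      hm.lintegral_prod_right'
    rw [hinner, e]
    refine (enorm_inner_le_lintegral_stft (by positivity) (h i) (u i)).trans ?_
    refine le_trans (le_of_eq ?_) (add_le_add_right (hEc i) _)
    rw [← lintegral_add_left hm']
    refine lintegral_congr fun x => ?_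
    have hmx : Measurable (superlevelPart R s v (fun x p => H i x p * U i x p) x) :=
      hm.of_uncurry_left
    rw [← lintegral_add_left hmx]
    refine lintegral_congr fun p => ?_
    simp only [superlevelPart]
    split_ifs <;> simp [hHdef, hUdef]
  have htot : ENNReal.ofReal (c₅ / ρ ^ 2) * ∑ i, ‖∫ y, conj (f i y) * (B y * u i y)‖ₑ ≤
      ENNReal.ofReal (c₅ / ρ ^ 2) * ENNReal.ofReal ((c₄ * c₂ * C₃ * C₁ + c₄ * c₂) / c₅ * n * β) := by
    rw [Finset.mul_sum]
    refine (Finset.sum_le_sum fun i _ => hsplit i).trans ?_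
    rw [Finset.sum_add_distrib, Finset.sum_const, Finset.card_univ, Fintype.card_fin, nsmul_eq_mul]
    simp only [hvs] at hE
    have hV := (h1 R hR B).trans (mul_le_mul' le_rfl hB)
    refine (add_le_add_left (hE.trans (mul_le_mul' le_rfl hV)) _).trans (le_of_eq ?_)
    rw [← ENNReal.ofReal_natCast]
    rw [← ENNReal.ofReal_mul (by positivity), ← ENNReal.ofReal_mul (by positivity),
      ← ENNReal.ofReal_mul (by positivity), ← ENNReal.ofReal_mul (by positivity),
      ← ENNReal.ofReal_mul (by positivity), ← ENNReal.ofReal_mul (by positivity),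
      ← ENNReal.ofReal_mul (by positivity), ← ENNReal.ofReal_add (by positivity) (by positivity),
      ← ENNReal.ofReal_mul (by positivity)]
    congr 1
    rw [hs, hns, hρs]
    field_simp
  have hne : ENNReal.ofReal (c₅ / ρ ^ 2) ≠ 0 := by
    simp only [ne_eq, ENNReal.ofReal_eq_zero, not_le]
    positivity
  exact (ENNReal.mul_le_mul_iff_right hne ENNReal.ofReal_ne_top).1 htot

/-! ### The low-frequency part -/

/-- The multiplier `(2π|ξ|)^{-d/2}`. -/
def rieszMultiplier (ξ : Space d) : ℝ := (2 * Real.pi * ‖ξ‖) ^ (-(d / 2) : ℝ)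

theorem measurable_rieszMultiplier : Measurable (rieszMultiplier : Space d → ℝ) := by
  unfold rieszMultiplier; fun_prop

theorem rieszMultiplier_sq_le (ξ : Space d) : rieszMultiplier ξ ^ 2 ≤ ‖ξ‖ ^ (-d : ℝ) := by
  have hpi := Real.pi_gt_three
  have e : (-(d / 2) : ℝ) * (2 : ℕ) = -d := by push_cast; ring
  rw [rieszMultiplier, ← Real.rpow_mul_natCast (by positivity), e,
    Real.mul_rpow (by positivity) (norm_nonneg _)]
  refine mul_le_of_le_one_left (by positivity) ?_
  exact Real.rpow_le_one_of_one_le_of_nonpos (by linarith) (by simp)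

/-- The kernel of `a ↦ (|D|^{-d/2} a)(x)` at frequencies up to `R`, for functions `a` such that the
integral of `|ξ|^{-d/2} a` over the unit ball vanishes. -/
def lowKernel (R : ℝ) (x ξ : Space d) : ℂ :=
  (rieszMultiplier ξ : ℂ) * (Metric.closedBall (0 : Space d) R).indicator
    (fun ξ => Complex.exp ((2 * Real.pi * inner ℝ ξ x : ℝ) * Complex.I) -
      (Metric.ball (0 : Space d) 1).indicator (fun _ => 1) ξ) ξ

theorem measurable_lowKernel (R : ℝ) (x : Space d) : Measurable (lowKernel R x) := by
  unfold lowKernel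
  refine Measurable.mul ?_ (Measurable.indicator (Measurable.sub (by fun_prop) ?_)
    Metric.isClosed_closedBall.measurableSet)
  · have := measurable_rieszMultiplier (d := d)
    fun_prop
  · exact measurable_const.indicator measurableSet_ball

/-- The subtracted `1` makes the kernel vanish to first order at `ξ = 0`. Below `r` this is used
through `|e^{iθ} - 1| ≤ |θ|`, between `r` and `1` only `|e^{iθ} - 1| ≤ 2`, and above `1` nothing is
subtracted. The radius `r` stays free. -/
theorem enorm_lowKernel_sq_le (R r : ℝ) (x ξ : Space d) :
    ‖lowKernel R x ξ‖ₑ ^ 2 ≤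
      (Metric.ball (0 : Space d) r).indicator (fun ξ => ENNReal.ofReal (4 * Real.pi ^ 2 * ‖x‖ ^ 2) *
        ENNReal.ofReal (‖ξ‖ ^ (2 - d : ℝ))) ξ +
      {ξ : Space d | r ≤ ‖ξ‖ ∧ ‖ξ‖ ≤ 1}.indicator (fun ξ => ENNReal.ofReal 4 *
        ENNReal.ofReal (‖ξ‖ ^ (-d : ℝ))) ξ +
      {ξ : Space d | 1 ≤ ‖ξ‖ ∧ ‖ξ‖ ≤ R}.indicator (fun ξ => ENNReal.ofReal (‖ξ‖ ^ (-d : ℝ))) ξ := by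
  have hpi := Real.pi_pos
  have hm := rieszMultiplier_sq_le ξ
  have hexp : ‖Complex.exp ((2 * Real.pi * inner ℝ ξ x : ℝ) * Complex.I)‖ = 1 :=
    Complex.norm_exp_ofReal_mul_I _
  set E := Complex.exp ((2 * Real.pi * inner ℝ ξ x : ℝ) * Complex.I) with hE
  by_cases hR : ‖ξ‖ ≤ R
  swap
  · have : ξ ∉ Metric.closedBall (0 : Space d) R := by simpa using hR
    rw [lowKernel, Set.indicator_of_notMem this]
    simp
  have hR' : ξ ∈ Metric.closedBall (0 : Space d) R := by simpa using hR
  rw [lowKernel, Set.indicator_of_mem hR', enorm_mul, mul_pow, enorm_ofReal_sq, ← hE,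
    ← ofReal_norm (_ - _), ← ENNReal.ofReal_pow (norm_nonneg _), ← ENNReal.ofReal_mul (sq_nonneg _)]
  rcases lt_or_ge ‖ξ‖ 1 with h1 | h1
  · have h1' : ξ ∈ Metric.ball (0 : Space d) 1 := by simpa using h1
    rw [Set.indicator_of_mem h1']
    rcases lt_or_ge ‖ξ‖ r with h2 | h2
    · have h2' : ξ ∈ Metric.ball (0 : Space d) r := by simpa using h2
      refine le_trans ?_ (le_self_add.trans le_self_add)
      rw [Set.indicator_of_mem h2', ← ENNReal.ofReal_mul (by positivity)]
      refine ENNReal.ofReal_le_ofReal ?_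
      have h3 : ‖E - 1‖ ≤ 2 * Real.pi * (‖ξ‖ * ‖x‖) := by
        have h4 := Real.norm_exp_I_mul_ofReal_sub_one_le (x := 2 * Real.pi * inner ℝ ξ x)
        rw [mul_comm Complex.I] at h4
        refine h4.trans ?_
        rw [norm_mul, Real.norm_of_nonneg (by positivity)]
        gcongr
        exact norm_inner_le_norm ξ x
      rcases eq_or_ne ξ 0 with h0 | h0
      · have : ‖E - 1‖ = 0 := by
          refine le_antisymm (h3.trans_eq ?_) (norm_nonneg _)
          simp [h0]
        rw [this]
        simp only [ne_eq, OfNat.ofNat_ne_zero, not_false_eq_true, zero_pow, mul_zero]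
        positivity
      have h0' : 0 < ‖ξ‖ := norm_pos_iff.2 h0
      calc _ ≤ ‖ξ‖ ^ (-d : ℝ) * (2 * Real.pi * (‖ξ‖ * ‖x‖)) ^ 2 := by gcongr
        _ = 4 * Real.pi ^ 2 * ‖x‖ ^ 2 * (‖ξ‖ ^ (2 : ℝ) * ‖ξ‖ ^ (-d : ℝ)) := by
          rw [Real.rpow_two]; ring
        _ = _ := by rw [← Real.rpow_add h0', sub_eq_add_neg]
    · refine le_trans ?_ (le_add_self.trans le_self_add)
      rw [Set.indicator_of_mem (by exact ⟨h2, h1.le⟩), ← ENNReal.ofReal_mul (by norm_num)]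
      refine ENNReal.ofReal_le_ofReal ?_
      have h3 : ‖E - 1‖ ≤ 2 := (norm_sub_le _ _).trans (by rw [hexp, norm_one]; norm_num)
      calc _ ≤ ‖ξ‖ ^ (-d : ℝ) * 2 ^ 2 := by gcongr
        _ = _ := by ring
  · refine le_trans ?_ le_add_self
    have h1' : ξ ∉ Metric.ball (0 : Space d) 1 := by simpa using h1
    rw [Set.indicator_of_notMem h1', sub_zero, hexp, Set.indicator_of_mem (by exact ⟨h1, hR⟩)]
    refine ENNReal.ofReal_le_ofReal ?_
    simpa using hm

theorem exists_lintegral_lowKernel_sq_le [NeZero d] : ∃ C : ℝ, 0 < C ∧ ∀ R : ℝ, 1 ≤ R → ∀ x : Space d,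
    ∫⁻ ξ, ‖lowKernel R x ξ‖ₑ ^ 2 ≤ ENNReal.ofReal (C * (1 + Real.log R)) +
      ENNReal.ofReal (C / R ^ 2) * ENNReal.ofReal (‖x‖ ^ 2) := by
  have hpi := Real.pi_pos
  set A := (sphereArea d).toReal with hA
  have hA0 : 0 ≤ A := ENNReal.toReal_nonneg
  have hA' : sphereArea d = ENNReal.ofReal A := (ENNReal.ofReal_toReal sphereArea_ne_top).symm
  refine ⟨A * (2 * Real.pi ^ 2 + 8) + 1, by positivity, fun R hR x => ?_⟩
  have hR0 : 0 < R := by linarith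
  have hlR : 0 ≤ Real.log R := Real.log_nonneg hR
  -- With this radius `‖x‖ r ≤ 1`, so the inner ball contributes a constant and the middle annulus
  -- `log(1 + ‖x‖)`.
  set r : ℝ := 1 / (1 + ‖x‖) with hr
  have hx : 0 ≤ ‖x‖ := norm_nonneg x
  have hr0 : 0 < r := by positivity
  have hr1 : r ≤ 1 := by rw [hr, div_le_one (by positivity)]; linarith
  have hann : ∀ r ρ : ℝ, MeasurableSet {x : Space d | r ≤ ‖x‖ ∧ ‖x‖ ≤ ρ} := by
    intro r ρ
    exact (measurableSet_le measurable_const measurable_norm).inter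
      (measurableSet_le measurable_norm measurable_const)
  have hxr : ‖x‖ * r ≤ 1 := by
    rw [hr, mul_one_div, div_le_one (by positivity)]; linarith
  -- Splitting off `log R` leaves `log(1 + ‖x‖/R) ≤ ‖x‖/R`, which is bounded by a quadratic: `|x|²`
  -- is what the oscillator can control.
  have hlog : Real.log (1 / r) ≤ Real.log R + 1 + ‖x‖ ^ 2 / R ^ 2 := by
    rw [hr, one_div_one_div]
    have h1 : 1 + ‖x‖ ≤ R * (1 + ‖x‖ / R) := by
      have : R * (1 + ‖x‖ / R) = R + ‖x‖ := by field_simp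
      linarith
    have h2 : 0 ≤ ‖x‖ / R := by positivity
    have h3 := Real.log_le_sub_one_of_pos (by positivity : 0 < 1 + ‖x‖ / R)
    calc Real.log (1 + ‖x‖) ≤ Real.log (R * (1 + ‖x‖ / R)) := Real.log_le_log (by positivity) h1
      _ = Real.log R + Real.log (1 + ‖x‖ / R) := Real.log_mul (by positivity) (by positivity)
      _ ≤ _ := by
        rw [← div_pow]
        nlinarith [sq_nonneg (‖x‖ / R - 1)]
  refine (lintegral_mono fun ξ => enorm_lowKernel_sq_le R r x ξ).trans ?_
  rw [lintegral_add_right _ (Measurable.indicator (by fun_prop) (hann 1 R)),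
    lintegral_add_right _ (Measurable.indicator (by fun_prop) (hann r 1)),
    lintegral_indicator measurableSet_ball, lintegral_indicator (hann r 1),
    lintegral_indicator (hann 1 R), lintegral_const_mul' _ _ ENNReal.ofReal_ne_top,
    lintegral_const_mul' _ _ ENNReal.ofReal_ne_top, setLIntegral_annulus hr0 hr1,
    setLIntegral_annulus one_pos hR, setLIntegral_ball_norm_rpow (by linarith) hr0.le, hA']
  have hl1 : 0 ≤ Real.log (1 / r) := Real.log_nonneg (by rw [le_div_iff₀ hr0]; linarith)
  have e2 : (d + (2 - d) : ℝ) = (2 : ℕ) := by push_cast; ring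
  rw [e2, Real.rpow_natCast, div_one]
  rw [← ENNReal.ofReal_mul (by positivity), ← ENNReal.ofReal_mul (by positivity),
    ← ENNReal.ofReal_mul (by positivity), ← ENNReal.ofReal_mul (by positivity),
    ← ENNReal.ofReal_mul (by positivity),
    ← ENNReal.ofReal_mul (by positivity), ← ENNReal.ofReal_add (by positivity) (by positivity),
    ← ENNReal.ofReal_add (by positivity) (by positivity),
    ← ENNReal.ofReal_add (by positivity) (by positivity)]
  refine ENNReal.ofReal_le_ofReal ?_
  have h5 : (‖x‖ * r) ^ 2 ≤ 1 := pow_le_one₀ (by positivity) hxr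
  have hX : 0 ≤ ‖x‖ ^ 2 / R ^ 2 := by positivity
  calc _ = A * (2 * Real.pi ^ 2 * (‖x‖ * r) ^ 2 + 4 * Real.log (1 / r) + Real.log R) := by
        push_cast; ring
    _ ≤ A * (2 * Real.pi ^ 2 * 1 + 4 * (Real.log R + 1 + ‖x‖ ^ 2 / R ^ 2) + Real.log R) := by
        gcongr
    _ ≤ A * ((2 * Real.pi ^ 2 + 8) * (1 + Real.log R + ‖x‖ ^ 2 / R ^ 2)) := by
        refine mul_le_mul_of_nonneg_left ?_ hA0
        nlinarith [mul_nonneg (sq_nonneg Real.pi) hlR, mul_nonneg (sq_nonneg Real.pi) hX]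
    _ ≤ (A * (2 * Real.pi ^ 2 + 8) + 1) * (1 + Real.log R + ‖x‖ ^ 2 / R ^ 2) := by
        rw [← mul_assoc]
        refine mul_le_mul_of_nonneg_right (by linarith) (by positivity)
    _ = _ := by ring

/-- The functions `u` with `û = (2π|ξ|)^{-d/2} a`. -/
def IsRieszPotential (a u : L2 d) : Prop :=
  ((𝓕 u : L2 d) : Space d → ℂ) =ᵐ[volume] fun ξ => (rieszMultiplier ξ : ℂ) * a ξ

/-- The part of `u` at frequencies up to `R`. -/
def lowPart (R : ℝ) (u : L2 d) : L2 d :=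
  𝓕⁻ (((Lp.memLp (𝓕 u : L2 d)).indicator
    (Metric.isClosed_closedBall (x := (0 : Space d)) (ε := R)).measurableSet).toLp _)

theorem integrable_indicator_fourier (R : ℝ) (u : L2 d) :
    Integrable ((Metric.closedBall (0 : Space d) R).indicator (𝓕 u : L2 d)) := by
  rw [integrable_indicator_iff Metric.isClosed_closedBall.measurableSet]
  have : IsFiniteMeasure (volume.restrict (Metric.closedBall (0 : Space d) R)) :=
    ⟨by simpa using (isCompact_closedBall (0 : Space d) R).measure_lt_top⟩
  exact ((Lp.memLp (𝓕 u : L2 d)).restrict _).integrable (by norm_num)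

/-- Inverse Fourier transform minus the vanishing integral of `𝓕 u` over the unit ball; `1 ≤ R` puts
that ball inside the cut-off region. -/
theorem lowPart_ae_eq {R : ℝ} (hR : 1 ≤ R) {a u : L2 d} (hu : IsRieszPotential a u)
    (h0 : ∫ ξ in Metric.ball (0 : Space d) 1, (𝓕 u : L2 d) ξ = 0) :
    lowPart R u =ᵐ[volume] fun x => ∫ ξ, lowKernel R x ξ * a ξ := by
  have hi := integrable_indicator_fourier R u
  have h1 := fourierInv_toLp_ae_eq hi ((Lp.memLp (𝓕 u : L2 d)).indicator
    (Metric.isClosed_closedBall (x := (0 : Space d)) (ε := R)).measurableSet)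
  rw [lowPart]
  filter_upwards [h1] with x hx
  rw [hx, Real.fourierInv_eq']
  have hsub : Metric.ball (0 : Space d) 1 ⊆ Metric.closedBall 0 R :=
    Metric.ball_subset_closedBall.trans (Metric.closedBall_subset_closedBall hR)
  have h2 : ∫ ξ, (Metric.ball (0 : Space d) 1).indicator (𝓕 u : L2 d) ξ = 0 := by
    rw [integral_indicator measurableSet_ball, h0]
  have hi2 : Integrable ((Metric.ball (0 : Space d) 1).indicator (𝓕 u : L2 d)) := by
    have := hi.indicator (measurableSet_ball (x := (0 : Space d)) (ε := 1))
    rwa [Set.indicator_indicator, Set.inter_eq_left.2 hsub] at this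
  have hi3 : Integrable fun ξ : Space d =>
      Complex.exp ((2 * Real.pi * inner ℝ ξ x : ℝ) * Complex.I) •
        (Metric.closedBall (0 : Space d) R).indicator (𝓕 u : L2 d) ξ := by
    refine hi.mono ((by fun_prop : Continuous fun ξ : Space d =>
      Complex.exp ((2 * Real.pi * inner ℝ ξ x : ℝ) * Complex.I)).aestronglyMeasurable.smul hi.1)
      (.of_forall fun ξ => ?_)
    rw [norm_smul, Complex.norm_exp_ofReal_mul_I, one_mul]
  rw [← sub_zero (∫ ξ, _ • _), ← h2, ← integral_sub hi3 hi2]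
  refine integral_congr_ae ?_
  filter_upwards [hu] with ξ hξ
  rw [lowKernel]
  by_cases hb : ξ ∈ Metric.closedBall (0 : Space d) R
  · rw [Set.indicator_of_mem hb, Set.indicator_of_mem hb]
    by_cases hb1 : ξ ∈ Metric.ball (0 : Space d) 1
    · rw [Set.indicator_of_mem hb1, Set.indicator_of_mem hb1, hξ, smul_eq_mul]
      ring
    · rw [Set.indicator_of_notMem hb1, Set.indicator_of_notMem hb1, hξ, smul_eq_mul]
      ring
  · rw [Set.indicator_of_notMem hb, Set.indicator_of_notMem hb,
      Set.indicator_of_notMem fun h => hb (hsub h)]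
    simp

theorem isHighPart_sub_lowPart (R : ℝ) {a u : L2 d} (hu : IsRieszPotential a u) :
    IsHighPart R a (u - lowPart R u) := by
  have h1 : (𝓕 (u - lowPart R u) : L2 d) = 𝓕 u - ((Lp.memLp (𝓕 u : L2 d)).indicator
      (Metric.isClosed_closedBall (x := (0 : Space d)) (ε := R)).measurableSet).toLp _ := by
    have h2 : (𝓕 (u - lowPart R u) : L2 d) = 𝓕 u - 𝓕 (lowPart R u) :=
      map_sub (Lp.fourierTransformₗᵢ (Space d) ℂ) u (lowPart R u)
    rw [h2, lowPart, FourierTransform.fourier_fourierInv_eq]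
  rw [IsHighPart, h1]
  filter_upwards [hu, Lp.coeFn_sub (𝓕 u : L2 d) (((Lp.memLp (𝓕 u : L2 d)).indicator
      (Metric.isClosed_closedBall (x := (0 : Space d)) (ε := R)).measurableSet).toLp _),
    ((Lp.memLp (𝓕 u : L2 d)).indicator
      (Metric.isClosed_closedBall (x := (0 : Space d)) (ε := R)).measurableSet).coeFn_toLp]
    with ξ h2 h3 h4
  rw [h3, Pi.sub_apply, h4, highMultiplier]
  by_cases hb : ξ ∈ Metric.closedBall (0 : Space d) R
  · rw [Set.indicator_of_mem hb, sub_self, if_neg (by simpa using hb)]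
    simp
  · rw [Set.indicator_of_notMem hb, sub_zero, if_pos (by simpa using hb), h2]
    rfl

/-! ### The estimate for a block of Hermite functions -/

/-- At almost every `x` the values of the low parts are integrals of the `a i` against the same
kernel, so Bessel's inequality bounds the sum of their squares. -/
theorem lintegral_lowPart_sq_sum_le {R : ℝ} (hR : 1 ≤ R) {N : ℕ} {a u : Fin N → L2 d}
    (ha : IsBessel a) (hu : ∀ i, IsRieszPotential (a i) (u i))
    (h0 : ∀ i, ∫ ξ in Metric.ball (0 : Space d) 1, (𝓕 (u i) : L2 d) ξ = 0) {κ : Space d → ℝ≥0∞}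
    (hκ : ∀ x, ∫⁻ ξ, ‖lowKernel R x ξ‖ₑ ^ 2 ≤ κ x) (hκt : ∀ x, κ x ≠ ⊤) (B : 𝓢(Space d, ℂ)) :
    ∑ i, ∫⁻ x, ‖B x * lowPart R (u i) x‖ₑ ^ 2 ≤ ∫⁻ x, ‖B x‖ₑ ^ 2 * κ x := by
  have hm : ∀ i, Measurable fun x => ‖B x * lowPart R (u i) x‖ₑ ^ 2 := fun i => by
    have h1 := (Lp.stronglyMeasurable (lowPart R (u i))).measurable
    have h2 := B.continuous.measurable
    fun_prop
  rw [← lintegral_finsetSum _ fun i _ => hm i]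
  refine lintegral_mono_ae ?_
  filter_upwards [ae_all_iff.2 fun i => lowPart_ae_eq hR (hu i) (h0 i)] with x hx
  simp only [hx, enorm_mul, mul_pow, ← Finset.mul_sum]
  refine mul_le_mul' le_rfl ((ha.sum_enorm_integral_sq_le ?_).trans (hκ x))
  exact memLp_two_of_lintegral_ne_top (measurable_lowKernel R x).aestronglyMeasurable
    (ne_top_of_le_ne_top (hκt x) (hκ x))

theorem memLp_schwartz_mul (B : 𝓢(Space d, ℂ)) (u : L2 d) : MemLp (fun x => B x * u x) 2 volume :=
  (Lp.memLp u).mul (B.memLp_top volume)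

/-- Cauchy–Schwarz in `L²` and in `i`: `√N` comes from `∑ ‖f i‖² ≤ N`, and the choice `R² = 2n + d`
turns the term `|x|²/R²` of the kernel bound into a multiple of `‖B‖²`. -/
theorem exists_sum_low_le [NeZero d] : ∃ C : ℝ, 0 < C ∧ ∀ (n : ℕ) (R : ℝ), 1 ≤ R →
    R ^ 2 = (2 * n + d : ℕ) → ∀ (N : ℕ) (f a u : Fin N → L2 d), IsBessel f → IsBessel a →
    (∀ i, IsRieszPotential (a i) (u i)) →
    (∀ i, ∫ ξ in Metric.ball (0 : Space d) 1, (𝓕 (u i) : L2 d) ξ = 0) →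
    ∀ B ∈ polySpace d n, ∑ i, ‖∫ y, conj (f i y) * (B y * lowPart R (u i) y)‖ₑ ≤
      ENNReal.ofReal (C * √N * (√(1 + Real.log R) * ‖toL2 d B‖)) := by
  obtain ⟨C, hC, hκ⟩ := exists_lintegral_lowKernel_sq_le (d := d)
  refine ⟨√(2 * C), by positivity, ?_⟩
  intro n R hR hRn N f a u hf ha hu h0 B hB
  have hR0 : 0 < R := by linarith
  have hl : 0 ≤ Real.log R := Real.log_nonneg hR
  have h1 := lintegral_lowPart_sq_sum_le hR ha hu h0 (hκ R hR)
    (fun x => ENNReal.add_ne_top.2 ⟨ENNReal.ofReal_ne_top,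
      ENNReal.mul_ne_top ENNReal.ofReal_ne_top ENNReal.ofReal_ne_top⟩) B
  have h2 : ∫⁻ x, ‖B x‖ₑ ^ 2 * (ENNReal.ofReal (C * (1 + Real.log R)) +
      ENNReal.ofReal (C / R ^ 2) * ENNReal.ofReal (‖x‖ ^ 2)) ≤
        (ENNReal.ofReal (√(2 * C) * (√(1 + Real.log R) * ‖toL2 d B‖))) ^ 2 := by
    have hBm : Measurable (B : Space d → ℂ) := B.continuous.measurable
    calc _ = ENNReal.ofReal (C * (1 + Real.log R)) * ‖toL2 d B‖ₑ ^ 2 +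
          ENNReal.ofReal (C / R ^ 2) * ∫⁻ x, ENNReal.ofReal (‖x‖ ^ 2) * ‖B x‖ₑ ^ 2 := by
          rw [enorm_toL2_sq, ← lintegral_const_mul _ (by fun_prop),
            ← lintegral_const_mul _ (by fun_prop), ← lintegral_add_left (by fun_prop)]
          refine lintegral_congr fun x => ?_
          ring
      _ ≤ ENNReal.ofReal (C * (1 + Real.log R)) * ‖toL2 d B‖ₑ ^ 2 +
          ENNReal.ofReal (C / R ^ 2) * ((2 * n + d : ℕ) * ‖toL2 d B‖ₑ ^ 2) := by
          gcongr
          exact lintegral_norm_sq_mul_le hB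
      _ ≤ _ := by
          rw [← ENNReal.ofReal_natCast, ← hRn, ← ofReal_norm, ← ENNReal.ofReal_pow (norm_nonneg _),
            ← ENNReal.ofReal_mul (by positivity), ← ENNReal.ofReal_mul (by positivity),
            ← ENNReal.ofReal_mul (by positivity),
            ← ENNReal.ofReal_add (mul_nonneg (by positivity) (sq_nonneg _))
              (mul_nonneg (by positivity) (mul_nonneg (by positivity) (sq_nonneg _))),
            ← ENNReal.ofReal_pow (mul_nonneg (by positivity)
              (mul_nonneg (by positivity) (norm_nonneg _)))]
          refine ENNReal.ofReal_le_ofReal ?_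
          generalize ‖toL2 d B‖ = b
          rw [mul_pow, mul_pow, Real.sq_sqrt (by positivity), Real.sq_sqrt (by positivity)]
          have e : C / R ^ 2 * (R ^ 2 * b ^ 2) = C * b ^ 2 := by field_simp
          rw [e]
          nlinarith [mul_nonneg (mul_nonneg hC.le hl) (sq_nonneg b)]
  set Y : Fin N → ℝ≥0∞ := fun i => (∫⁻ x, ‖B x * lowPart R (u i) x‖ₑ ^ 2) ^ (1 / 2 : ℝ) with hY
  have h3 : ∀ i, ‖∫ y, conj (f i y) * (B y * lowPart R (u i) y)‖ₑ ≤ ‖f i‖ₑ * Y i := fun i => by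
    refine (enorm_integral_le_lintegral_enorm _).trans ?_
    simp only [enorm_mul (conj _), RCLike.enorm_conj]
    refine lintegral_mul_le_of_sq_le (Lp.aestronglyMeasurable (f i)).enorm
      (memLp_schwartz_mul B _).1.enorm (enorm_sq_eq_lintegral (f i)).ge ?_
    rw [hY, rpow_half_sq]
  refine (Finset.sum_le_sum fun i _ => h3 i).trans ?_
  refine (sum_mul_le_of_sq_le (A := ENNReal.ofReal √N)
    (B := ENNReal.ofReal (√(2 * C) * (√(1 + Real.log R) * ‖toL2 d B‖))) ?_ ?_).trans_eq ?_
  · rw [← ENNReal.ofReal_pow (by positivity), Real.sq_sqrt (by positivity), ENNReal.ofReal_natCast]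
    refine (Finset.sum_le_sum fun i _ => pow_le_one' (hf.enorm_le_one i) 2).trans_eq ?_
    simp
  · simp only [hY, rpow_half_sq]
    exact h1.trans h2
  · rw [← ENNReal.ofReal_mul (by positivity)]
    congr 1
    ring

/-- `(1 + t)^d ≤ 2^d (1 + t^d)` leaves the moment `|ξ|^{2d}`, which `d` derivatives of the Hermite
sum control; the shifted degree is harmless as `2(n + d) + d ≤ 3 R²`. -/
theorem lintegral_weight_mul_fourier_sq_le {n : ℕ} {R : ℝ} (hR : 0 < R)
    (hRn : R ^ 2 = (2 * n + d : ℕ)) {B : 𝓢(Space d, ℂ)} (hB : B ∈ polySpace d n) :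
    ∫⁻ ξ, weight R d ξ * ‖𝓕 B ξ‖ₑ ^ 2 ≤ ENNReal.ofReal ((√(2 ^ d * (1 + 3 ^ d)) * ‖toL2 d B‖) ^ 2) := by
  have h1 : ∀ ξ : Space d, weight R d ξ ≤ ENNReal.ofReal (2 ^ d) +
      ENNReal.ofReal (2 ^ d / (R ^ 2) ^ d) * ENNReal.ofReal (‖ξ‖ ^ 2) ^ d := fun ξ => by
    rw [weight, ← ENNReal.ofReal_pow (by positivity), ← ENNReal.ofReal_mul (by positivity),
      ← ENNReal.ofReal_add (by positivity) (by positivity), Real.rpow_natCast]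
    refine ENNReal.ofReal_le_ofReal ?_
    have h2 := add_pow_le (zero_le_one' ℝ) (by positivity : 0 ≤ ‖ξ‖ ^ 2 / R ^ 2) d
    rw [bracket]
    refine h2.trans ?_
    calc _ ≤ (2 : ℝ) ^ d * (1 ^ d + (‖ξ‖ ^ 2 / R ^ 2) ^ d) := by
          gcongr
          · norm_num
          · omega
      _ = _ := by rw [one_pow, div_pow]; ring
  have hFm : Measurable ((𝓕 B : 𝓢(Space d, ℂ)) : Space d → ℂ) := (𝓕 B).continuous.measurable
  calc _ ≤ ∫⁻ ξ, (ENNReal.ofReal (2 ^ d) * ‖𝓕 B ξ‖ₑ ^ 2 +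
        ENNReal.ofReal (2 ^ d / (R ^ 2) ^ d) * (ENNReal.ofReal (‖ξ‖ ^ 2) ^ d * ‖𝓕 B ξ‖ₑ ^ 2)) := by
        refine lintegral_mono fun ξ => (mul_le_mul' (h1 ξ) le_rfl).trans_eq ?_
        ring
    _ = ENNReal.ofReal (2 ^ d) * ‖toL2 d B‖ₑ ^ 2 + ENNReal.ofReal (2 ^ d / (R ^ 2) ^ d) *
        ∫⁻ ξ, ENNReal.ofReal (‖ξ‖ ^ 2) ^ d * ‖𝓕 B ξ‖ₑ ^ 2 := by
        rw [lintegral_add_left (by fun_prop), lintegral_const_mul _ (by fun_prop),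
          lintegral_const_mul _ (by fun_prop), ← enorm_toL2_fourier, enorm_toL2_sq]
    _ ≤ ENNReal.ofReal (2 ^ d) * ‖toL2 d B‖ₑ ^ 2 + ENNReal.ofReal (2 ^ d / (R ^ 2) ^ d) *
        (((2 * (n + d) + d : ℕ) : ℝ≥0∞) ^ d * ‖toL2 d B‖ₑ ^ 2) := by
        gcongr
        exact lintegral_norm_pow_mul_fourier_le d hB
    _ ≤ ENNReal.ofReal (2 ^ d) * ‖toL2 d B‖ₑ ^ 2 + ENNReal.ofReal (2 ^ d / (R ^ 2) ^ d) *
        (ENNReal.ofReal (3 * R ^ 2) ^ d * ‖toL2 d B‖ₑ ^ 2) := by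
        gcongr
        rw [← ENNReal.ofReal_natCast, hRn]
        refine ENNReal.ofReal_le_ofReal ?_
        push_cast
        have : (0 : ℝ) ≤ n := by positivity
        linarith
    _ = _ := by
        rw [← ofReal_norm, ← ENNReal.ofReal_pow (norm_nonneg _), ← ENNReal.ofReal_pow (by positivity),
          ← ENNReal.ofReal_mul (by positivity), ← ENNReal.ofReal_mul (by positivity),
          ← ENNReal.ofReal_mul (by positivity),
          ← ENNReal.ofReal_add (mul_nonneg (by positivity) (sq_nonneg _))
            (mul_nonneg (by positivity) (mul_nonneg (by positivity) (sq_nonneg _)))]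
        congr 1
        generalize ‖toL2 d B‖ = b
        rw [mul_pow √_ b, Real.sq_sqrt (by positivity), mul_pow]
        field_simp

theorem integrable_conj_mul_mul (f u : L2 d) (B : 𝓢(Space d, ℂ)) :
    Integrable fun y => conj (f y) * (B y * u y) :=
  integrable_conj_mul (Lp.memLp f) (memLp_schwartz_mul B u)

/-- Splitting each `u i` at frequency `R = √(2n + d)`. The logarithm comes from the low part only;
the high part is bounded without it. -/
theorem exists_block_le [NeZero d] : ∃ C : ℝ, 0 < C ∧ ∀ (n N : ℕ) (f a u : Fin N → L2 d),
    IsBessel f → IsBessel a → (∀ i, IsRieszPotential (a i) (u i)) →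
    (∀ i, ∫ ξ in Metric.ball (0 : Space d) 1, (𝓕 (u i) : L2 d) ξ = 0) →
    ∀ B ∈ polySpace d n, ∑ i, ‖∫ y, conj (f i y) * (B y * u i y)‖ ≤
      C * √N * (√(1 + Real.log (2 * n + d)) * ‖toL2 d B‖) := by
  obtain ⟨C₁, hC₁, hlow⟩ := exists_sum_low_le (d := d)
  obtain ⟨C₂, hC₂, hhigh⟩ := exists_sum_high_le (d := d)
  set c : ℝ := √(2 ^ d * (1 + 3 ^ d)) with hc
  have hc0 : 0 < c := by positivity
  refine ⟨C₁ + C₂ * c, by positivity, ?_⟩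
  intro n N f a u hf ha hu h0 B hB
  have hd : 1 ≤ d := NeZero.one_le
  -- The high-frequency estimate needs a strictly positive bound `β`, so a block that vanishes is
  -- treated apart.
  rcases eq_or_ne (toL2 d B) 0 with hB0 | hB0
  · have h1 : ∀ i, ∫ y, conj (f i y) * (B y * u i y) = 0 := fun i => by
      refine integral_eq_zero_of_ae ?_
      have h2 := coeFn_toL2 B
      rw [hB0] at h2
      filter_upwards [h2, Lp.coeFn_zero ℂ 2 (volume : Measure (Space d))] with y h3 h4
      rw [← h3, h4]
      simp
    simp [h1, hB0]
  have hb : 0 < ‖toL2 d B‖ := norm_pos_iff.2 hB0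
  set X : ℝ := 2 * n + d with hX
  have hX1 : 1 ≤ X := by
    have : (1 : ℝ) ≤ d := by exact_mod_cast hd
    have : (0 : ℝ) ≤ n := by positivity
    linarith
  set R : ℝ := √X with hR
  have hR1 : 1 ≤ R := Real.one_le_sqrt.2 hX1
  have hRn : R ^ 2 = (2 * n + d : ℕ) := by
    rw [hR, Real.sq_sqrt (by linarith), hX]; push_cast; ring
  have hlX : 0 ≤ Real.log X := Real.log_nonneg hX1
  have hlR : Real.log R ≤ Real.log X := by
    rw [hR, Real.log_sqrt (by linarith)]
    linarith
  have h1 := hlow n R hR1 hRn N f a u hf ha hu h0 B hB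
  have h2 := hhigh R (by linarith) N f a _ hf ha (fun i => isHighPart_sub_lowPart R (hu i)) B
    (c * ‖toL2 d B‖) (mul_pos hc0 hb) (lintegral_weight_mul_fourier_sq_le (by linarith) hRn hB)
  have h3 : ∀ i, ‖∫ y, conj (f i y) * (B y * u i y)‖ₑ ≤
      ‖∫ y, conj (f i y) * (B y * lowPart R (u i) y)‖ₑ +
        ‖∫ y, conj (f i y) * (B y * (u i - lowPart R (u i) : L2 d) y)‖ₑ := fun i => by
    refine le_trans (le_of_eq ?_) (enorm_add_le _ _)
    rw [← integral_add (integrable_conj_mul_mul _ _ _) (integrable_conj_mul_mul _ _ _)]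
    congr 1
    refine integral_congr_ae ?_
    filter_upwards [Lp.coeFn_sub (u i) (lowPart R (u i))] with y hy
    rw [hy, Pi.sub_apply]
    ring
  have h4 : ∑ i, ‖∫ y, conj (f i y) * (B y * u i y)‖ₑ ≤
      ENNReal.ofReal (C₁ * √N * (√(1 + Real.log R) * ‖toL2 d B‖)) +
        ENNReal.ofReal (C₂ * √N * (c * ‖toL2 d B‖)) := by
    refine (Finset.sum_le_sum fun i _ => h3 i).trans ?_
    rw [Finset.sum_add_distrib]
    exact add_le_add h1 h2
  have hn1 : 0 ≤ C₁ * √N * (√(1 + Real.log R) * ‖toL2 d B‖) :=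
    mul_nonneg (by positivity) (mul_nonneg (Real.sqrt_nonneg _) hb.le)
  have hn2 : 0 ≤ C₂ * √N * (c * ‖toL2 d B‖) := mul_nonneg (by positivity) (mul_nonneg hc0.le hb.le)
  rw [← ENNReal.ofReal_add hn1 hn2] at h4
  simp only [← ofReal_norm] at h4
  rw [← ENNReal.ofReal_sum_of_nonneg fun i _ => norm_nonneg _,
    ENNReal.ofReal_le_ofReal_iff (add_nonneg hn1 hn2)] at h4
  refine h4.trans ?_
  have h5 : √(1 + Real.log R) ≤ √(1 + Real.log X) := Real.sqrt_le_sqrt (by linarith)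
  have h6 : 1 ≤ √(1 + Real.log X) := Real.one_le_sqrt.2 (by linarith)
  have h7 : 0 ≤ √(N : ℝ) := Real.sqrt_nonneg _
  generalize ‖toL2 d B‖ = b at *
  calc _ = C₁ * √N * b * √(1 + Real.log R) + C₂ * √N * c * b * 1 := by ring
    _ ≤ C₁ * √N * b * √(1 + Real.log X) + C₂ * √N * c * b * √(1 + Real.log X) := by gcongr
    _ = _ := by ring

/-! ### Dyadic summation -/

theorem norm_toL2_sum_sq {w : ℕ → 𝓢(Space d, ℂ)} (hw : ∀ n, w n ∈ hermiteSpace d n)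
    (s : Finset ℕ) : ‖toL2 d (∑ n ∈ s, w n)‖ ^ 2 = ∑ n ∈ s, ‖toL2 d (w n)‖ ^ 2 := by
  induction s using Finset.induction_on with
  | empty => simp
  | insert n s hn ih =>
    have h : inner ℂ (toL2 d (w n)) (toL2 d (∑ m ∈ s, w m)) = 0 := by
      rw [map_sum, inner_sum]
      refine Finset.sum_eq_zero fun m hm => ?_
      exact inner_hermiteSpace (by rintro rfl; exact hn hm) (hw n) (hw m)
    rw [Finset.sum_insert hn, Finset.sum_insert hn, map_add, ← ih, norm_add_sq (𝕜 := ℂ), h]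
    simp

theorem exp_one_le_log_level [NeZero d] (n : ℕ) : Real.exp 1 ≤ Real.log (level d n) := by
  have hd : (0 : ℝ) < d := by exact_mod_cast Nat.pos_of_ne_zero (NeZero.ne d)
  rw [← Real.log_exp (Real.exp 1)]
  refine Real.log_le_log (Real.exp_pos _) ?_
  rw [level, div_mul_eq_mul_div, le_div_iff₀ hd]
  gcongr
  have : (0 : ℝ) ≤ n := by positivity
  linarith

/-- The integer `j` with `2 ^ j ≤ log (level d n) < 2 ^ (j + 1)`. -/
def dyadicIndex (d n : ℕ) : ℕ := Nat.log 2 ⌊Real.log (level d n)⌋₊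

theorem two_le_log_level [NeZero d] (n : ℕ) : 2 ≤ Real.log (level d n) := by
  have := Real.exp_one_gt_d9
  linarith [exp_one_le_log_level (d := d) n]

theorem two_le_floor [NeZero d] (n : ℕ) : 2 ≤ ⌊Real.log (level d n)⌋₊ :=
  Nat.le_floor (by exact_mod_cast two_le_log_level n)

theorem one_le_dyadicIndex [NeZero d] (n : ℕ) : 1 ≤ dyadicIndex d n :=
  Nat.log_pos one_lt_two (two_le_floor n)

theorem two_pow_dyadicIndex_le [NeZero d] (n : ℕ) : 2 ^ dyadicIndex d n ≤ Real.log (level d n) := by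
  have h1 : 2 ^ dyadicIndex d n ≤ ⌊Real.log (level d n)⌋₊ :=
    Nat.pow_log_le_self 2 (by have := two_le_floor (d := d) n; omega)
  have h2 := Nat.floor_le (by linarith [two_le_log_level (d := d) n] : 0 ≤ Real.log (level d n))
  refine le_trans ?_ h2
  exact_mod_cast h1

theorem log_level_le_two_pow [NeZero d] (n : ℕ) :
    Real.log (level d n) ≤ 2 * 2 ^ dyadicIndex d n := by
  have h1 : ⌊Real.log (level d n)⌋₊ + 1 ≤ 2 ^ (dyadicIndex d n + 1) :=
    Nat.lt_pow_succ_log_self one_lt_two _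
  have h2 := Nat.lt_floor_add_one (Real.log (level d n))
  rw [← pow_succ']
  refine h2.le.trans ?_
  exact_mod_cast h1

/-- The logarithm of `level d n` is `e - log d + log(2n + d)`, so the block loss is comparable to `2
^ dyadicIndex d n` with a constant depending on `d`. -/
theorem log_two_mul_add_le [NeZero d] (n : ℕ) :
    1 + Real.log (2 * n + d) ≤ (3 + Real.log d) * 2 ^ dyadicIndex d n := by
  have hd1 : (1 : ℝ) ≤ d := by exact_mod_cast NeZero.one_le (n := d)
  have hn : (0 : ℝ) ≤ n := by positivity
  have h1 : Real.log (level d n) = Real.exp 1 - Real.log d + Real.log (2 * n + d) := by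
    rw [level, Real.log_mul (by positivity) (by positivity), Real.log_div (by positivity)
      (by positivity), Real.log_exp]
  have h2 := log_level_le_two_pow (d := d) n
  have h3 : (1 : ℝ) ≤ 2 ^ dyadicIndex d n := one_le_pow₀ (by norm_num)
  have h4 := Real.exp_pos 1
  have h5 := Real.log_nonneg hd1
  nlinarith

/-- Squared, the weight is `L (log L)^{1+2ε}` with `L = log (level d n)`. Here `2^j ≤ L`, and hence
`log L ≥ j log 2 ≥ j/2`, so the weight pays for `2^j` with a summable factor to spare. -/
theorem two_pow_mul_le [NeZero d] {ε : ℝ} (hε : 0 < ε) (n : ℕ) :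
    (2 : ℝ) ^ dyadicIndex d n ≤ ((dyadicIndex d n : ℝ) / 2) ^ (-(1 + 2 * ε)) *
      (Real.log (level d n) ^ (1 / 2 : ℝ) *
        Real.log (Real.log (level d n)) ^ (1 / 2 + ε)) ^ 2 := by
  set L := Real.log (level d n) with hL
  set j := dyadicIndex d n with hj
  have hL2 : 2 ≤ L := two_le_log_level n
  have hj1 : (1 : ℝ) ≤ j := by exact_mod_cast one_le_dyadicIndex n
  have h1 : (2 : ℝ) ^ j ≤ L := two_pow_dyadicIndex_le n
  have h2 : (j : ℝ) / 2 ≤ Real.log L := by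
    have h3 := Real.log_le_log (by positivity) h1
    rw [Real.log_pow] at h3
    have := Real.log_two_gt_d9
    nlinarith
  have h4 : 0 ≤ Real.log L := by linarith
  have h5 : (L ^ (1 / 2 : ℝ) * Real.log L ^ (1 / 2 + ε)) ^ 2 = L * Real.log L ^ (1 + 2 * ε) := by
    rw [mul_pow, ← Real.rpow_mul_natCast (by linarith), ← Real.rpow_mul_natCast h4]
    congr 1
    · norm_num
    · congr 1
      push_cast
      ring
  have h6 : ((j : ℝ) / 2) ^ (1 + 2 * ε) ≤ Real.log L ^ (1 + 2 * ε) :=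
    Real.rpow_le_rpow (by linarith) h2 (by linarith)
  have h7 : 0 < ((j : ℝ) / 2) ^ (1 + 2 * ε) := Real.rpow_pos_of_pos (by linarith) _
  rw [h5, Real.rpow_neg (by linarith), inv_mul_eq_div, le_div_iff₀ h7]
  exact mul_le_mul h1 h6 h7.le (by linarith)

/-- The block estimate summed over dyadic blocks. The constant is independent of `m`, as is needed
for the passage from partial sums to `v`. -/
theorem exists_sum_partial_le [NeZero d] {ε : ℝ} (hε : 0 < ε) : ∃ C : ℝ, 0 < C ∧
    ∀ (w : ℕ → 𝓢(Space d, ℂ)) (M : ℝ), (∀ n, w n ∈ hermiteSpace d n) →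
    HasSum (fun n => (Real.log (level d n) ^ (1 / 2 : ℝ) *
      Real.log (Real.log (level d n)) ^ (1 / 2 + ε)) ^ 2 * ‖toL2 d (w n)‖ ^ 2) M →
    ∀ (m N : ℕ) (f a u : Fin N → L2 d), IsBessel f → IsBessel a →
    (∀ i, IsRieszPotential (a i) (u i)) →
    (∀ i, ∫ ξ in Metric.ball (0 : Space d) 1, (𝓕 (u i) : L2 d) ξ = 0) →
    ∑ i, ‖∫ y, conj (f i y) * ((∑ n ∈ Finset.range m, w n) y * u i y)‖ ≤ C * √N * √M := by
  obtain ⟨C, hC, hblock⟩ := exists_block_le (d := d)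
  have hd1 : (1 : ℝ) ≤ d := by exact_mod_cast NeZero.one_le (n := d)
  have hld := Real.log_nonneg hd1
  -- Summable exactly because `ε > 0`. The value at `j = 0` is immaterial, since every `dyadicIndex`
  -- is at least `1`.
  set κ : ℕ → ℝ := fun j => ((j : ℝ) / 2) ^ (-(1 + 2 * ε)) with hκ
  have hκ0 : ∀ j, 0 ≤ κ j := fun j => by positivity
  have hκs : Summable κ := by
    have h1 : Summable fun j : ℕ => (j : ℝ) ^ (-(1 + 2 * ε)) :=
      Real.summable_nat_rpow.2 (by linarith)
    refine (h1.mul_right ((2 : ℝ) ^ (-(1 + 2 * ε)))⁻¹).congr fun j => ?_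
    simp only [hκ]
    rw [Real.div_rpow (by positivity) (by positivity), div_eq_mul_inv]
  set K : ℝ := ∑' j, κ j with hK
  have hK0 : 0 ≤ K := tsum_nonneg hκ0
  refine ⟨C * √(3 + Real.log d) * √(K + 1), by positivity, ?_⟩
  intro w M hw hM m N f a u hf ha hu h0
  set F : ℕ → ℝ := fun n => (Real.log (level d n) ^ (1 / 2 : ℝ) *
    Real.log (Real.log (level d n)) ^ (1 / 2 + ε)) ^ 2 with hF
  have hF0 : ∀ n, 0 ≤ F n := fun n => sq_nonneg _
  set J : Finset ℕ := (Finset.range m).image (dyadicIndex d) with hJ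
  set S : ℕ → Finset ℕ := fun j => (Finset.range m).filter fun n => dyadicIndex d n = j with hS
  have hmaps : ∀ n ∈ Finset.range m, dyadicIndex d n ∈ J := fun n hn => Finset.mem_image_of_mem _ hn
  set B : ℕ → 𝓢(Space d, ℂ) := fun j => ∑ n ∈ S j, w n with hB
  have hsum : ∑ n ∈ Finset.range m, w n = ∑ j ∈ J, B j :=
    (Finset.sum_fiberwise_of_maps_to hmaps _).symm
  set T : ℕ → ℝ := fun j => ∑ n ∈ S j, F n * ‖toL2 d (w n)‖ ^ 2 with hT
  have hT0 : ∀ j, 0 ≤ T j := fun j =>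
    Finset.sum_nonneg fun n _ => mul_nonneg (hF0 n) (sq_nonneg _)
  have hTM : ∑ j ∈ J, T j ≤ M := by
    rw [hT, Finset.sum_fiberwise_of_maps_to hmaps]
    exact sum_le_hasSum _ (fun n _ => mul_nonneg (hF0 n) (sq_nonneg _)) hM
  have hBn : ∀ j, 2 ^ j * ‖toL2 d (B j)‖ ^ 2 ≤ κ j * T j := fun j => by
    rw [hB, norm_toL2_sum_sq hw, hT, Finset.mul_sum, Finset.mul_sum]
    refine Finset.sum_le_sum fun n hn => ?_
    obtain rfl := (Finset.mem_filter.1 hn).2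
    rw [← mul_assoc]
    exact mul_le_mul_of_nonneg_right (two_pow_mul_le hε n) (sq_nonneg _)
  have hBj : ∀ j ∈ J, ∑ i, ‖∫ y, conj (f i y) * (B j y * u i y)‖ ≤
      C * √N * √(3 + Real.log d) * (√(κ j) * √(T j)) := fun j hj => by
    have hne : (S j).Nonempty := by
      obtain ⟨n, hn, rfl⟩ := Finset.mem_image.1 hj
      exact ⟨n, Finset.mem_filter.2 ⟨hn, rfl⟩⟩
    -- The block estimate is applied with the largest degree present in the block; its own dyadic
    -- index is still `j`.
    set n := (S j).max' hne with hn
    have hnj : dyadicIndex d n = j := (Finset.mem_filter.1 ((S j).max'_mem hne)).2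
    have hBP : B j ∈ polySpace d n := Submodule.sum_mem _ fun k hk =>
      hermiteSpace_le_polySpace ((S j).le_max' k hk) (hw k)
    refine (hblock n N f a u hf ha hu h0 (B j) hBP).trans ?_
    have h1 := log_two_mul_add_le (d := d) n
    rw [hnj] at h1
    have h2 := hBn j
    have h3 : √(1 + Real.log (2 * n + d)) * ‖toL2 d (B j)‖ ≤
        √(3 + Real.log d) * (√(κ j) * √(T j)) := by
      rw [← Real.sqrt_mul (hκ0 j)]
      calc _ ≤ √((3 + Real.log d) * 2 ^ j) * ‖toL2 d (B j)‖ :=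
            mul_le_mul_of_nonneg_right (Real.sqrt_le_sqrt h1) (norm_nonneg _)
        _ = √(3 + Real.log d) * √(2 ^ j * ‖toL2 d (B j)‖ ^ 2) := by
            rw [Real.sqrt_mul (by positivity), Real.sqrt_mul (by positivity),
              Real.sqrt_sq (norm_nonneg _)]
            ring
        _ ≤ _ := mul_le_mul_of_nonneg_left (Real.sqrt_le_sqrt h2) (Real.sqrt_nonneg _)
    calc _ ≤ C * √N * (√(3 + Real.log d) * (√(κ j) * √(T j))) :=
          mul_le_mul_of_nonneg_left h3 (by positivity)
      _ = _ := by ring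
  have hi : ∀ i, ‖∫ y, conj (f i y) * ((∑ n ∈ Finset.range m, w n) y * u i y)‖ ≤
      ∑ j ∈ J, ‖∫ y, conj (f i y) * (B j y * u i y)‖ := fun i => by
    refine le_trans (le_of_eq ?_) (norm_sum_le _ _)
    rw [← integral_finsetSum _ fun j _ => integrable_conj_mul_mul (f i) (u i) (B j), hsum]
    congr 1
    refine integral_congr_ae (.of_forall fun y => ?_)
    simp only [sum_apply, Finset.sum_mul, Finset.mul_sum]
  calc _ ≤ ∑ i, ∑ j ∈ J, ‖∫ y, conj (f i y) * (B j y * u i y)‖ := Finset.sum_le_sum fun i _ => hi i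
    _ = ∑ j ∈ J, ∑ i, ‖∫ y, conj (f i y) * (B j y * u i y)‖ := Finset.sum_comm
    _ ≤ ∑ j ∈ J, C * √N * √(3 + Real.log d) * (√(κ j) * √(T j)) := Finset.sum_le_sum hBj
    _ = C * √N * √(3 + Real.log d) * ∑ j ∈ J, √(κ j) * √(T j) := by rw [Finset.mul_sum]
    _ ≤ C * √N * √(3 + Real.log d) * (√(∑ j ∈ J, κ j) * √(∑ j ∈ J, T j)) := by
        gcongr
        exact Real.sum_sqrt_mul_sqrt_le _ hκ0 hT0
    _ ≤ C * √N * √(3 + Real.log d) * (√(K + 1) * √M) := by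
        gcongr
        linarith [hκs.sum_le_tsum J fun j _ => hκ0 j]
    _ = _ := by ring

/-! ### The quadratic form and its eigenvectors -/

/-- The map `u ↦ (2π|ξ|)^s û` on the form domain. -/
def kineticMap (s : ℝ) (V : Space d → ℝ) : formDomain s V →ₗ[ℂ] L2 d where
  toFun u := u.2.1.toLp
  map_add' u w := by
    rw [← MemLp.toLp_add]
    exact MemLp.toLp_congr _ _ (kineticRoot_add s (u : L2 d) w)
  map_smul' c u := by
    rw [RingHom.id_apply, ← MemLp.toLp_const_smul]
    exact MemLp.toLp_congr _ _ (kineticRoot_smul s c (u : L2 d))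

/-- The map `u ↦ V^{1/2} u` on the form domain. -/
def potentialMap (s : ℝ) (V : Space d → ℝ) : formDomain s V →ₗ[ℂ] L2 d where
  toFun u := u.2.2.toLp
  map_add' u w := by
    rw [← MemLp.toLp_add]
    exact MemLp.toLp_congr _ _ (potentialRoot_add V (u : L2 d) w)
  map_smul' c u := by
    rw [RingHom.id_apply, ← MemLp.toLp_const_smul]
    exact MemLp.toLp_congr _ _ (potentialRoot_smul V c (u : L2 d))

theorem coeFn_kineticMap {s : ℝ} {V : Space d → ℝ} (u : formDomain s V) :
    kineticMap s V u =ᵐ[volume] kineticRoot s (u : L2 d) := u.2.1.coeFn_toLp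

theorem coeFn_potentialMap {s : ℝ} {V : Space d → ℝ} (u : formDomain s V) :
    potentialMap s V u =ᵐ[volume] potentialRoot V (u : L2 d) := u.2.2.coeFn_toLp

theorem schrodingerForm_eq_inner {s : ℝ} {V : Space d → ℝ} (w u : formDomain s V) :
    schrodingerForm s V w u = inner ℂ (kineticMap s V w) (kineticMap s V u) -
      inner ℂ (potentialMap s V w) (potentialMap s V u) := by
  rw [schrodingerForm, ← inner_toLp_eq_integral w.2.1 u.2.1, ← inner_toLp_eq_integral w.2.2 u.2.2]
  rfl

theorem conj_schrodingerForm {s : ℝ} {V : Space d → ℝ} (w u : formDomain s V) :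
    conj (schrodingerForm s V w u) = schrodingerForm s V u w := by
  rw [schrodingerForm_eq_inner, schrodingerForm_eq_inner, map_sub, inner_conj_symm, inner_conj_symm]

theorem mem_eigenspace_schrodinger_iff {s : ℝ} (hs : 0 ≤ s) {V : Space d → ℝ}
    (hV : MemLp (fun x => ((√(V x) : ℝ) : ℂ)) 2 volume) {lam : ℝ} {u : L2 d} :
    u ∈ eigenspace (schrodinger s V) lam ↔ u ∈ formDomain s V ∧
      ∀ w ∈ formDomain s V, schrodingerForm s V w u = lam * inner ℂ w u := by
  have h : u ∈ eigenspace (schrodinger s V) lam ↔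
      (u, (lam : ℂ) • u) ∈ (schrodinger s V).graph := Iff.rfl
  rw [h, graph_schrodinger hs hV]
  have h2 : (u, (lam : ℂ) • u) ∈ schrodingerGraph s V ↔ u ∈ formDomain s V ∧
      ∀ w ∈ formDomain s V, schrodingerForm s V w u = inner ℂ w ((lam : ℂ) • u) := Iff.rfl
  simp only [h2, inner_smul_right]

theorem inner_eigenspace_schrodinger {s : ℝ} (hs : 0 ≤ s) {V : Space d → ℝ}
    (hV : MemLp (fun x => ((√(V x) : ℝ) : ℂ)) 2 volume) {lam mu : ℝ} (hne : lam ≠ mu) {u w : L2 d}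
    (hu : u ∈ eigenspace (schrodinger s V) lam) (hw : w ∈ eigenspace (schrodinger s V) mu) :
    inner ℂ u w = 0 := by
  rw [mem_eigenspace_schrodinger_iff hs hV] at hu hw
  have h1 := hw.2 u hu.1
  have h2 := hu.2 w hw.1
  have h3 := conj_schrodingerForm (s := s) (V := V) ⟨w, hw.1⟩ ⟨u, hu.1⟩
  simp only at h3
  rw [h1, h2, map_mul, Complex.conj_ofReal, inner_conj_symm] at h3
  have h4 : ((lam - mu : ℝ) : ℂ) * inner ℂ u w = 0 := by
    push_cast
    linear_combination h3
  rcases mul_eq_zero.1 h4 with h5 | h5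
  · exact absurd (sub_eq_zero.1 (by exact_mod_cast h5)) hne
  · exact h5

/-! ### Linear algebra -/

/-- `K ∘ P⁻¹` is a contraction on the range of `P`. Pulling back an orthonormal basis of `P (ker
l)`, the vectors `K (c i)` are its images under a contraction, hence a Bessel family. The kernel of
`l` has codimension at most one. -/
theorem exists_orthonormal_of_contraction {E H : Type*} [AddCommGroup E] [Module ℂ E]
    [FiniteDimensional ℂ E] [NormedAddCommGroup H] [InnerProductSpace ℂ H] {K P : E →ₗ[ℂ] H}
    (hP : Function.Injective P) (hK : ∀ c, ‖K c‖ ≤ ‖P c‖) (l : E →ₗ[ℂ] ℂ) :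
    ∃ (N : ℕ) (c : Fin N → E), Module.finrank ℂ E ≤ N + 1 ∧ (∀ i, l (c i) = 0) ∧
      Orthonormal ℂ (fun i => P (c i)) ∧
      ∀ h : H, ∑ i, ‖inner ℂ (K (c i)) h‖ ^ 2 ≤ ‖h‖ ^ 2 := by
  set W : Submodule ℂ E := LinearMap.ker l with hW
  set Q : Submodule ℂ H := W.map P with hQ
  have hfin : Module.finrank ℂ Q = Module.finrank ℂ W :=
    (LinearEquiv.finrank_eq (Submodule.equivMapOfInjective P hP W)).symm
  have hrk : Module.finrank ℂ (LinearMap.range l) ≤ 1 := by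
    simpa using Submodule.finrank_le (LinearMap.range l)
  have hrn : Module.finrank ℂ (LinearMap.range l) + Module.finrank ℂ W = Module.finrank ℂ E :=
    LinearMap.finrank_range_add_finrank_ker l
  let b := stdOrthonormalBasis ℂ Q
  have hc : ∀ i, ∃ c ∈ W, P c = b i := fun i => (b i).2
  choose c hcW hcP using hc
  have hon : Orthonormal ℂ (fun i => P (c i)) := by
    simp only [hcP]
    exact b.orthonormal.comp_linearIsometry Q.subtypeₗᵢ
  refine ⟨Module.finrank ℂ Q, c, by omega, fun i => hcW i, hon, fun h => ?_⟩
  -- Testing on `∑ z i • c i` is duality: it gives `S ≤ ‖P (∑ z i • c i)‖ ‖h‖ = √S ‖h‖`.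
  set z : Fin (Module.finrank ℂ Q) → ℂ := fun i => inner ℂ (K (c i)) h with hz
  set S : ℝ := ∑ i, ‖z i‖ ^ 2 with hS
  have hS0 : 0 ≤ S := Finset.sum_nonneg fun i _ => sq_nonneg _
  have h1 : ‖P (∑ i, z i • c i)‖ ^ 2 = S := by
    have h2 : P (∑ i, z i • c i) = ∑ i, z i • P (c i) := by simp
    have h3 := hon.inner_sum z z Finset.univ
    rw [h2, norm_sq_eq_re_inner (𝕜 := ℂ), h3, map_sum]
    refine Finset.sum_congr rfl fun i _ => ?_
    rw [Complex.conj_mul', ← Complex.ofReal_pow]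
    rfl
  have h5 : inner ℂ (K (∑ i, z i • c i)) h = (S : ℂ) := by
    rw [map_sum, sum_inner, hS]
    push_cast
    refine Finset.sum_congr rfl fun i _ => ?_
    rw [map_smul, inner_smul_left, mul_comm]
    exact Complex.mul_conj' (z i)
  have h6 : S ≤ ‖P (∑ i, z i • c i)‖ * ‖h‖ := by
    have h7 := norm_inner_le_norm (𝕜 := ℂ) (K (∑ i, z i • c i)) h
    rw [h5, Complex.norm_real, Real.norm_of_nonneg hS0] at h7
    exact h7.trans (mul_le_mul_of_nonneg_right (hK _) (norm_nonneg _))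
  have h8 : S ^ 2 ≤ S * ‖h‖ ^ 2 := by
    calc S ^ 2 ≤ (‖P (∑ i, z i • c i)‖ * ‖h‖) ^ 2 := by gcongr
      _ = _ := by rw [mul_pow, h1]
  rcases hS0.eq_or_lt with h9 | h9
  · rw [← h9]; positivity
  · rw [sq] at h8
    exact le_of_mul_le_mul_left h8 h9

theorem isBessel_of_norm {ι : Type*} [Fintype ι] {a : ι → L2 d}
    (h : ∀ g : L2 d, ∑ i, ‖inner ℂ (a i) g‖ ^ 2 ≤ ‖g‖ ^ 2) : IsBessel a := fun g => by
  simp only [← ofReal_norm, ← ENNReal.ofReal_pow (norm_nonneg _)]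
  rw [← ENNReal.ofReal_sum_of_nonneg fun i _ => sq_nonneg _]
  exact ENNReal.ofReal_le_ofReal (h g)

theorem isBessel_of_orthonormal {ι : Type*} [Fintype ι] {a : ι → L2 d} (ha : Orthonormal ℂ a) :
    IsBessel a :=
  isBessel_of_norm fun g => ha.sum_inner_products_le g

/-- The indicator function of the unit ball. -/
def unitBallIndicator (d : ℕ) : L2 d :=
  indicatorConstLp 2 (measurableSet_ball (x := (0 : Space d)) (ε := 1)) measure_ball_lt_top.ne (1 : ℂ)

/-- The integral of the Fourier transform over the unit ball. -/
def lowFunctional (d : ℕ) : L2 d →ₗ[ℂ] ℂ :=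
  (innerSL ℂ (unitBallIndicator d) : L2 d →ₗ[ℂ] ℂ) ∘ₗ
    ((Lp.fourierTransformₗᵢ (Space d) ℂ).toLinearEquiv : L2 d →ₗ[ℂ] L2 d)

theorem lowFunctional_apply (u : L2 d) :
    lowFunctional d u = ∫ ξ in Metric.ball (0 : Space d) 1, (𝓕 u : L2 d) ξ := by
  have h : lowFunctional d u = inner ℂ (unitBallIndicator d) (𝓕 u : L2 d) := rfl
  rw [h, unitBallIndicator, L2.inner_indicatorConstLp_one]

/-- The two powers of `2π|ξ|` cancel away from `ξ = 0`, a null set because `d ≥ 1`. -/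
theorem isRieszPotential_kineticMap [NeZero d] {V : Space d → ℝ}
    (u : formDomain ((d : ℝ) / 2) V) : IsRieszPotential (kineticMap ((d : ℝ) / 2) V u) (u : L2 d) := by
  have hpi := Real.pi_pos
  have hae : ∀ᵐ p : Space d, p ≠ 0 := Measure.ae_ne volume 0
  rw [IsRieszPotential]
  filter_upwards [coeFn_kineticMap u, hae] with ξ h1 h2
  have h3 : 0 < ‖ξ‖ := norm_pos_iff.2 h2
  rw [h1, kineticRoot, rieszMultiplier, ← mul_assoc, ← Complex.ofReal_mul,
    ← Real.rpow_add (by positivity), neg_add_cancel, Real.rpow_zero]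
  simp

/-! ### Truncation -/

/-- The product of a square integrable function with an indicator function. -/
def truncate {S : Set (Space d)} (hS : MeasurableSet S) (f : L2 d) : L2 d :=
  ((Lp.memLp f).indicator hS).toLp _

theorem coeFn_truncate {S : Set (Space d)} (hS : MeasurableSet S) (f : L2 d) :
    truncate hS f =ᵐ[volume] S.indicator f := ((Lp.memLp f).indicator hS).coeFn_toLp

/-- Cutting off destroys orthonormality but not Bessel's inequality, since the cut-off can be moved
to the test function. -/
theorem IsBessel.truncate {ι : Type*} [Fintype ι] {a : ι → L2 d} (ha : IsBessel a)
    {S : Set (Space d)} (hS : MeasurableSet S) : IsBessel fun i => truncate hS (a i) := fun g => by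
  have h1 : ∀ i, ‖inner ℂ (BoundStates.truncate hS (a i)) g‖ₑ =
      ‖∫ y, star (S.indicator (g : Space d → ℂ)) y * a i y‖ₑ := fun i => by
    rw [inner_eq_integral, ← RCLike.enorm_conj, ← integral_conj]
    congr 1
    refine integral_congr_ae ?_
    filter_upwards [coeFn_truncate hS (a i)] with y hy
    rw [hy]
    by_cases h : y ∈ S <;> simp [h, mul_comm]
  simp only [h1]
  refine (ha.sum_enorm_integral_sq_le ((Lp.memLp g).indicator hS).star).trans ?_
  rw [enorm_sq_eq_lintegral]
  refine lintegral_mono fun y => ?_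
  by_cases h : y ∈ S <;> simp [h]

/-- Passage from partial sums to `v`, whose expansion converges only in `L²`. On `S` the `u i` are
bounded, so `conj (u i) * g i` is square integrable there and pairing with it is continuous; in the
limit it gives `∫_S |g i|²`. -/
theorem sum_setIntegral_le {N : ℕ} {u g : Fin N → L2 d} {v : L2 d}
    (hg : ∀ i, g i =ᵐ[volume] fun y => v y * u i y)
    (hv : ∀ᵐ y, conj (v y) = v y) {w : ℕ → 𝓢(Space d, ℂ)}
    (hw : HasSum (fun n => toL2 d (w n)) v) {S : Set (Space d)} (hS : MeasurableSet S) {k : ℝ}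
    (hk0 : 0 ≤ k) (hk : ∀ i, ∀ y ∈ S, ‖u i y‖ ≤ k) {D : ℝ}
    (hD : ∀ m, ∑ i, ‖∫ y, conj (truncate hS (g i) y) *
      ((∑ n ∈ Finset.range m, w n) y * u i y)‖ ≤ D) :
    ∑ i, ∫ y in S, ‖g i y‖ ^ 2 ≤ D := by
  have hHm : ∀ i, MemLp (S.indicator fun y => conj (u i y) * g i y) 2 volume := fun i => by
    refine MemLp.of_le_mul (c := k) (Lp.memLp (g i)) ?_ (.of_forall fun y => ?_)
    · exact ((Lp.aestronglyMeasurable (u i)).star.mul (Lp.aestronglyMeasurable (g i))).indicator hS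
    · by_cases h : y ∈ S
      · rw [Set.indicator_of_mem h, norm_mul, RCLike.norm_conj]
        exact mul_le_mul_of_nonneg_right (hk i y h) (norm_nonneg _)
      · rw [Set.indicator_of_notMem h, norm_zero]
        positivity
  set H : Fin N → L2 d := fun i => (hHm i).toLp _ with hH
  have hHae : ∀ i, H i =ᵐ[volume] S.indicator fun y => conj (u i y) * g i y := fun i =>
    (hHm i).coeFn_toLp
  have h1 : ∀ i, inner ℂ (H i) v = ((∫ y in S, ‖g i y‖ ^ 2 : ℝ) : ℂ) := fun i => by
    rw [inner_eq_integral, ← integral_complex_ofReal, ← integral_indicator hS]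
    refine integral_congr_ae ?_
    filter_upwards [hHae i, hg i, hv] with y h2 h3 h4
    rw [h2]
    by_cases h : y ∈ S
    · rw [Set.indicator_of_mem h, Set.indicator_of_mem h, map_mul, Complex.conj_conj,
        Complex.ofReal_pow, ← Complex.conj_mul', h3, map_mul, h4]
      ring
    · simp [h]
  have h2 : ∀ i m, inner ℂ (H i) (∑ n ∈ Finset.range m, toL2 d (w n)) =
      ∫ y, conj (truncate hS (g i) y) * ((∑ n ∈ Finset.range m, w n) y * u i y) := fun i m => by
    rw [← map_sum, inner_eq_integral]
    refine integral_congr_ae ?_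
    filter_upwards [hHae i, coeFn_truncate hS (g i), coeFn_toL2 (∑ n ∈ Finset.range m, w n)]
      with y h3 h4 h5
    rw [h3, h4, h5]
    by_cases h : y ∈ S
    · rw [Set.indicator_of_mem h, Set.indicator_of_mem h, map_mul, Complex.conj_conj]
      ring
    · simp [h]
  have h3 : ∀ i, Filter.Tendsto (fun m => ‖inner ℂ (H i) (∑ n ∈ Finset.range m, toL2 d (w n))‖)
      Filter.atTop (nhds ‖inner ℂ (H i) v‖) := fun i =>
    ((continuous_const.inner continuous_id).norm.tendsto v).comp hw.tendsto_sum_nat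
  have h4 : ∑ i, ‖inner ℂ (H i) v‖ ≤ D := by
    refine le_of_tendsto' (tendsto_finsetSum _ fun i _ => h3 i) fun m => ?_
    simp only [h2]
    exact hD m
  refine le_trans (Finset.sum_le_sum fun i _ => ?_) h4
  rw [h1, Complex.norm_real]
  exact le_abs_self _

/-- The sets where all `|u i| ≤ k` exhaust the space as `k → ∞`, and the masses of the normalised `g
i` on them tend to `1`. -/
theorem card_le_of_truncated_le {N : ℕ} {u g : Fin N → L2 d} (hg1 : ∀ i, ‖g i‖ = 1) {D : ℝ}
    (hD : ∀ (S : Set (Space d)), MeasurableSet S → ∀ k : ℝ, 0 ≤ k →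
      (∀ i, ∀ y ∈ S, ‖u i y‖ ≤ k) → ∑ i, ∫ y in S, ‖g i y‖ ^ 2 ≤ D) : (N : ℝ) ≤ D := by
  set S : ℕ → Set (Space d) := fun k => {y | ∀ i, ‖u i y‖ ≤ k} with hS
  have hSm : ∀ k, MeasurableSet (S k) := fun k => by
    have h1 : S k = ⋂ i, {y | ‖u i y‖ ≤ k} := by ext y; simp [hS]
    rw [h1]
    exact MeasurableSet.iInter fun i => measurableSet_le
      (Lp.stronglyMeasurable (u i)).measurable.norm measurable_const
  have hmono : Monotone S := fun k l hkl y hy i => (hy i).trans (by exact_mod_cast hkl)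
  have hU : ⋃ k, S k = Set.univ := by
    refine Set.eq_univ_of_forall fun y => Set.mem_iUnion.2 ?_
    obtain ⟨k, hk⟩ := exists_nat_ge (∑ i, ‖u i y‖)
    exact ⟨k, fun i => (Finset.single_le_sum (f := fun i => ‖u i y‖) (fun _ _ => norm_nonneg _)
      (Finset.mem_univ i)).trans hk⟩
  have h1 : ∀ i, Filter.Tendsto (fun k => ∫ y in S k, ‖g i y‖ ^ 2) Filter.atTop (nhds 1) :=
    fun i => by
    have h2 := tendsto_setIntegral_of_monotone (μ := volume) (f := fun y => ‖g i y‖ ^ 2) hSm hmono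
      (((memLp_two_iff_integrable_sq_norm (Lp.aestronglyMeasurable _)).1
        (Lp.memLp (g i))).integrableOn)
    rw [hU, setIntegral_univ] at h2
    have h3 : ∫ y, ‖g i y‖ ^ 2 = 1 := by
      have h4 := inner_eq_integral (g i) (g i)
      rw [inner_self_eq_norm_sq_to_K, hg1] at h4
      simp only [Complex.conj_mul'] at h4
      have h5 : ((∫ y, ‖g i y‖ ^ 2 : ℝ) : ℂ) = 1 := by
        rw [← integral_complex_ofReal]
        push_cast
        rw [← h4]
        simp
      exact_mod_cast h5
    rwa [h3] at h2
  have h5 := le_of_tendsto' (tendsto_finsetSum Finset.univ fun i _ => h1 i)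
    fun k => hD (S k) (hSm k) k (by positivity) fun i y hy => hy i
  simpa using h5

/-! ### Counting eigenvalues -/

theorem exists_orthonormal_of_le_rank {H : Type*} [NormedAddCommGroup H] [InnerProductSpace ℂ H]
    {F : Submodule ℂ H} {k : ℕ} (hk : (k : ℕ∞) ≤ (Module.rank ℂ F).toENat) :
    ∃ v : Fin k → H, Orthonormal ℂ v ∧ ∀ j, v j ∈ F := by
  obtain ⟨t, ht, hl⟩ := le_rank_iff_exists_linearIndependent_finset.1
    (Cardinal.natCast_le_toENat.1 hk)
  set G : Submodule ℂ F := Submodule.span ℂ (t : Set F) with hG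
  have hfin : Module.finrank ℂ G = k := by
    rw [← ht]
    exact finrank_span_finset_eq_card hl
  have : FiniteDimensional ℂ G := FiniteDimensional.span_finset ℂ t
  let b := (stdOrthonormalBasis ℂ G).reindex (finCongr hfin)
  refine ⟨fun j => ((b j : F) : H), ?_, fun j => (b j : F).2⟩
  exact (b.orthonormal.comp_linearIsometry G.subtypeₗᵢ).comp_linearIsometry F.subtypeₗᵢ

/-- Bases of finitely many eigenspaces combine, by orthogonality, into one orthonormal family of
eigenvectors, to which the hypothesis applies. -/
theorem numNegEigenvalues_le {H : Type*} [NormedAddCommGroup H] [InnerProductSpace ℂ H]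
    {A : H →ₗ.[ℂ] H} (hA : ∀ lam mu : ℝ, lam ≠ mu → ∀ u ∈ eigenspace A lam, ∀ w ∈ eigenspace A mu,
      inner ℂ u w = 0) {X : ℝ} (hX : 0 ≤ X)
    (h : ∀ (N : ℕ) (e : Fin N → H) (lam : Fin N → ℝ), Orthonormal ℂ e → (∀ i, lam i < 0) →
      (∀ i, e i ∈ eigenspace A (lam i)) → (N : ℝ) ≤ 1 + X) :
    numNegEigenvalues A ≤ 1 + ENNReal.ofReal X := by
  set r : Set.Iio (0 : ℝ) → ℕ∞ := fun lam => (Module.rank ℂ (eigenspace A lam)).toENat with hr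
  have key : ∀ (s : Finset (Set.Iio (0 : ℝ))) (k : Set.Iio (0 : ℝ) → ℕ),
      (∀ lam ∈ s, (k lam : ℕ∞) ≤ r lam) → ((∑ lam ∈ s, k lam : ℕ) : ℝ) ≤ 1 + X := by
    intro s k hk
    have h1 : ∀ lam : s, ∃ v : Fin (k lam) → H, Orthonormal ℂ v ∧ ∀ j, v j ∈ eigenspace A lam.1 :=
      fun lam => exists_orthonormal_of_le_rank (hk lam.1 lam.2)
    choose v hv hve using h1
    set E : (Σ lam : s, Fin (k lam)) → H := fun p => v p.1 p.2 with hE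
    have hEo : Orthonormal ℂ E := by
      refine ⟨fun p => (hv p.1).1 p.2, ?_⟩
      rintro ⟨lam, j⟩ ⟨mu, j'⟩ hne
      by_cases hlm : lam = mu
      · subst hlm
        exact (hv lam).2 fun hj => hne (congrArg (Sigma.mk lam) hj)
      · refine hA lam mu (fun h' => hlm (Subtype.ext (Subtype.ext h'))) _ (hve lam j) _ (hve mu j')
    have hcard : Fintype.card (Σ lam : s, Fin (k lam)) = ∑ lam ∈ s, k lam := by
      rw [Fintype.card_sigma]
      simp only [Fintype.card_fin]
      exact Finset.sum_coe_sort s k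
    let eq := Fintype.equivFinOfCardEq hcard
    exact h _ (E ∘ eq.symm) (fun i => ((eq.symm i).1 : Set.Iio (0 : ℝ)))
      (hEo.comp _ eq.symm.injective) (fun i => (eq.symm i).1.1.2) fun i => hve _ _
  rw [numNegEigenvalues, ENNReal.tsum_eq_iSup_sum]
  refine iSup_le fun s => ?_
  -- An infinite-dimensional eigenspace would supply families of every size, contradicting the
  -- bound.
  have hfin : ∀ lam ∈ s, r lam ≠ ⊤ := by
    intro lam hlam htop
    obtain ⟨m, hm⟩ := exists_nat_gt (1 + X)
    have h2 := key {lam} (fun _ => m) fun mu hmu => by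
      rw [Finset.mem_singleton.1 hmu, htop]
      exact le_top
    rw [Finset.sum_singleton] at h2
    linarith
  have h3 := key s (fun lam => (r lam).toNat) fun lam hlam => by
    rw [ENat.natCast_toNat (hfin lam hlam)]
  calc ∑ lam ∈ s, ((r lam : ℕ∞) : ℝ≥0∞) = ∑ lam ∈ s, (((r lam).toNat : ℕ) : ℝ≥0∞) := by
        refine Finset.sum_congr rfl fun lam hlam => ?_
        conv_lhs => rw [← ENat.natCast_toNat (hfin lam hlam)]
        rfl
    _ = ENNReal.ofReal ((∑ lam ∈ s, (r lam).toNat : ℕ) : ℝ) := by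
        rw [ENNReal.ofReal_natCast]
        push_cast
        rfl
    _ ≤ ENNReal.ofReal (1 + X) := ENNReal.ofReal_le_ofReal h3
    _ = _ := by rw [ENNReal.ofReal_add zero_le_one hX, ENNReal.ofReal_one]

/-! ### The form on negative eigenvectors, and the final count -/

theorem norm_kineticMap_sq_sub {s : ℝ} (hs : 0 ≤ s) {V : Space d → ℝ}
    (hV : MemLp (fun x => ((√(V x) : ℝ) : ℂ)) 2 volume) {N : ℕ} {e : Fin N → formDomain s V}
    {lam : Fin N → ℝ} (he : Orthonormal ℂ fun i => (e i : L2 d))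
    (hlam : ∀ i, (e i : L2 d) ∈ eigenspace (schrodinger s V) (lam i)) (c : Fin N → ℂ) :
    ‖kineticMap s V (∑ i, c i • e i)‖ ^ 2 - ‖potentialMap s V (∑ i, c i • e i)‖ ^ 2 =
      ∑ i, lam i * ‖c i‖ ^ 2 := by
  set U : formDomain s V := ∑ i, c i • e i with hU
  have h1 : ∀ i, schrodingerForm s V U (e i) = lam i * conj (c i) := fun i => by
    rw [((mem_eigenspace_schrodinger_iff hs hV).1 (hlam i)).2 U U.2]
    congr 1
    have h2 : (U : L2 d) = ∑ i, c i • (e i : L2 d) := by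
      rw [hU]
      push_cast
      rfl
    rw [h2]
    exact he.inner_left_fintype c i
  have h3 : schrodingerForm s V U U = ∑ i, c i * schrodingerForm s V U (e i) := by
    simp only [schrodingerForm_eq_inner, mul_sub, Finset.sum_sub_distrib]
    have h4 : ∀ T : formDomain s V →ₗ[ℂ] L2 d, inner ℂ (T U) (T U) =
        ∑ i, c i * inner ℂ (T U) (T (e i)) := fun T => by
      conv_lhs => rw [hU, map_sum, inner_sum]
      refine Finset.sum_congr rfl fun i _ => ?_
      rw [map_smul, inner_smul_right, ← map_sum]
    rw [h4, h4]
  rw [schrodingerForm_eq_inner, inner_self_eq_norm_sq_to_K, inner_self_eq_norm_sq_to_K] at h3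
  have h5 : ((‖kineticMap s V U‖ ^ 2 - ‖potentialMap s V U‖ ^ 2 : ℝ) : ℂ) =
      ((∑ i, lam i * ‖c i‖ ^ 2 : ℝ) : ℂ) := by
    push_cast
    refine h3.trans (Finset.sum_congr rfl fun i _ => ?_)
    rw [h1, mul_left_comm, Complex.mul_conj']
  exact_mod_cast h5

theorem exists_card_eigenvectors_le [NeZero d] {ε : ℝ} (hε : 0 < ε) : ∃ C : ℝ, 0 < C ∧
    ∀ (V : Space d → ℝ) (hv : MemLp (fun x => ((√(V x) : ℝ) : ℂ)) 2 volume)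
      (hdom : hv.toLp (fun x => ((√(V x) : ℝ) : ℂ)) ∈ (logWeight d ε).domain)
      (N : ℕ) (e : Fin N → L2 d) (lam : Fin N → ℝ), Orthonormal ℂ e → (∀ i, lam i < 0) →
      (∀ i, e i ∈ eigenspace (schrodinger ((d : ℝ) / 2) V) (lam i)) →
      (N : ℝ) ≤ 1 + C * ‖logWeight d ε ⟨hv.toLp (fun x => ((√(V x) : ℝ) : ℂ)), hdom⟩‖ ^ 2 := by
  obtain ⟨C, hC, hpart⟩ := exists_sum_partial_le (d := d) hε
  refine ⟨C ^ 2, by positivity, ?_⟩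
  intro V hv hdom N e lam he hlam0 hlam
  set s : ℝ := (d : ℝ) / 2 with hs
  have hs0 : 0 ≤ s := by positivity
  set v : L2 d := hv.toLp (fun x => ((√(V x) : ℝ) : ℂ)) with hvdef
  set M : ℝ := ‖logWeight d ε ⟨v, hdom⟩‖ ^ 2 with hM
  obtain ⟨w, hw, hwv, hwM⟩ := exists_hermite_expansion (NeZero.one_le (n := d)) _ v hdom
  have hvae : v =ᵐ[volume] fun x => ((√(V x) : ℝ) : ℂ) := hv.coeFn_toLp
  have heD : ∀ i, e i ∈ formDomain s V := fun i =>
    ((mem_eigenspace_schrodinger_iff hs0 hv).1 (hlam i)).1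
  set e' : Fin N → formDomain s V := fun i => ⟨e i, heD i⟩ with he'
  set L : (Fin N → ℂ) →ₗ[ℂ] formDomain s V := Fintype.linearCombination ℂ e' with hL
  set K : (Fin N → ℂ) →ₗ[ℂ] L2 d := kineticMap s V ∘ₗ L with hK
  set P : (Fin N → ℂ) →ₗ[ℂ] L2 d := potentialMap s V ∘ₗ L with hP
  have hq : ∀ c, ‖K c‖ ^ 2 - ‖P c‖ ^ 2 = ∑ i, lam i * ‖c i‖ ^ 2 := fun c =>
    norm_kineticMap_sq_sub (e := e') hs0 hv he hlam c
  have hneg : ∀ (c : Fin N → ℂ) i, lam i * ‖c i‖ ^ 2 ≤ 0 := fun c i =>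
    mul_nonpos_of_nonpos_of_nonneg (hlam0 i).le (sq_nonneg _)
  have hKP : ∀ c, ‖K c‖ ≤ ‖P c‖ := fun c => by
    have h1 := hq c
    have h2 : ∑ i, lam i * ‖c i‖ ^ 2 ≤ 0 := Finset.sum_nonpos fun i _ => hneg c i
    exact (pow_le_pow_iff_left₀ (norm_nonneg _) (norm_nonneg _) two_ne_zero).1 (by linarith)
  have hPi : Function.Injective P := by
    rw [← LinearMap.ker_eq_bot, LinearMap.ker_eq_bot']
    intro c hc
    have h1 := hq c
    rw [hc, norm_zero, zero_pow two_ne_zero, sub_zero] at h1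
    have h2 : ∑ i, lam i * ‖c i‖ ^ 2 = 0 :=
      le_antisymm (Finset.sum_nonpos fun i _ => hneg c i) (h1 ▸ sq_nonneg _)
    have h3 := (Finset.sum_eq_zero_iff_of_nonpos fun i _ => hneg c i).1 h2
    ext i
    have h4 := h3 i (Finset.mem_univ i)
    simpa [(hlam0 i).ne] using h4
  -- The one discarded dimension makes the integral of the Fourier transform over the unit ball
  -- vanish, as the low-frequency estimate requires.
  obtain ⟨N', c, hN', hl, hon, hbes⟩ := exists_orthonormal_of_contraction hPi hKP
    (lowFunctional d ∘ₗ (formDomain s V).subtype ∘ₗ L)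
  rw [Module.finrank_fin_fun] at hN'
  set u : Fin N' → L2 d := fun i => (L (c i) : L2 d) with hu
  set g : Fin N' → L2 d := fun i => P (c i) with hg
  have hbound : (N' : ℝ) ≤ C * √N' * √M := by
    refine card_le_of_truncated_le (u := u) (g := g) (fun i => hon.1 i) ?_
    intro S hS k hk0 hk
    refine sum_setIntegral_le (v := v) (fun i => ?_) ?_ hwv hS hk0 hk fun m => ?_
    · filter_upwards [coeFn_potentialMap (L (c i)), hvae] with y h1 h2
      have h3 : g i = potentialMap s V (L (c i)) := rfl
      rw [h3, h1, h2]
      rfl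
    · filter_upwards [hvae] with y hy
      rw [hy, Complex.conj_ofReal]
    · refine hpart w M hw hwM m N' _ (fun i => K (c i)) u
        ((isBessel_of_orthonormal hon).truncate hS) (isBessel_of_norm hbes)
        (fun i => isRieszPotential_kineticMap (L (c i))) fun i => ?_
      rw [← lowFunctional_apply]
      exact hl i
  have hM0 : 0 ≤ M := sq_nonneg _
  -- The estimate `N' ≤ C √N' √M` bounds `N'` by itself: divide by `√N'` and square.
  have h1 : (N' : ℝ) ≤ C ^ 2 * M := by
    have h2 : √(N' : ℝ) ^ 2 = N' := Real.sq_sqrt (by positivity)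
    have h3 : √M ^ 2 = M := Real.sq_sqrt hM0
    rw [← h2] at hbound ⊢
    rw [← h3, ← mul_pow]
    refine pow_le_pow_left₀ (Real.sqrt_nonneg _) ?_ 2
    rcases (Real.sqrt_nonneg (N' : ℝ)).eq_or_lt with h4 | h4
    · rw [← h4]; positivity
    · rw [h2] at hbound
      refine le_of_mul_le_mul_left ?_ h4
      nlinarith
  have h5 : (N : ℝ) ≤ N' + 1 := by exact_mod_cast hN'
  linarith

end BoundStates

end

theorem mainTheorem2 (d : ℕ) (hd : 1 ≤ d) (ε : ℝ) (hε : 0 < ε) :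
    ∃ C : ℝ, 0 < C ∧
      ∀ (V : EuclideanSpace ℝ (Fin d) → ℝ), (∀ᵐ x ∂volume, 0 ≤ V x) →
        ∀ (hv : MemLp (fun x => ((√(V x) : ℝ) : ℂ)) 2 volume)
          (hdom : hv.toLp (fun x => ((√(V x) : ℝ) : ℂ)) ∈ (BoundStates.logWeight d ε).domain),
          BoundStates.numNegEigenvalues (BoundStates.schrodinger ((d : ℝ) / 2) V) ≤
            1 + ENNReal.ofReal (C *
              ‖BoundStates.logWeight d ε
                ⟨hv.toLp (fun x => ((√(V x) : ℝ) : ℂ)), hdom⟩‖ ^ 2) := by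
  have : NeZero d := ⟨by omega⟩
  obtain ⟨C, hC, h⟩ := BoundStates.exists_card_eigenvectors_le (d := d) hε
  refine ⟨C, hC, fun V _ hv hdom => BoundStates.numNegEigenvalues_le ?_ (by positivity)
    (h V hv hdom)⟩
  exact fun lam mu hne u hu w hw =>
    BoundStates.inner_eigenspace_schrodinger (by positivity) hv hne hu hw
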